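/- Let $d,m$ be integers with $d\ge 1$, let $r\in\mathbb R$, let $\mathbb T^d=(\mathbb R/2\pi\mathbb Z)^d$, and assume $2m>4+\frac d2$, $2r>2+\frac d2$. For $f^0:\mathbb T^d\times\mathbb R^d\to\mathbb R$ let $$\|f^0\|_{\mathcal H^{2m}_{2r}}=\Big(\sum_{|\alpha|+|\beta|\le 2m}\int_{\mathbb T^d}\int_{\mathbb R^d}(1+|v|^2)^{2r}\,|\partial_x^\alpha\partial_v^\beta f^0|^2\,dv\,dx\Big)^{1/2},$$ with weak derivatives, and let $\mathcal H^{2m}_{2r}$ be the space of functions for which it is finite. For a velocity profile $\mathbf f$ on $\mathbb R^d$ and $\gamma>0$, $\tau\in\mathbb R$, $\eta\in\mathbb R^d\setminus\{0\}$ put $$\mathcal P(\gamma,\tau,\eta,\mathbf f)=1-\int_0^{+\infty}e^{-(\gamma+i\tau)s}\,\frac{i\eta}{1+|\eta|^2}\cdot\widehat{\nabla_v\mathbf f}(\eta s)\,ds,\qquad \widehat{u}(\xi)=\int_{\mathbb R^d}e^{-i\xi\cdot v}u(v)\,dv,$$ and call $\mathbf f$ $c_0$ Penrose stable if $\inf_{\gamma>0,\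 \tau\in\mathbb R,\ \eta\neq0}|\mathcal P(\gamma,\tau,\eta,\mathbf f)|\ge c_0$. For $F=F(t,x)$ put $$K_{\nabla_vf^0}(F)(t,x)=\int_0^t\int_{\mathbb R^d}(\nabla_xF)(s,x-(t-s)v)\cdot\nabla_vf^0(x,v)\,dv\,ds .$$ **Proposition.** Let $c_0>0$. There is a continuous, non-decreasing function $\Lambda:\mathbb R\to(0,\infty)$, depending only on $d,m,r,c_0$, such that the following holds. Let $f^0\in\mathcal H^{2m}_{2r}$ be such that $f^0(x,\cdot)$ is $c_0$ Penrose stable for almost every $x\in\mathbb T^d$ (equivalently, for every $x$, for the representative of $f^0$ that is continuous in $x$), and put $\Lambda_0=\Lambda(\|f^0\|_{\mathcal H^{2m}_{2r}})$. Let $\gamma\ge\Lambda_0$ and $\varepsilon\in(0,1]$. Let $R\in L^2(\mathbb R\times\mathbb T^d;\mathbb C)$ and $h:\mathbb R\times\mathbb T^d\to\mathbb C$ both vanish for $t<0$, with $h\in L^2((-\infty,T]\times\mathbb T^d)$ for every $T\in\mathbb R$, and assume that $$h=e^{-\gamma t}K_{\nabla_vf^0}\big(e^{\gamma t}(I-\varepsilon^2\Delta_x)^{-1}h\big)+R\qquad\text{a.e.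 on }\mathbb R\times\mathbb T^d .$$ Then $h\in L^2(\mathbb R\times\mathbb T^d)$ and $$\|h\|_{L^2(\mathbb R\times\mathbb T^d)}\le\Lambda_0\,\|R\|_{L^2(\mathbb R\times\mathbb T^d)} .$$ -/

import Mathlib

open MeasureTheory Set Real
open scoped ContDiff ENNReal

noncomputable section

namespace VlasovPenrose

instance factTwoPiPos : Fact (0 < 2 * π) := ⟨Real.two_pi_pos⟩

/-- The torus `𝕋ᵈ = (ℝ / 2πℤ)ᵈ`, with the product of the Lebesgue measures (total mass `(2π)ᵈ`). -/
abbrev Torus (d : ℕ) : Type := Fin d → AddCircle (2 * π)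

/-- The velocity space `ℝᵈ`, with its Euclidean norm and Lebesgue measure. -/
abbrev Vel (d : ℕ) : Type := EuclideanSpace ℝ (Fin d)

/-- The projection `ℝᵈ → 𝕋ᵈ`. -/
def toTorus {d : ℕ} (y : Vel d) : Torus d := fun i => ((y i : ℝ) : AddCircle (2 * π))

/-! ### Weighted Sobolev spaces on `𝕋ᵈ × ℝᵈ` -/

/-- The classical partial derivative `∂_{x_i}` of a function on `𝕋ᵈ × ℝᵈ`. -/
def pdX {d : ℕ} (i : Fin d) (φ : Torus d × Vel d → ℝ) : Torus d × Vel d → ℝ :=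
  fun z => deriv (fun s : ℝ => φ (z.1 + Pi.single i (s : AddCircle (2 * π)), z.2)) 0

/-- The classical partial derivative `∂_{v_i}` of a function on `𝕋ᵈ × ℝᵈ`. -/
def pdV {d : ℕ} (i : Fin d) (φ : Torus d × Vel d → ℝ) : Torus d × Vel d → ℝ :=
  fun z => deriv (fun s : ℝ => φ (z.1, z.2 + EuclideanSpace.single i s)) 0

/-- `∂_x^α ∂_v^β φ = ∂_{x_1}^{α_1} ⋯ ∂_{x_d}^{α_d} ∂_{v_1}^{β_1} ⋯ ∂_{v_d}^{β_d} φ`. -/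
def pdIter {d : ℕ} (α β : Fin d → ℕ) (φ : Torus d × Vel d → ℝ) : Torus d × Vel d → ℝ :=
  (List.finRange d).foldr (fun i ψ => (pdX i)^[α i] ψ)
    ((List.finRange d).foldr (fun i ψ => (pdV i)^[β i] ψ) φ)

/-- Test functions on `𝕋ᵈ × ℝᵈ`: smooth, with compact support. -/
structure IsTest {d : ℕ} (φ : Torus d × Vel d → ℝ) : Prop where
  smooth : ContDiff ℝ ∞ (fun y : Vel d × Vel d => φ (toTorus y.1, y.2))
  bounded_support : ∃ ρ : ℝ, ∀ z, ρ < ‖z.2‖ → φ z = 0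

/-- `g` is the weak (distributional) derivative `∂_x^α ∂_v^β f`. -/
structure IsWeakDeriv {d : ℕ} (α β : Fin d → ℕ) (f g : Torus d × Vel d → ℝ) : Prop where
  locInt_left : LocallyIntegrable f
  locInt_right : LocallyIntegrable g
  integral_eq : ∀ φ : Torus d × Vel d → ℝ, IsTest φ →
    ∫ z, f z * pdIter α β φ z = (-1) ^ (∑ i, α i + ∑ i, β i) * ∫ z, g z * φ z

open Classical in
/-- The weak derivative `∂_x^α ∂_v^β f` (unique up to null sets; `0` if there is none). -/
def weakDeriv {d : ℕ} (α β : Fin d → ℕ) (f : Torus d × Vel d → ℝ) : Torus d × Vel d → ℝ :=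
  if h : ∃ g, IsWeakDeriv α β f g then h.choose else 0

theorem weakDeriv_spec {d : ℕ} {α β : Fin d → ℕ} {f : Torus d × Vel d → ℝ}
    (h : ∃ g, IsWeakDeriv α β f g) : IsWeakDeriv α β f (weakDeriv α β f) := by
  unfold weakDeriv
  rw [dif_pos h]
  exact h.choose_spec

/-- `f ∈ 𝓗^k_r`: all weak derivatives of order at most `k` exist and have a finite
weighted `L²` norm, with weight `(1 + |v|²)^r`. -/
def MemH {d : ℕ} (k : ℕ) (r : ℝ) (f : Torus d × Vel d → ℝ) : Prop :=
  ∀ α β : Fin d → ℕ, ∑ i, α i + ∑ i, β i ≤ k →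
    (∃ g, IsWeakDeriv α β f g) ∧
      Integrable (fun z : Torus d × Vel d => (1 + ‖z.2‖ ^ 2) ^ r * weakDeriv α β f z ^ 2)

/-- The pairs of multi-indices `(α, β)` with `|α| + |β| ≤ k`. -/
def multiIndices (d k : ℕ) : Finset ((Fin d → ℕ) × (Fin d → ℕ)) :=
  ((Fintype.piFinset fun _ => Finset.range (k + 1)) ×ˢ
    (Fintype.piFinset fun _ => Finset.range (k + 1))).filter
      (fun p => ∑ i, p.1 i + ∑ i, p.2 i ≤ k)

/-- The norm of `𝓗^k_r`. -/
def normH {d : ℕ} (k : ℕ) (r : ℝ) (f : Torus d × Vel d → ℝ) : ℝ :=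
  √(∑ p ∈ multiIndices d k,
    ∫ z : Torus d × Vel d, (1 + ‖z.2‖ ^ 2) ^ r * weakDeriv p.1 p.2 f z ^ 2)

/-- The weak velocity gradient `∇_v f`. -/
def gradV {d : ℕ} (f : Torus d × Vel d → ℝ) (z : Torus d × Vel d) : Fin d → ℝ :=
  fun j => weakDeriv 0 (Pi.single j 1) f z

/-! ### The Penrose stability condition -/

/-- The Fourier transform in velocity, `∫ e^{-iξ·v} u(v) dv`. -/
def fourierV {d : ℕ} (u : Vel d → ℝ) (ξ : Vel d) : ℂ :=
  ∫ v : Vel d, Complex.exp (-Complex.I * ((inner ℝ ξ v : ℝ) : ℂ)) * (u v : ℂ)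

/-- The Penrose function `𝓟(γ, τ, η, 𝐟)` of a velocity profile `𝐟`. It depends on the profile only
through its gradient, which is the argument `g = ∇_v 𝐟`. -/
def penrose {d : ℕ} (γ τ : ℝ) (η : Vel d) (g : Vel d → Fin d → ℝ) : ℂ :=
  1 - ∫ s in Ioi (0 : ℝ), Complex.exp (-((γ : ℂ) + Complex.I * (τ : ℂ)) * (s : ℂ)) *
    (Complex.I / ((1 + ‖η‖ ^ 2 : ℝ) : ℂ) *
      ∑ j, (η j : ℂ) * fourierV (fun v => g v j) (s • η))

/-- The `c₀` Penrose stability condition for a profile with velocity gradient `g`: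
`inf |𝓟(γ, τ, η)| ≥ c₀` over `γ > 0`, `τ ∈ ℝ`, `η ≠ 0`. -/
def PenroseStable {d : ℕ} (c₀ : ℝ) (g : Vel d → Fin d → ℝ) : Prop :=
  ∀ (γ τ : ℝ) (η : Vel d), 0 < γ → η ≠ 0 → c₀ ≤ ‖penrose γ τ η g‖

/-! ### Functions of `(t, x) ∈ ℝ × 𝕋ᵈ` and the integral operator -/

/-- Smooth complex functions on the torus. -/
def TorusSmooth {d : ℕ} (φ : Torus d → ℂ) : Prop :=
  ContDiff ℝ ∞ (fun y : Vel d => φ (toTorus y))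

/-- The classical partial derivative `∂_{x_i}` on the torus. -/
def torusPd {d : ℕ} (i : Fin d) (φ : Torus d → ℂ) : Torus d → ℂ :=
  fun x => deriv (fun s : ℝ => φ (x + Pi.single i (s : AddCircle (2 * π)))) 0

/-- The classical Laplacian on the torus. -/
def torusLaplacian {d : ℕ} (φ : Torus d → ℂ) : Torus d → ℂ :=
  fun x => ∑ i, torusPd i (torusPd i φ) x

/-- `w` is the weak derivative `∂_{x_i} F` of a function `F(t, x)`: for almost every `t`, `w(t, ·)`
is the weak derivative of `F(t, ·)` on the torus. -/
structure IsWeakPdX {d : ℕ} (i : Fin d) (F w : ℝ × Torus d → ℂ) : Prop where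
  meas : AEStronglyMeasurable w
  weak : ∀ᵐ t : ℝ, Integrable (fun x => F (t, x)) ∧ Integrable (fun x => w (t, x)) ∧
    ∀ φ : Torus d → ℂ, TorusSmooth φ →
      ∫ x, F (t, x) * torusPd i φ x = -∫ x, w (t, x) * φ x

open Classical in
/-- The weak derivative `∂_{x_i} F` (unique up to null sets; `0` if there is none). -/
def weakPdX {d : ℕ} (i : Fin d) (F : ℝ × Torus d → ℂ) : ℝ × Torus d → ℂ :=
  if h : ∃ w, IsWeakPdX i F w then h.choose else 0

theorem weakPdX_spec {d : ℕ} {i : Fin d} {F : ℝ × Torus d → ℂ}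
    (h : ∃ w, IsWeakPdX i F w) : IsWeakPdX i F (weakPdX i F) := by
  unfold weakPdX
  rw [dif_pos h]
  exact h.choose_spec

/-- `u = (I - ε²Δ)⁻¹ h`: for almost every `t`, `u(t, ·) ∈ L²(𝕋ᵈ)` is the weak solution of
`u - ε²Δu = h(t, ·)` on the torus. -/
structure IsResolvent {d : ℕ} (ε : ℝ) (h u : ℝ × Torus d → ℂ) : Prop where
  meas : AEStronglyMeasurable u
  weak : ∀ᵐ t : ℝ, MemLp (fun x => u (t, x)) 2 ∧
    ∀ φ : Torus d → ℂ, TorusSmooth φ →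
      ∫ x, u (t, x) * (φ x - (ε : ℂ) ^ 2 * torusLaplacian φ x) = ∫ x, h (t, x) * φ x

open Classical in
/-- `(I - ε²Δ)⁻¹ h`, the Laplacian acting in `x` (unique up to null sets; `0` if there is none). -/
def resolvent {d : ℕ} (ε : ℝ) (h : ℝ × Torus d → ℂ) : ℝ × Torus d → ℂ :=
  if H : ∃ u, IsResolvent ε h u then H.choose else 0

theorem resolvent_spec {d : ℕ} {ε : ℝ} {h : ℝ × Torus d → ℂ}
    (H : ∃ u, IsResolvent ε h u) : IsResolvent ε h (resolvent ε h) := by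
  unfold resolvent
  rw [dif_pos H]
  exact H.choose_spec

/-- The operator
`K_G(F)(t, x) = ∫_0^t ∫ (∇_x F)(s, x - (t - s) v) · G(x, v) dv ds`. -/
def opK {d : ℕ} (G : Torus d × Vel d → Fin d → ℝ) (F : ℝ × Torus d → ℂ) : ℝ × Torus d → ℂ :=
  fun z => ∫ s in (0 : ℝ)..z.1, ∫ v : Vel d,
    ∑ j, weakPdX j F (s, z.2 - toTorus ((z.1 - s) • v)) * (G (z.2, v) j : ℂ)

/-- `h` solves `h = e^{-γt} K_{∇_v f⁰}(e^{γt} (I - ε²Δ)⁻¹ h) + R` almost everywhere on `ℝ × 𝕋ᵈ`. -/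
def SolvesEq {d : ℕ} (f₀ : Torus d × Vel d → ℝ) (ε γ : ℝ) (h R : ℝ × Torus d → ℂ) : Prop :=
  ∀ᵐ z : ℝ × Torus d, h z = (Real.exp (-γ * z.1) : ℂ) *
    opK (gradV f₀) (fun y => (Real.exp (γ * y.1) : ℂ) * resolvent ε h y) z + R z

end VlasovPenrose

end

open VlasovPenrose

/-!
The equation is written for the Fourier coefficients in `x` of `h(t, ·)`. If `φ_n` is the Fourier
transform in `v` of the `n`-th mode in `x` of `f⁰`, then `e^{-γ t} K_{∇_v f⁰}(e^{γ t} (I - ε²Δ)⁻¹ h)`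
becomes the matrix Volterra operator
`(V h)_k(t) = ∑ₙ ∫ e^{-γ s} m_{n, k - n}(s) h_{k - n}(t - s) ds`, with
`m_{n, k}(s) = -s |k|² (1 + ε²|k|²)⁻¹ φ_n(s k)` for `s > 0` (`profileKernel`,
`ProfileModes.coef_opK_eq`, `ProfileModes.modeEq`). The task is to bound `1 - V` from below on
`L²(ℝ; ℓ²(ℤᵈ))`, uniformly in `ε`.

A Fourier transform in time turns `V` into a pseudodifferential operator on the torus, with a parameter
`τ` and with symbol `p(x, k) = ∑ₙ e^{i n·x} p_{n, k}`, where `p_{n, k}` is the Fourier transform of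
`e^{-γ s} m_{n, k}(s)`. By the scaling `s ↦ ε s` the symbol at `x` is that of the velocity profile
`f⁰(x, ·)` at the point `(ε γ, ε τ, ε k)`: `1 - p(x, k)` is a value of the Penrose function
(`ProfileModes.penrose_eq`), so it is at least `min c₀ 1` in modulus (for `k = 0` it equals `1`). This
passes from the symbol to the operator by freezing the symbol (`frozen_symbol_estimate`): multiply `h`
by the Dirichlet kernel of the cube `[0, N)ᵈ` centred at a point `y`, invert the symbol frozen at `y`,
and integrate over `y`. There are two errors. Replacing `x` by `y` costs
`O(N^{-1/2}) ∑ₙ (1 + |n|) sup_k |p_{n, k}|`, because the cube and its translate by `n` differ by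
`O(N^{d-1} |n|)` points; it is small if `N` is large. Replacing a frequency by a neighbouring one in the
cube costs `O(C_N) ∑ₙ Lip_k p_{n, k}`; it is small if `γ` is large, because `m_{n, k}(s)` is Lipschitz in
`k` uniformly in `s`, so that `p_{n, k}` has Lipschitz constant `O(1 / γ)`. No regularity of the symbol
beyond the summability of these two series is used.

Both series are controlled by the norm of `f⁰` (`exists_profileModes`). Three velocity derivatives give
the decay `|ξ| (1 + |ξ|²) |φ_n(ξ)| ≤ A_n`, which makes `m_{n, k}` integrable in `s` uniformly in `k` and
`ε`; two derivatives and one power of `v` give the Lipschitz bound for `|ξ|² φ_n(ξ)`; the remaining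
`2 m - 3` derivatives in `x`, with Parseval's identity and the Cauchy–Schwarz inequality, make
`∑ₙ (1 + |n|) A_n` finite.

The Fourier transform in time needs `h` to be square integrable on the whole line, which is to be proved.
A Volterra equation with a bounded kernel has solutions of at most exponential growth
(`PenroseKernel.exists_exp_weight`; the rate depends on `ε`), and multiplication by `e^{-μ t}` only replaces `γ` by `γ + μ`. If
`e^{-(μ + δ) t} h` is square integrable, the estimate applied to `e^{-μ t} h` times a weight which is
`1` up to time `T` and then decays like `e^{-2 δ t}` has an error `O(δ)`, absorbed for a small fixed `δ`;
letting `T → ∞` shows that `e^{-μ t} h` is square integrable. So `μ` is lowered to `0` in finitely many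
steps (`seqNorm_le_of_modeEq`), whose number does not enter the final constant.
-/

noncomputable section
namespace VlasovPenrose
variable {d : ℕ}

/-! ### Integral inequalities -/

theorem lintegral_mul_le_sqrt {α : Type*} [MeasurableSpace α] (μ : Measure α) {f g : α → ℝ≥0∞}
    (hf : AEMeasurable f μ) (hg : AEMeasurable g μ) :
    ∫⁻ a, f a * g a ∂μ ≤
      (∫⁻ a, f a ^ 2 ∂μ) ^ (1 / 2 : ℝ) * (∫⁻ a, g a ^ 2 ∂μ) ^ (1 / 2 : ℝ) := by
  have := ENNReal.lintegral_mul_le_Lp_mul_Lq μ Real.HolderConjugate.two_two hf hg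
  simpa only [Pi.mul_apply, ENNReal.rpow_two] using this

theorem ennreal_rpow_half_sq (a : ℝ≥0∞) : (a ^ (1 / 2 : ℝ)) ^ 2 = a := by
  rw [← ENNReal.rpow_two, ← ENNReal.rpow_mul]; norm_num

theorem ennreal_sq_rpow_half (a : ℝ≥0∞) : (a ^ 2) ^ (1 / 2 : ℝ) = a := by
  rw [← ENNReal.rpow_two, ← ENNReal.rpow_mul]; norm_num

theorem ennreal_sq_le_sq_iff {a b : ℝ≥0∞} : a ^ 2 ≤ b ^ 2 ↔ a ≤ b := by
  constructor
  · intro h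
    have := ENNReal.rpow_le_rpow h (by norm_num : (0 : ℝ) ≤ 1 / 2)
    rwa [ennreal_sq_rpow_half, ennreal_sq_rpow_half] at this
  · intro h; gcongr

/-- Cauchy–Schwarz with a weight: `(∫ w u)² ≤ (∫ w) (∫ w u²)`. -/
theorem sq_lintegral_mul_le {α : Type*} [MeasurableSpace α] (μ : Measure α) {w u : α → ℝ≥0∞}
    (hw : AEMeasurable w μ) (hu : AEMeasurable u μ) :
    (∫⁻ a, w a * u a ∂μ) ^ 2 ≤ (∫⁻ a, w a ∂μ) * ∫⁻ a, w a * u a ^ 2 ∂μ := by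
  have h := lintegral_mul_le_sqrt μ (hw.pow_const (1 / 2 : ℝ))
    ((hw.pow_const (1 / 2 : ℝ)).mul hu)
  have e1 : ∀ a, w a ^ (1 / 2 : ℝ) * ((fun x => w x ^ (1 / 2 : ℝ)) * u) a = w a * u a := by
    intro a
    simp only [Pi.mul_apply]
    rw [← mul_assoc, ← sq, ennreal_rpow_half_sq]
  have e2 : ∀ a, ((fun x => w x ^ (1 / 2 : ℝ)) * u) a ^ 2 = w a * u a ^ 2 := by
    intro a
    simp only [Pi.mul_apply]
    rw [mul_pow, ennreal_rpow_half_sq]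
  simp only [e1, e2, ennreal_rpow_half_sq] at h
  calc _ ≤ _ := pow_le_pow_left' h 2
    _ = _ := by rw [mul_pow, ennreal_rpow_half_sq, ennreal_rpow_half_sq]

/-- Minkowski's integral inequality in `L²`. -/
theorem lintegral_lintegral_sq_le {α β : Type*} [MeasurableSpace α] [MeasurableSpace β]
    (μ : Measure α) (ν : Measure β) [SFinite μ] [SFinite ν] {f : α → β → ℝ≥0∞}
    (hf : Measurable (Function.uncurry f)) :
    ∫⁻ a, (∫⁻ b, f a b ∂ν) ^ 2 ∂μ ≤ (∫⁻ b, (∫⁻ a, f a b ^ 2 ∂μ) ^ (1 / 2 : ℝ) ∂ν) ^ 2 := by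
  -- expand the square as a double integral and apply the Cauchy–Schwarz inequality in `a`
  have hfa : ∀ a, Measurable (f a) := fun a => hf.of_uncurry_left
  have hfb : ∀ b, Measurable (fun a => f a b) := fun b => hf.of_uncurry_right
  have hN : Measurable fun b => (∫⁻ a, f a b ^ 2 ∂μ) ^ (1 / 2 : ℝ) := by
    refine Measurable.pow_const ?_ _
    exact Measurable.lintegral_prod_left' (f := fun z : α × β => f z.1 z.2 ^ 2)
      (Measurable.pow_const hf 2)
  have h1 : ∀ a, (∫⁻ b, f a b ∂ν) ^ 2 = ∫⁻ z : β × β, f a z.1 * f a z.2 ∂(ν.prod ν) := by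
    intro a
    rw [sq, lintegral_prod_mul (hfa a).aemeasurable (hfa a).aemeasurable]
  have h2 : Measurable (fun z : α × (β × β) => f z.1 z.2.1 * f z.1 z.2.2) :=
    (hf.comp (measurable_fst.prodMk measurable_snd.fst)).mul
      (hf.comp (measurable_fst.prodMk measurable_snd.snd))
  calc _ = ∫⁻ z : β × β, ∫⁻ a, f a z.1 * f a z.2 ∂μ ∂(ν.prod ν) := by
        simp_rw [h1]
        exact lintegral_lintegral_swap h2.aemeasurable
    _ ≤ ∫⁻ z : β × β, (∫⁻ a, f a z.1 ^ 2 ∂μ) ^ (1 / 2 : ℝ) *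
          (∫⁻ a, f a z.2 ^ 2 ∂μ) ^ (1 / 2 : ℝ) ∂(ν.prod ν) := by
        gcongr with z
        exact lintegral_mul_le_sqrt μ (hfb _).aemeasurable (hfb _).aemeasurable
    _ = _ := by
        rw [sq, lintegral_prod_mul hN.aemeasurable hN.aemeasurable]

/-- Minkowski's inequality in `L²` for a countable sum. -/
theorem lintegral_tsum_sq_le {α ι : Type*} [MeasurableSpace α] [Countable ι]
    (μ : Measure α) [SFinite μ] {f : ι → α → ℝ≥0∞} (hf : ∀ i, Measurable (f i)) :
    ∫⁻ a, (∑' i, f i a) ^ 2 ∂μ ≤ (∑' i, (∫⁻ a, f i a ^ 2 ∂μ) ^ (1 / 2 : ℝ)) ^ 2 := by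
  let _ : MeasurableSpace ι := ⊤
  have := lintegral_lintegral_sq_le μ (Measure.count : Measure ι) (f := fun a i => f i a)
    (measurable_from_prod_countable_left hf)
  simpa only [lintegral_count] using this

/-- Plancherel's theorem for the Fourier integral of a function in `L¹ ∩ L²`. -/
theorem lintegral_enorm_fourier_sq {f : ℝ → ℂ} (h1 : Integrable f) (h2 : MemLp f 2) :
    ∫⁻ τ, ‖FourierTransform.fourier f τ‖ₑ ^ 2 = ∫⁻ t, ‖f t‖ₑ ^ 2 := by
  set F : Lp ℂ 2 (volume : Measure ℝ) := h2.toLp f with hF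
  -- the Fourier integral and the `L²` Fourier transform agree as tempered distributions
  have key : ∀ᵐ τ, FourierTransform.fourier f τ = (FourierTransform.fourier F : Lp ℂ 2 (volume : Measure ℝ)) τ := by
    refine ae_eq_of_integral_contDiff_smul_eq ?_ ?_ ?_
    · exact (VectorFourier.fourierIntegral_continuous Real.continuous_fourierChar
        (by exact continuous_inner) h1).locallyIntegrable
    · exact (Lp.memLp _).locallyIntegrable (by norm_num)
    · intro g hg hgs
      let φ : SchwartzMap ℝ ℂ := HasCompactSupport.toSchwartzMap
        (f := fun x => (g x : ℂ)) (hgs.comp_left (g := fun x : ℝ => (x : ℂ)) (by simp))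
        (Complex.ofRealCLM.contDiff.comp hg)
      have hφ : ∀ x, φ x = (g x : ℂ) := fun x => rfl
      have e := congrArg (fun T => T φ) (Lp.fourier_toTemperedDistribution_eq F)
      simp only [TemperedDistribution.fourier_apply, Lp.toTemperedDistribution_apply] at e
      have e2 : ∀ x, g x • (FourierTransform.fourier F : Lp ℂ 2 (volume : Measure ℝ)) x
          = φ x • (FourierTransform.fourier F : Lp ℂ 2 (volume : Measure ℝ)) x := by
        intro x; rw [hφ, Complex.real_smul, smul_eq_mul]
      have e3 : ∀ x, g x • FourierTransform.fourier f x = φ x • FourierTransform.fourier f x := by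
        intro x; rw [hφ, Complex.real_smul, smul_eq_mul]
      simp_rw [e2, e3]
      rw [← e]
      have e4 := VectorFourier.integral_fourierIntegral_smul_eq_flip (L := innerₗ ℝ)
        (f := (φ : ℝ → ℂ)) (g := f) (μ := volume) (ν := volume) Real.continuous_fourierChar
        (by exact continuous_inner) φ.integrable h1
      have e5 : ∫ x, (FourierTransform.fourier φ : SchwartzMap ℝ ℂ) x • F x
          = ∫ x, (FourierTransform.fourier φ : SchwartzMap ℝ ℂ) x • f x := by
        refine integral_congr_ae ?_
        filter_upwards [h2.coeFn_toLp] with x hx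
        rw [hF, hx]
      rw [e5]
      rw [flip_innerₗ] at e4
      exact e4.symm
  have n1 : ∀ G : Lp ℂ 2 (volume : Measure ℝ), ∫⁻ τ, ‖G τ‖ₑ ^ 2 = ‖G‖ₑ ^ 2 := by
    intro G
    rw [Lp.enorm_def, eLpNorm_eq_lintegral_rpow_enorm_toReal (by norm_num) (by norm_num)]
    simp only [ENNReal.toReal_ofNat, ENNReal.rpow_two, ennreal_rpow_half_sq]
  have n2 : ∫⁻ τ, ‖FourierTransform.fourier f τ‖ₑ ^ 2 = ‖(FourierTransform.fourier F : Lp ℂ 2 (volume : Measure ℝ))‖ₑ ^ 2 := by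
    rw [← n1]
    refine lintegral_congr_ae ?_
    filter_upwards [key] with τ hτ
    rw [hτ]
  have n3 : ∫⁻ t, ‖f t‖ₑ ^ 2 = ‖F‖ₑ ^ 2 := by
    rw [← n1]
    refine lintegral_congr_ae ?_
    filter_upwards [h2.coeFn_toLp] with τ hτ
    rw [hF, hτ]
  rw [n2, n3, ← ofReal_norm, ← ofReal_norm, Lp.norm_fourier_eq]

/-! ### Fourier series on the torus -/

/-- The characters `e_k(x) = e^{i k·x}` of the torus, `k ∈ ℤᵈ`. -/
def tchar {d : ℕ} (k : Fin d → ℤ) : C(Torus d, ℂ) where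
  toFun x := ∏ i, fourier (k i) (x i)
  continuous_toFun := by fun_prop

theorem tchar_apply (k : Fin d → ℤ) (x : Torus d) : tchar k x = ∏ i, fourier (k i) (x i) := rfl

theorem tchar_neg (k : Fin d → ℤ) (x : Torus d) : tchar (-k) x = starRingEnd ℂ (tchar k x) := by
  simp only [tchar_apply, Pi.neg_apply, fourier_neg, map_prod]

theorem tchar_add (k l : Fin d → ℤ) (x : Torus d) : tchar (k + l) x = tchar k x * tchar l x := by
  simp only [tchar_apply, Pi.add_apply, fourier_add, Finset.prod_mul_distrib]

@[simp] theorem tchar_zero (x : Torus d) : tchar (0 : Fin d → ℤ) x = 1 := by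
  simp [tchar_apply]

@[simp] theorem norm_tchar (k : Fin d → ℤ) (x : Torus d) : ‖tchar k x‖ = 1 := by
  rw [tchar_apply, norm_prod]
  exact Finset.prod_eq_one fun i _ => by simp [fourier_apply, Circle.norm_coe]

@[simp] theorem enorm_tchar (k : Fin d → ℤ) (x : Torus d) : ‖tchar k x‖ₑ = 1 := by
  rw [← ofReal_norm, norm_tchar, ENNReal.ofReal_one]

theorem tchar_add_right (k : Fin d → ℤ) (x y : Torus d) :
    tchar k (x + y) = tchar k x * tchar k y := by
  simp [tchar_apply, fourier_apply, ← Finset.prod_mul_distrib, smul_add, AddCircle.toCircle_add]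

theorem tchar_neg_right (k : Fin d → ℤ) (x : Torus d) : tchar k (-x) = tchar (-k) x := by
  simp [tchar_apply, fourier_apply]

theorem tchar_sub_right (k : Fin d → ℤ) (x y : Torus d) :
    tchar k (x - y) = tchar k x * tchar (-k) y := by
  rw [sub_eq_add_neg, tchar_add_right, tchar_neg_right]

/-- An integer frequency as a vector of `ℝᵈ`. -/
def intVec (k : Fin d → ℤ) : Vel d := WithLp.toLp 2 (fun i => (k i : ℝ))

@[simp] theorem intVec_apply (k : Fin d → ℤ) (i : Fin d) : intVec k i = (k i : ℝ) := rfl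

theorem tchar_toTorus (k : Fin d → ℤ) (v : Vel d) :
    tchar k (toTorus v) = Complex.exp (Complex.I * ((inner ℝ (intVec k) v : ℝ) : ℂ)) := by
  simp only [tchar_apply, toTorus, fourier_coe_apply]
  rw [← Complex.exp_sum]
  congr 1
  simp only [PiLp.inner_apply, intVec_apply, Complex.ofReal_sum, Finset.mul_sum]
  refine Finset.sum_congr rfl fun i _ => ?_
  have : (π : ℂ) ≠ 0 := by exact_mod_cast Real.pi_ne_zero
  simp
  field_simp

theorem tchar_single (k : Fin d → ℤ) (i : Fin d) (s : ℝ) :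
    tchar k (Pi.single i (s : AddCircle (2 * π))) = Complex.exp (Complex.I * (k i : ℂ) * (s : ℂ)) := by
  have h : (Pi.single i (s : AddCircle (2 * π)) : Torus d) = toTorus (EuclideanSpace.single i s) := by
    ext j
    by_cases hj : j = i
    · subst hj; simp [toTorus]
    · simp [toTorus, hj]
  rw [h, tchar_toTorus]
  simp [EuclideanSpace.inner_single_right]
  ring_nf

theorem volume_torus_univ : volume (univ : Set (Torus d)) = ENNReal.ofReal (2 * π) ^ d := by
  rw [← Set.pi_univ, volume_pi, Measure.pi_pi]
  simp [AddCircle.measure_univ]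

instance : IsFiniteMeasure (volume : Measure (Torus d)) := by
  refine ⟨?_⟩
  rw [volume_torus_univ]
  exact ENNReal.pow_lt_top ENNReal.ofReal_lt_top

theorem integral_fourier_of_ne_zero {n : ℤ} (hn : n ≠ 0) :
    ∫ x : AddCircle (2 * π), (fourier n x : ℂ) = 0 := by
  have h := integral_add_right_eq_self (μ := (volume : Measure (AddCircle (2 * π))))
    (fun x => (fourier n x : ℂ)) ((2 * π / 2 / n : ℝ) : AddCircle (2 * π))
  simp_rw [fourier_add_half_inv_index hn (by positivity : (0:ℝ) < 2 * π)] at h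
  rw [integral_neg] at h
  exact self_eq_neg.mp h.symm

theorem integral_tchar (k : Fin d → ℤ) :
    ∫ x, tchar k x = if k = 0 then ((2 * π : ℝ) : ℂ) ^ d else 0 := by
  split_ifs with h
  · subst h
    simp [measureReal_def, volume_torus_univ, Real.pi_pos.le]
  · simp only [tchar_apply]
    rw [MeasureTheory.integral_fintype_prod_volume_eq_prod]
    obtain ⟨i, hi⟩ := Function.ne_iff.mp h
    exact Finset.prod_eq_zero (Finset.mem_univ i) (integral_fourier_of_ne_zero hi)

/-- The star subalgebra of `C(𝕋ᵈ, ℂ)` generated by the characters. -/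
def tcharSubalgebra (d : ℕ) : StarSubalgebra ℂ C(Torus d, ℂ) where
  toSubalgebra := Algebra.adjoin ℂ (range tchar)
  star_mem' := by
    change Algebra.adjoin ℂ (range tchar) ≤ star (Algebra.adjoin ℂ (range tchar))
    refine Algebra.adjoin_le ?_
    rintro _ ⟨n, rfl⟩
    refine Algebra.subset_adjoin ⟨-n, ?_⟩
    ext1 x
    simp only [tchar_neg, starRingEnd_apply, ContinuousMap.star_apply]

theorem tcharSubalgebra_coe :
    (tcharSubalgebra d).toSubalgebra.toSubmodule = Submodule.span ℂ (range tchar) := by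
  apply Algebra.adjoin_eq_span_of_subset
  refine .trans (fun x ↦ Submonoid.closure_induction (fun _ ↦ id) ⟨0, ?_⟩ ?_) Submodule.subset_span
  · ext z
    simp
  · rintro _ _ _ _ ⟨m, rfl⟩ ⟨n, rfl⟩
    refine ⟨m + n, ?_⟩
    ext z
    simp [tchar_add]

theorem tcharSubalgebra_separatesPoints : (tcharSubalgebra d).SeparatesPoints := by
  intro x y hxy
  rw [Ne, funext_iff, not_forall] at hxy
  obtain ⟨i, hi⟩ := hxy
  refine ⟨_, ⟨tchar (Pi.single i 1), Algebra.subset_adjoin ⟨Pi.single i 1, rfl⟩, rfl⟩, ?_⟩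
  have h1 : ∀ z : Torus d, tchar (Pi.single i 1) z = fourier 1 (z i) := by
    intro z
    rw [tchar_apply, Finset.prod_eq_single i]
    · simp
    · intro j _ hj; simp [hj]
    · simp
  change tchar (Pi.single i 1) x ≠ tchar (Pi.single i 1) y
  rw [h1, h1, fourier_one, fourier_one]
  contrapose hi
  rw [Circle.coe_inj] at hi
  exact AddCircle.injective_toCircle (by positivity) hi

theorem span_tchar_closure_eq_top :
    (Submodule.span ℂ (range (tchar (d := d)))).topologicalClosure = ⊤ := by
  rw [← tcharSubalgebra_coe]
  exact congr_arg (Subalgebra.toSubmodule <| StarSubalgebra.toSubalgebra ·)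
    (ContinuousMap.starSubalgebra_topologicalClosure_eq_top_of_separatesPoints _
      tcharSubalgebra_separatesPoints)

/-- An integrable function on the torus with vanishing Fourier coefficients vanishes. -/
theorem ae_eq_zero_of_integral_tchar {f : Torus d → ℂ} (hf : Integrable f)
    (h : ∀ k, ∫ x, tchar k x * f x = 0) : f =ᵐ[volume] 0 := by
  have hint : ∀ φ : C(Torus d, ℂ), Integrable (fun x => φ x * f x) := fun φ =>
    hf.bdd_mul (c := ‖φ‖) φ.continuous.aestronglyMeasurable (.of_forall fun x => φ.norm_coe_le_norm x)
  -- the span of the characters is dense, so `f` is orthogonal to all continuous functions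
  have hcont : ∀ φ : C(Torus d, ℂ), ∫ x, φ x * f x = 0 := by
    let L : C(Torus d, ℂ) →ₗ[ℂ] ℂ :=
      { toFun := fun φ => ∫ x, φ x * f x
        map_add' := fun φ ψ => by
          simp only [ContinuousMap.add_apply, add_mul]
          exact integral_add (hint φ) (hint ψ)
        map_smul' := fun c φ => by
          simp only [ContinuousMap.smul_apply, smul_eq_mul, mul_assoc, RingHom.id_apply]
          exact integral_const_mul _ _ }
    let Lc : C(Torus d, ℂ) →L[ℂ] ℂ := L.mkContinuous (∫ x, ‖f x‖) (fun φ => by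
      change ‖∫ x, φ x * f x‖ ≤ _
      rw [← integral_mul_const]
      refine norm_integral_le_of_norm_le (hf.norm.mul_const _) (.of_forall fun x => ?_)
      rw [norm_mul, mul_comm]
      gcongr
      exact φ.norm_coe_le_norm x)
    have hker : (⊤ : Submodule ℂ C(Torus d, ℂ)) ≤ LinearMap.ker (Lc : C(Torus d, ℂ) →ₗ[ℂ] ℂ) := by
      rw [← span_tchar_closure_eq_top]
      refine Submodule.topologicalClosure_minimal _ ?_ (ContinuousLinearMap.isClosed_ker Lc)
      rw [Submodule.span_le]
      rintro _ ⟨k, rfl⟩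
      exact h k
    intro φ
    exact hker (Submodule.mem_top (x := φ))
  -- a real integrable function orthogonal to the real continuous functions vanishes
  have hreal : ∀ g : Torus d → ℝ, Integrable g →
      (∀ φ : BoundedContinuousFunction (Torus d) ℝ, ∫ x, φ x * g x = 0) → g =ᵐ[volume] 0 := by
    intro g hg hφ
    have fin1 : IsFiniteMeasure (volume.withDensity fun x => ENNReal.ofReal (g x)) :=
      isFiniteMeasure_withDensity_ofReal hg.2
    have fin2 : IsFiniteMeasure (volume.withDensity fun x => ENNReal.ofReal (-g x)) :=
      isFiniteMeasure_withDensity_ofReal hg.neg.2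
    have m1 : AEMeasurable (fun x => ENNReal.ofReal (g x)) := hg.1.aemeasurable.ennreal_ofReal
    have m2 : AEMeasurable (fun x => ENNReal.ofReal (-g x)) := hg.1.aemeasurable.neg.ennreal_ofReal
    have hfin : ∫⁻ x, ENNReal.ofReal (g x) ≠ (⊤ : ℝ≥0∞) := by
      refine ((lintegral_mono fun x => ?_).trans_lt hg.2).ne
      exact Real.ofReal_le_enorm _
    have hext : (volume.withDensity fun x => ENNReal.ofReal (g x))
        = volume.withDensity fun x => ENNReal.ofReal (-g x) := by
      refine ext_of_forall_integral_eq_of_IsFiniteMeasure fun φ => ?_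
      rw [integral_withDensity_eq_integral_toReal_smul₀ m1 (by simp),
        integral_withDensity_eq_integral_toReal_smul₀ m2 (by simp), ← sub_eq_zero,
        ← integral_sub, ← hφ φ]
      · refine integral_congr_ae (.of_forall fun x => ?_)
        simp only [smul_eq_mul, ENNReal.toReal_ofReal']
        rw [← sub_mul, mul_comm]
        congr 1
        rcases le_total 0 (g x) with h | h
        · simp [h]
        · simp [h]
      · refine Integrable.mul_bdd (c := ‖φ‖) ?_ φ.continuous.aestronglyMeasurable (.of_forall fun x => φ.norm_coe_le_norm x)
        simp only [ENNReal.toReal_ofReal']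
        exact hg.pos_part
      · refine Integrable.mul_bdd (c := ‖φ‖) ?_ φ.continuous.aestronglyMeasurable (.of_forall fun x => φ.norm_coe_le_norm x)
        simp only [ENNReal.toReal_ofReal']
        exact hg.neg_part
    rw [withDensity_eq_iff m1 m2 hfin] at hext
    · filter_upwards [hext] with x hx
      rcases le_total 0 (g x) with h | h
      · rw [ENNReal.ofReal_of_nonpos (by linarith : -g x ≤ 0), ENNReal.ofReal_eq_zero] at hx
        exact le_antisymm hx h
      · rw [ENNReal.ofReal_of_nonpos h, eq_comm, ENNReal.ofReal_eq_zero] at hx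
        exact le_antisymm h (neg_nonpos.mp hx)
  have hc : ∀ φ : BoundedContinuousFunction (Torus d) ℝ, ∫ x, ((φ x : ℝ) : ℂ) * f x = 0 := fun φ =>
    hcont ⟨fun x => ((φ x : ℝ) : ℂ), by fun_prop⟩
  have hci : ∀ φ : BoundedContinuousFunction (Torus d) ℝ, Integrable fun x => ((φ x : ℝ) : ℂ) * f x :=
    fun φ => hint ⟨fun x => ((φ x : ℝ) : ℂ), by fun_prop⟩
  have r1 := hreal (fun x => (f x).re) hf.re (fun φ => by
    have := congrArg Complex.re (hc φ)
    have e := integral_re (hci φ)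
    simp only [RCLike.re_to_complex] at e
    rw [← e] at this
    simpa using this)
  have r2 := hreal (fun x => (f x).im) hf.im (fun φ => by
    have := congrArg Complex.im (hc φ)
    have e := integral_im (hci φ)
    simp only [RCLike.im_to_complex] at e
    rw [← e] at this
    simpa using this)
  filter_upwards [r1, r2] with x h1 h2
  exact Complex.ext h1 h2

/-- The Fourier coefficients `(2π)^{-d} ∫ e^{-i k·x} f(x) dx` of a function on the torus. -/
def coef (k : Fin d → ℤ) (f : Torus d → ℂ) : ℂ :=
  (((2 * π : ℝ) : ℂ) ^ d)⁻¹ * ∫ x, tchar (-k) x * f x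

theorem two_pi_pow_ne_zero : (((2 * π : ℝ) : ℂ) ^ d) ≠ 0 :=
  pow_ne_zero _ (by exact_mod_cast Real.two_pi_pos.ne')

theorem coef_congr_ae {k : Fin d → ℤ} {f g : Torus d → ℂ} (h : f =ᵐ[volume] g) :
    coef k f = coef k g := by
  unfold coef
  congr 1
  refine integral_congr_ae ?_
  filter_upwards [h] with x hx
  rw [hx]

theorem integrable_tchar_mul {f : Torus d → ℂ} (hf : Integrable f) (k : Fin d → ℤ) :
    Integrable (fun x => tchar k x * f x) :=
  hf.bdd_mul (c := 1) (tchar k).continuous.aestronglyMeasurable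
    (.of_forall fun x => (norm_tchar k x).le)

theorem coef_add {k : Fin d → ℤ} {f g : Torus d → ℂ} (hf : Integrable f) (hg : Integrable g) :
    coef k (fun x => f x + g x) = coef k f + coef k g := by
  simp only [coef, mul_add]
  rw [integral_add (integrable_tchar_mul hf _) (integrable_tchar_mul hg _), mul_add]

theorem coef_finset_sum {ι : Type*} (S : Finset ι) {f : ι → Torus d → ℂ} (hf : ∀ i ∈ S, Integrable (f i))
    (k : Fin d → ℤ) : coef k (fun x => ∑ i ∈ S, f i x) = ∑ i ∈ S, coef k (f i) := by
  unfold coef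
  rw [← Finset.mul_sum, ← integral_finsetSum _ fun i hi => integrable_tchar_mul (hf i hi) _]
  simp only [Finset.mul_sum]

theorem coef_const_mul (k : Fin d → ℤ) (c : ℂ) (f : Torus d → ℂ) :
    coef k (fun x => c * f x) = c * coef k f := by
  simp only [coef, mul_left_comm _ c]
  rw [integral_const_mul]
  ring

theorem ae_eq_of_coef_eq {f g : Torus d → ℂ} (hf : Integrable f) (hg : Integrable g)
    (h : ∀ k, coef k f = coef k g) : f =ᵐ[volume] g := by
  have := ae_eq_zero_of_integral_tchar (hf.sub hg) (fun k => by
    have hk := h (-k)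
    simp only [coef, neg_neg] at hk
    have hk := mul_left_cancel₀ (inv_ne_zero two_pi_pow_ne_zero) hk
    simp only [Pi.sub_apply, mul_sub]
    rw [integral_sub (integrable_tchar_mul hf _) (integrable_tchar_mul hg _), hk, sub_self])
  filter_upwards [this] with x hx
  exact sub_eq_zero.mp hx

theorem coef_tchar (k l : Fin d → ℤ) : coef k (tchar l) = if l = k then 1 else 0 := by
  unfold coef
  simp_rw [← tchar_add]
  rw [integral_tchar]
  simp only [neg_add_eq_zero, eq_comm (a := k)]
  split_ifs
  · exact inv_mul_cancel₀ two_pi_pow_ne_zero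
  · simp

/-- The normalised characters, as vectors of `L²(𝕋ᵈ)`. -/
def tcharLp (k : Fin d → ℤ) : Lp ℂ 2 (volume : Measure (Torus d)) :=
  (((√((2 * π) ^ d))⁻¹ : ℝ) : ℂ) • ContinuousMap.toLp (E := ℂ) 2 volume ℂ (tchar k)

theorem inner_tcharLp (k : Fin d → ℤ) (f : Lp ℂ 2 (volume : Measure (Torus d))) :
    inner ℂ (tcharLp k) f = ((√((2 * π) ^ d) : ℝ) : ℂ) * coef k f := by
  unfold tcharLp coef
  rw [inner_smul_left, MeasureTheory.L2.inner_def]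
  have : ∫ x, inner ℂ ((ContinuousMap.toLp (E := ℂ) 2 volume ℂ (tchar k)) x) (f x)
      = ∫ x, tchar (-k) x * f x := by
    refine integral_congr_ae ?_
    filter_upwards [ContinuousMap.coeFn_toLp (p := 2) (𝕜 := ℂ) volume (tchar k)] with x hx
    rw [hx, RCLike.inner_apply, ← tchar_neg, mul_comm]
  rw [this, ← mul_assoc]
  congr 1
  rw [Complex.conj_ofReal, ← Complex.ofReal_pow, ← Complex.ofReal_inv, ← Complex.ofReal_mul]
  congr 1
  have h : (0 : ℝ) < (2 * π) ^ d := by positivity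
  have h2 := Real.mul_self_sqrt h.le
  have h3 : √((2 * π) ^ d) ≠ 0 := (Real.sqrt_pos.mpr h).ne'
  field_simp
  rw [sq, h2]

theorem orthonormal_tcharLp : Orthonormal ℂ (tcharLp (d := d)) := by
  rw [orthonormal_iff_ite]
  intro k l
  rw [inner_tcharLp]
  have h1 : coef k (tcharLp l : Lp ℂ 2 (volume : Measure (Torus d)))
      = (((√((2 * π) ^ d))⁻¹ : ℝ) : ℂ) * coef k (tchar l) := by
    rw [← coef_const_mul]
    refine coef_congr_ae ?_
    unfold tcharLp
    filter_upwards [Lp.coeFn_smul (((√((2 * π) ^ d))⁻¹ : ℝ) : ℂ)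
      (ContinuousMap.toLp (E := ℂ) 2 volume ℂ (tchar l)),
      ContinuousMap.coeFn_toLp (p := 2) (𝕜 := ℂ) volume (tchar l)] with x hx hy
    rw [hx, Pi.smul_apply, hy, smul_eq_mul]
  rw [h1, coef_tchar, ← mul_assoc, ← Complex.ofReal_mul,
    mul_inv_cancel₀ (Real.sqrt_pos.mpr (by positivity)).ne']
  simp [eq_comm]

/-- The characters form a Hilbert basis of `L²(𝕋ᵈ)`. -/
def tcharBasis (d : ℕ) : HilbertBasis (Fin d → ℤ) ℂ (Lp ℂ 2 (volume : Measure (Torus d))) :=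
  HilbertBasis.mkOfOrthogonalEqBot orthonormal_tcharLp (by
    rw [Submodule.eq_bot_iff]
    intro f hf
    have h0 : ∀ k, coef k f = 0 := by
      intro k
      have := (Submodule.mem_orthogonal _ _).mp hf (tcharLp k) (Submodule.subset_span ⟨k, rfl⟩)
      rw [inner_tcharLp] at this
      refine (mul_eq_zero.mp this).resolve_left ?_
      exact_mod_cast (Real.sqrt_pos.mpr (by positivity)).ne'
    have := ae_eq_of_coef_eq (g := 0) ((Lp.memLp f).integrable (by norm_num)) (integrable_zero _ _ _)
      (fun k => by rw [h0]; simp [coef])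
    exact (Lp.eq_zero_iff_ae_eq_zero).mpr this)

theorem inner_tcharBasis (k : Fin d → ℤ) (f : Lp ℂ 2 (volume : Measure (Torus d))) :
    inner ℂ (tcharBasis d k) f = ((√((2 * π) ^ d) : ℝ) : ℂ) * coef k f := by
  unfold tcharBasis
  rw [HilbertBasis.coe_mkOfOrthogonalEqBot, inner_tcharLp]

/-- Parseval's identity for inner products on the torus. -/
theorem hasSum_conj_coef_mul_coef {f g : Torus d → ℂ} (hf : MemLp f 2) (hg : MemLp g 2) :
    HasSum (fun k => ((2 * π : ℝ) : ℂ) ^ d * (starRingEnd ℂ (coef k f) * coef k g))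
      (∫ x, starRingEnd ℂ (f x) * g x) := by
  have h := (tcharBasis d).hasSum_inner_mul_inner (hf.toLp f) (hg.toLp g)
  have e : inner ℂ (hf.toLp f) (hg.toLp g) = ∫ x, starRingEnd ℂ (f x) * g x := by
    rw [MeasureTheory.L2.inner_def]
    refine integral_congr_ae ?_
    filter_upwards [hf.coeFn_toLp, hg.coeFn_toLp] with x hx hy
    rw [hx, hy, RCLike.inner_apply, mul_comm]
  rw [e] at h
  refine h.congr_fun fun k => ?_
  rw [← inner_conj_symm, inner_tcharBasis, inner_tcharBasis, coef_congr_ae hf.coeFn_toLp,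
    coef_congr_ae hg.coeFn_toLp, map_mul, Complex.conj_ofReal]
  have h2 := Real.mul_self_sqrt (show (0 : ℝ) ≤ (2 * π) ^ d by positivity)
  rw [mul_mul_mul_comm, ← Complex.ofReal_mul, h2, Complex.ofReal_pow]

theorem coef_conj (k : Fin d → ℤ) (f : Torus d → ℂ) :
    coef k (fun x => starRingEnd ℂ (f x)) = starRingEnd ℂ (coef (-k) f) := by
  unfold coef
  rw [map_mul, ← integral_conj]
  congr 1
  · rw [map_inv₀, map_pow, Complex.conj_ofReal]
  · simp [tchar_neg]

/-- Parseval's identity for the bilinear pairing on the torus. -/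
theorem hasSum_coef_mul_coef {f g : Torus d → ℂ} (hf : MemLp f 2) (hg : MemLp g 2) :
    HasSum (fun k => ((2 * π : ℝ) : ℂ) ^ d * (coef (-k) f * coef k g)) (∫ x, f x * g x) := by
  have := hasSum_conj_coef_mul_coef (f := fun x => starRingEnd ℂ (f x)) hf.star hg
  simpa only [coef_conj, Complex.conj_conj] using this

/-- Parseval's identity for norms on the torus. -/
theorem lintegral_enorm_sq_eq_tsum_coef {f : Torus d → ℂ} (hf : MemLp f 2) :
    ∫⁻ x, ‖f x‖ₑ ^ 2 = ENNReal.ofReal ((2 * π) ^ d) * ∑' k, ‖coef k f‖ₑ ^ 2 := by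
  have h := hasSum_conj_coef_mul_coef hf hf
  have h1 : ∫ x, starRingEnd ℂ (f x) * f x = ((∫ x, ‖f x‖ ^ 2 : ℝ) : ℂ) := by
    rw [← integral_complex_ofReal]
    refine integral_congr_ae (.of_forall fun x => ?_)
    simp only [Complex.conj_mul', Complex.ofReal_pow]
  have h2 : ∀ k, ((2 * π : ℝ) : ℂ) ^ d * (starRingEnd ℂ (coef k f) * coef k f)
      = (((2 * π) ^ d * ‖coef k f‖ ^ 2 : ℝ) : ℂ) := by
    intro k
    rw [Complex.conj_mul']
    push_cast
    rfl
  simp_rw [h1, h2] at h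
  have h3 : HasSum (fun k => (2 * π) ^ d * ‖coef k f‖ ^ 2) (∫ x, ‖f x‖ ^ 2) := by
    exact_mod_cast h
  have h4 : ∫⁻ x, ‖f x‖ₑ ^ 2 = ENNReal.ofReal (∫ x, ‖f x‖ ^ 2) := by
    rw [ofReal_integral_eq_lintegral_ofReal]
    · simp only [ENNReal.ofReal_pow (norm_nonneg _), ofReal_norm]
    · exact hf.integrable_norm_pow (by norm_num)
    · exact .of_forall fun x => by positivity
  rw [h4, ← h3.tsum_eq, ENNReal.ofReal_tsum_of_nonneg (fun k => by positivity) h3.summable,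
    ← ENNReal.tsum_mul_left]
  congr 1
  ext k
  rw [ENNReal.ofReal_mul (by positivity), ENNReal.ofReal_pow (norm_nonneg _), ofReal_norm]

/-! ### The `L²` norm of nonnegative functions -/

/-- The `L²` norm of a function with values in `[0, ∞]`. -/
def l2norm {α : Type*} [MeasurableSpace α] (μ : Measure α) (f : α → ℝ≥0∞) : ℝ≥0∞ :=
  (∫⁻ a, f a ^ 2 ∂μ) ^ (1 / 2 : ℝ)

section l2norm
variable {α : Type*} [MeasurableSpace α] {μ : Measure α}

theorem l2norm_sq (f : α → ℝ≥0∞) : l2norm μ f ^ 2 = ∫⁻ a, f a ^ 2 ∂μ := ennreal_rpow_half_sq _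

theorem l2norm_mono_ae {f g : α → ℝ≥0∞} (h : ∀ᵐ a ∂μ, f a ≤ g a) : l2norm μ f ≤ l2norm μ g := by
  unfold l2norm
  refine ENNReal.rpow_le_rpow (lintegral_mono_ae ?_) (by norm_num)
  filter_upwards [h] with a ha
  gcongr

theorem l2norm_mono {f g : α → ℝ≥0∞} (h : ∀ a, f a ≤ g a) : l2norm μ f ≤ l2norm μ g :=
  l2norm_mono_ae (.of_forall h)

theorem l2norm_add_le {f g : α → ℝ≥0∞} (hf : AEMeasurable f μ) (hg : AEMeasurable g μ) :
    l2norm μ (fun a => f a + g a) ≤ l2norm μ f + l2norm μ g := by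
  have := ENNReal.lintegral_Lp_add_le (p := 2) hf hg (by norm_num)
  simpa only [l2norm, Pi.add_apply, ENNReal.rpow_two] using this

theorem l2norm_const_mul (c : ℝ≥0∞) {f : α → ℝ≥0∞} (hf : AEMeasurable f μ) :
    l2norm μ (fun a => c * f a) = c * l2norm μ f := by
  unfold l2norm
  simp_rw [mul_pow]
  rw [lintegral_const_mul'' _ (hf.pow_const 2), ENNReal.mul_rpow_of_nonneg _ _ (by norm_num),
    ennreal_sq_rpow_half]

theorem l2norm_tsum_le {ι : Type*} [Countable ι] [SFinite μ] {f : ι → α → ℝ≥0∞}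
    (hf : ∀ i, Measurable (f i)) :
    l2norm μ (fun a => ∑' i, f i a) ≤ ∑' i, l2norm μ (f i) := by
  rw [← ennreal_sq_le_sq_iff, l2norm_sq]
  exact lintegral_tsum_sq_le μ hf

theorem l2norm_finset_sum_le {ι : Type*} (s : Finset ι) {f : ι → α → ℝ≥0∞}
    (hf : ∀ i, Measurable (f i)) :
    l2norm μ (fun a => ∑ i ∈ s, f i a) ≤ ∑ i ∈ s, l2norm μ (f i) := by
  classical
  induction s using Finset.induction_on with
  | empty => simp [l2norm]
  | insert i s hi ih =>
    simp only [Finset.sum_insert hi]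
    exact (l2norm_add_le (hf i).aemeasurable
      (Finset.measurable_sum _ fun j _ => hf j).aemeasurable).trans (by gcongr)

end l2norm

/-! ### Localization by Dirichlet kernels -/

/-- The discrete cube `[0, N)ᵈ`. -/
def cube (d N : ℕ) : Finset (Fin d → ℤ) := Fintype.piFinset fun _ => Finset.Ico 0 (N : ℤ)

theorem card_cube (d N : ℕ) : (cube d N).card = N ^ d := by
  simp [cube]

theorem card_Ico_sdiff_le (N : ℕ) (n : ℤ) :
    (Finset.Ico (0 : ℤ) N \ Finset.Ico n (N + n)).card ≤ n.natAbs := by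
  rcases le_total 0 n with h | h
  · have : Finset.Ico (0 : ℤ) N \ Finset.Ico n (N + n) ⊆ Finset.Ico 0 n := by
      intro x hx
      simp only [Finset.mem_sdiff, Finset.mem_Ico] at hx ⊢
      omega
    refine (Finset.card_le_card this).trans ?_
    rw [Int.card_Ico]; omega
  · have : Finset.Ico (0 : ℤ) N \ Finset.Ico n (N + n) ⊆ Finset.Ico (N + n) N := by
      intro x hx
      simp only [Finset.mem_sdiff, Finset.mem_Ico] at hx ⊢
      omega
    refine (Finset.card_le_card this).trans ?_
    rw [Int.card_Ico]; omega

/-- The cube and its translate by `n` differ by at most `d |n| N^{d-1}` points. -/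
theorem card_cube_sdiff_le (N : ℕ) (n : Fin d → ℤ) :
    ((cube d N \ (cube d N).map (addRightEmbedding n)).card : ℝ) * N ≤ d * ‖n‖ * N ^ d := by
  classical
  have hsub : cube d N \ (cube d N).map (addRightEmbedding n) ⊆ Finset.univ.biUnion fun i : Fin d =>
      Fintype.piFinset fun j => if j = i then Finset.Ico (0 : ℤ) N \ Finset.Ico (n i) (N + n i)
        else Finset.Ico 0 (N : ℤ) := by
    intro l hl
    rw [Finset.mem_sdiff] at hl
    obtain ⟨hl1, hl2⟩ := hl
    have hl1' : ∀ i, 0 ≤ l i ∧ l i < N := by simpa [cube] using hl1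
    have : ∃ i, ¬ (0 ≤ l i - n i ∧ l i - n i < N) := by
      by_contra hcon
      push Not at hcon
      refine hl2 (Finset.mem_map.mpr ⟨l - n, ?_, by simp⟩)
      simpa [cube] using hcon
    obtain ⟨i, hi⟩ := this
    simp only [Finset.mem_biUnion, Finset.mem_univ, true_and]
    refine ⟨i, Fintype.mem_piFinset.mpr fun j => ?_⟩
    have := hl1' j
    split_ifs with hj
    · subst hj
      simp only [Finset.mem_sdiff, Finset.mem_Ico]
      omega
    · simpa using this
  have hcard : ∀ i : Fin d, ((Fintype.piFinset fun j => if j = i then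
      Finset.Ico (0 : ℤ) N \ Finset.Ico (n i) (N + n i) else Finset.Ico 0 (N : ℤ)).card : ℝ) * N
        ≤ ‖n‖ * N ^ d := by
    intro i
    rw [Fintype.card_piFinset, ← Finset.mul_prod_erase _ _ (Finset.mem_univ i)]
    have : ∏ j ∈ Finset.univ.erase i, (if j = i then
      Finset.Ico (0 : ℤ) N \ Finset.Ico (n i) (N + n i) else Finset.Ico 0 (N : ℤ)).card = N ^ (d - 1) := by
      rw [Finset.prod_congr rfl (g := fun _ => N)]
      · simp
      · intro j hj
        rw [if_neg (Finset.ne_of_mem_erase hj)]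
        simp
    rw [this, if_pos rfl]
    have hd : (N : ℝ) ^ d = N ^ (d - 1) * N := by
      rw [← pow_succ]
      congr 1
      have := i.pos
      omega
    have h1 : ((Finset.Ico (0 : ℤ) N \ Finset.Ico (n i) (N + n i)).card : ℝ) ≤ ‖n‖ := by
      refine le_trans ?_ (norm_le_pi_norm n i)
      rw [Int.norm_eq_abs]
      have := card_Ico_sdiff_le N (n i)
      have h2 : ((n i).natAbs : ℝ) = |(n i : ℝ)| := by
        rw [Nat.cast_natAbs]; simp
      rw [← h2]
      exact_mod_cast this
    rw [hd]
    push_cast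
    rw [mul_assoc]
    gcongr
  have h3 := (Finset.card_le_card hsub).trans Finset.card_biUnion_le
  have h4 : ((cube d N \ (cube d N).map (addRightEmbedding n)).card : ℝ) ≤ ∑ i : Fin d,
      ((Fintype.piFinset fun j => if j = i then
      Finset.Ico (0 : ℤ) N \ Finset.Ico (n i) (N + n i) else Finset.Ico 0 (N : ℤ)).card : ℝ) := by
    exact_mod_cast h3
  calc _ ≤ _ := mul_le_mul_of_nonneg_right h4 (Nat.cast_nonneg N)
    _ ≤ ∑ i : Fin d, ‖n‖ * (N : ℝ) ^ d := by
        rw [Finset.sum_mul]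
        exact Finset.sum_le_sum fun i _ => hcard i
    _ = _ := by simp; ring

/-- The `ℓ²` norm of a family indexed by `ℤᵈ`. -/
def ell2 (u : (Fin d → ℤ) → ℂ) : ℝ≥0∞ := (∑' k, ‖u k‖ₑ ^ 2) ^ (1 / 2 : ℝ)

theorem ell2_sq (u : (Fin d → ℤ) → ℂ) : ell2 u ^ 2 = ∑' k, ‖u k‖ₑ ^ 2 := ennreal_rpow_half_sq _

/-- The measure on `𝕋ᵈ × ℤᵈ` used for localization: Lebesgue times counting. -/
abbrev locMeasure (d : ℕ) : Measure (Torus d × (Fin d → ℤ)) := volume.prod Measure.count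

theorem lintegral_locMeasure {f : Torus d × (Fin d → ℤ) → ℝ≥0∞} (hf : Measurable f) :
    ∫⁻ z, f z ∂(locMeasure d) = ∑' k, ∫⁻ y, f (y, k) := by
  rw [lintegral_prod_symm _ hf.aemeasurable, lintegral_count]

theorem coef_finset_sum_tchar (S : Finset (Fin d → ℤ)) (z : (Fin d → ℤ) → ℂ) (j : Fin d → ℤ) :
    coef j (fun y => ∑ l ∈ S, tchar (-l) y * z l) = if -j ∈ S then z (-j) else 0 := by
  classical
  unfold coef
  simp_rw [Finset.mul_sum]
  rw [integral_finsetSum]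
  · simp_rw [← mul_assoc, ← tchar_add, integral_mul_const, integral_tchar]
    rw [Finset.mul_sum]
    have : ∀ l ∈ S, (((2 * π : ℝ) : ℂ) ^ d)⁻¹ * ((if -j + -l = 0 then ((2 * π : ℝ) : ℂ) ^ d else 0) * z l)
        = if l = -j then z l else 0 := by
      intro l _
      have : -j + -l = 0 ↔ l = -j := by
        rw [add_eq_zero_iff_eq_neg, neg_neg, eq_comm]
      simp only [this]
      split_ifs
      · rw [← mul_assoc, inv_mul_cancel₀ two_pi_pow_ne_zero, one_mul]
      · simp
    rw [Finset.sum_congr rfl this, Finset.sum_ite_eq']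
  · intro l _
    exact (ContinuousMap.continuous (tchar (-j)) |>.mul ((tchar (-l)).continuous.mul continuous_const)).integrable_of_hasCompactSupport
      (HasCompactSupport.of_compactSpace _)

theorem measurable_locFun (S : Finset (Fin d → ℤ)) (z : (Fin d → ℤ) → ℂ) :
    Measurable fun a : Torus d × (Fin d → ℤ) => ∑ l ∈ S, tchar (-l) a.1 * z (a.2 - l) := by
  refine Finset.measurable_sum _ fun l _ => ?_
  exact ((tchar (-l)).continuous.measurable.comp measurable_fst).mul
    ((measurable_of_countable fun k => z (k - l)).comp measurable_snd)

/-- Let `u` be the function on the torus with Fourier coefficients `z`, multiplied by the Dirichlet kernel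
of the set of frequencies `S`, centred at `y`. Its coefficients, as a function of `y` and of the frequency,
have the `L²` norm of `z` up to a constant. -/
theorem l2norm_locFun (S : Finset (Fin d → ℤ)) (z : (Fin d → ℤ) → ℂ) :
    l2norm (locMeasure d) (fun a => ‖∑ l ∈ S, tchar (-l) a.1 * z (a.2 - l)‖ₑ)
      = (ENNReal.ofReal ((2 * π) ^ d) * S.card) ^ (1 / 2 : ℝ) * ell2 z := by
  unfold ell2
  rw [← ENNReal.mul_rpow_of_nonneg _ _ (by norm_num : (0:ℝ) ≤ 1 / 2)]
  unfold l2norm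
  congr 1
  rw [lintegral_locMeasure ((measurable_locFun S z).enorm.pow_const 2)]
  have h1 : ∀ k, ∫⁻ y, ‖∑ l ∈ S, tchar (-l) y * z (k - l)‖ₑ ^ 2
      = ENNReal.ofReal ((2 * π) ^ d) * ∑ l ∈ S, ‖z (k - l)‖ₑ ^ 2 := by
    intro k
    rw [lintegral_enorm_sq_eq_tsum_coef]
    · simp_rw [coef_finset_sum_tchar S fun l => z (k - l)]
      congr 1
      rw [← (Equiv.neg (Fin d → ℤ)).tsum_eq]
      simp only [Equiv.neg_apply, neg_neg]
      rw [tsum_eq_sum (s := S)]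
      · exact Finset.sum_congr rfl fun l hl => by rw [if_pos hl]
      · intro l hl; simp [hl]
    · refine Continuous.memLp_of_hasCompactSupport ?_ (HasCompactSupport.of_compactSpace _)
      exact continuous_finsetSum _ fun l _ => (tchar (-l)).continuous.mul continuous_const
  simp_rw [h1]
  rw [ENNReal.tsum_mul_left, mul_assoc]
  congr 1
  rw [Summable.tsum_finsetSum (fun _ _ => ENNReal.summable)]
  have h2 : ∀ l ∈ S, ∑' k, ‖z (k - l)‖ₑ ^ 2 = ∑' k, ‖z k‖ₑ ^ 2 := fun l _ =>
    (Equiv.subRight l).tsum_eq fun k => ‖z k‖ₑ ^ 2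
  rw [Finset.sum_congr rfl h2, Finset.sum_const, nsmul_eq_mul]

/-! ### The frozen symbol -/

theorem enorm_le_ell2 (u : (Fin d → ℤ) → ℂ) (k : Fin d → ℤ) : ‖u k‖ₑ ≤ ell2 u := by
  rw [← ennreal_sq_le_sq_iff, ell2_sq]
  exact ENNReal.le_tsum (f := fun k => ‖u k‖ₑ ^ 2) k

theorem ell2_mono_mul {u z : (Fin d → ℤ) → ℂ} {c : ℝ≥0∞} (h : ∀ k, ‖z k‖ₑ ≤ c * ‖u k‖ₑ) :
    ell2 z ≤ c * ell2 u := by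
  rw [← ennreal_sq_le_sq_iff, mul_pow, ell2_sq, ell2_sq, ← ENNReal.tsum_mul_left]
  gcongr with k
  rw [← mul_pow]
  gcongr
  exact h k

/-- The difference of the localizations over a cube and over its translate: only the frequencies in the
symmetric difference of the two cubes contribute. -/
theorem l2norm_locFun_sub_le (N : ℕ) (n : Fin d → ℤ) (z : (Fin d → ℤ) → ℂ) :
    l2norm (locMeasure d) (fun a =>
        ‖∑ l ∈ (cube d N).map (addRightEmbedding n), tchar (-l) a.1 * z (a.2 - l)
          - ∑ l ∈ cube d N, tchar (-l) a.1 * z (a.2 - l)‖ₑ)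
      ≤ 2 * (ENNReal.ofReal ((2 * π) ^ d) *
          (cube d N \ (cube d N).map (addRightEmbedding n)).card) ^ (1 / 2 : ℝ) * ell2 z := by
  classical
  set Q := cube d N
  set Q' := (cube d N).map (addRightEmbedding n)
  have hcard : (Q' \ Q).card = (Q \ Q').card :=
    Finset.card_sdiff_comm (Finset.card_map _)
  calc _ ≤ l2norm (locMeasure d) (fun a =>
        ‖∑ l ∈ Q' \ Q, tchar (-l) a.1 * z (a.2 - l)‖ₑ
          + ‖∑ l ∈ Q \ Q', tchar (-l) a.1 * z (a.2 - l)‖ₑ) := by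
        refine l2norm_mono fun a => ?_
        rw [← Finset.sum_sdiff_sub_sum_sdiff]
        exact enorm_sub_le
    _ ≤ _ := l2norm_add_le (measurable_locFun _ z).enorm.aemeasurable
        (measurable_locFun _ z).enorm.aemeasurable
    _ = _ := by
        rw [l2norm_locFun, l2norm_locFun, hcard]
        ring

/-- The basic estimate for a pseudodifferential operator on the torus with symbol `1 - p(x, k)`,
`p(x, k) = ∑ₙ eₙ(x) p n k`, in Fourier variables. The symbol is frozen at a point `y`, where it is
bounded below; `u` is localized near `y` by multiplication with the Dirichlet kernel of the cube
`[0, N)ᵈ` centred at `y`, and the result is integrated over `y`. The second term on the right bounds the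
variation of the symbol in the frequency over the cube, the third its variation in `x`. -/
theorem frozen_symbol_estimate {u R : (Fin d → ℤ) → ℂ} {p : (Fin d → ℤ) → (Fin d → ℤ) → ℂ}
    {b L : (Fin d → ℤ) → ℝ} {c : ℝ} {N : ℕ} (hN : 0 < N) (hu : ell2 u ≠ ⊤)
    (hb : Summable fun n => (1 + ‖n‖) * b n) (hp : ∀ n k, ‖p n k‖ ≤ b n)
    (hLs : Summable L) (hL0 : ∀ n, 0 ≤ L n)
    (hL : ∀ n k l, ‖p n k - p n (k - l)‖ ≤ L n * ‖intVec l‖)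
    (hpen : ∀ᵐ y : Torus d, ∀ k, c ≤ ‖1 - ∑' n, tchar n y * p n k‖)
    (hR : ∀ k, R k = u k - ∑' n, p n (k - n) * u (k - n)) :
    ENNReal.ofReal c * ell2 u ≤ ell2 R
      + ENNReal.ofReal ((∑' n, L n) * ∑ l ∈ cube d N, ‖intVec l‖) * ell2 u
      + ENNReal.ofReal (2 * √(d / N) * ∑' n, (1 + ‖n‖) * b n) * ell2 u := by
  classical
  have hb0 : ∀ n, 0 ≤ b n := fun n => (norm_nonneg _).trans (hp n 0)
  have hbs : Summable b := by
    refine Summable.of_nonneg_of_le hb0 (fun n => ?_) hb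
    have := mul_nonneg (norm_nonneg n) (hb0 n)
    linarith
  obtain ⟨M, hM⟩ : ∃ M : ℝ, ∀ k, ‖u k‖ ≤ M := by
    refine ⟨(ell2 u).toReal, fun k => ?_⟩
    have := (ENNReal.toReal_le_toReal (by simp) hu).mpr (enorm_le_ell2 u k)
    simpa using this
  have hM0 : 0 ≤ M := (norm_nonneg _).trans (hM 0)
  have hps : ∀ k j (y : Torus d) (a : ℂ), Summable fun n => tchar (n - j) y * p n k * a := by
    intro k j y a
    refine Summable.of_norm_bounded (hbs.mul_right ‖a‖) fun n => ?_
    rw [norm_mul, norm_mul, norm_tchar, one_mul]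
    gcongr
    exact hp n k
  have hps' : ∀ j (f : (Fin d → ℤ) → ((Fin d → ℤ))) (g : (Fin d → ℤ) → ((Fin d → ℤ))) (y : Torus d),
      Summable fun n => tchar j y * (p n (f n) * u (g n)) := by
    intro j f g y
    refine Summable.of_norm_bounded (hbs.mul_right M) fun n => ?_
    rw [norm_mul, norm_mul, norm_tchar, one_mul]
    exact mul_le_mul (hp n _) (hM _) (norm_nonneg _) (hb0 n)
  set Q := cube d N with hQ
  set z : (Fin d → ℤ) → (Fin d → ℤ) → ℂ := fun n k => p n k * u k with hz
  -- `V` and `W` are the localizations of `u` and `R`; `X n` is the commutator of the localization with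
  -- the shift of frequencies by `n`
  set V : Torus d × (Fin d → ℤ) → ℂ := fun a => ∑ l ∈ Q, tchar (-l) a.1 * u (a.2 - l) with hV
  set W : Torus d × (Fin d → ℤ) → ℂ := fun a => ∑ l ∈ Q, tchar (-l) a.1 * R (a.2 - l) with hW
  set X : (Fin d → ℤ) → Torus d × (Fin d → ℤ) → ℂ := fun n a =>
    ∑ l ∈ Q.map (addRightEmbedding n), tchar (-l) a.1 * z n (a.2 - l)
      - ∑ l ∈ Q, tchar (-l) a.1 * z n (a.2 - l) with hX
  set LL := ∑' n, L n with hLL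
  have hterm : ∀ a n, tchar n a.1 * X n a
      = ∑ l ∈ Q, tchar (-l) a.1 * (p n (a.2 - l - n) * u (a.2 - l - n))
        - ∑ l ∈ Q, tchar (n - l) a.1 * p n (a.2 - l) * u (a.2 - l) := by
    intro a n
    simp only [hX, hz, mul_sub, Finset.sum_map, Finset.mul_sum, addRightEmbedding_apply]
    congr 1
    · refine Finset.sum_congr rfl fun l _ => ?_
      rw [← mul_assoc, ← tchar_add, sub_sub, show n + -(l + n) = -l by abel]
    · refine Finset.sum_congr rfl fun l _ => ?_
      rw [← mul_assoc, ← tchar_add, ← mul_assoc, ← sub_eq_add_neg]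
  -- the localized equation, with the symbol frozen at the point `a.1` and the frequency `a.2`
  have hident : ∀ a, (1 - ∑' n, tchar n a.1 * p n a.2) * V a = W a
      - ∑ l ∈ Q, ∑' n, tchar (n - l) a.1 * (p n a.2 - p n (a.2 - l)) * u (a.2 - l)
      + ∑' n, tchar n a.1 * X n a := by
    intro a
    have e1 : ∑' n, tchar n a.1 * X n a = ∑ l ∈ Q, tchar (-l) a.1 * ∑' n, (p n (a.2 - l - n) * u (a.2 - l - n))
        - ∑ l ∈ Q, ∑' n, tchar (n - l) a.1 * p n (a.2 - l) * u (a.2 - l) := by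
      simp_rw [hterm]
      rw [Summable.tsum_sub, Summable.tsum_finsetSum, Summable.tsum_finsetSum]
      · simp_rw [tsum_mul_left]
      · exact fun l _ => hps _ _ _ _
      · exact fun l _ => hps' _ (fun n => a.2 - l - n) (fun n => a.2 - l - n) _
      · exact summable_sum fun l _ => hps' _ (fun n => a.2 - l - n) (fun n => a.2 - l - n) _
      · exact summable_sum fun l _ => hps _ _ _ _
    rw [e1]
    simp only [hW, hV, hR, mul_sub, Finset.sum_sub_distrib, sub_mul, one_mul]
    have e2 : ∀ l, ∑' n, (tchar (n - l) a.1 * p n a.2 * u (a.2 - l)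
          - tchar (n - l) a.1 * p n (a.2 - l) * u (a.2 - l))
        = (∑' n, tchar n a.1 * p n a.2) * (tchar (-l) a.1 * u (a.2 - l))
          - ∑' n, tchar (n - l) a.1 * p n (a.2 - l) * u (a.2 - l) := by
      intro l
      rw [Summable.tsum_sub (hps _ _ _ _) (hps _ _ _ _), ← tsum_mul_right]
      congr 1
      refine tsum_congr fun n => ?_
      rw [sub_eq_add_neg, tchar_add]
      ring
    simp_rw [e2]
    rw [Finset.sum_sub_distrib, Finset.mul_sum]
    ring
  -- the lower bound for the frozen symbol, pointwise in the point and the frequency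
  have hpt : ∀ᵐ a ∂(locMeasure d), ENNReal.ofReal c * ‖V a‖ₑ ≤ (‖W a‖ₑ
      + ∑ l ∈ Q, ENNReal.ofReal (LL * ‖intVec l‖) * ‖u (a.2 - l)‖ₑ) + ∑' n, ‖X n a‖ₑ := by
    have hpen' : ∀ᵐ a ∂(locMeasure d), ∀ k, c ≤ ‖1 - ∑' n, tchar n a.1 * p n k‖ :=
      Measure.quasiMeasurePreserving_fst.ae hpen
    filter_upwards [hpen'] with a ha
    calc _ ≤ ‖(1 - ∑' n, tchar n a.1 * p n a.2) * V a‖ₑ := by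
          rw [enorm_mul]
          gcongr
          rw [← ofReal_norm]
          exact ENNReal.ofReal_le_ofReal (ha _)
      _ ≤ (‖W a‖ₑ + ‖∑ l ∈ Q, ∑' n, tchar (n - l) a.1 * (p n a.2 - p n (a.2 - l)) * u (a.2 - l)‖ₑ)
          + ‖∑' n, tchar n a.1 * X n a‖ₑ := by
          rw [hident]
          exact (enorm_add_le _ _).trans (by gcongr; exact enorm_sub_le)
      _ ≤ _ := by
          gcongr
          · refine (enorm_sum_le _ _).trans ?_
            gcongr with l hl
            rw [tsum_mul_right, enorm_mul]
            gcongr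
            rw [← ofReal_norm]
            refine ENNReal.ofReal_le_ofReal ?_
            rw [hLL, ← tsum_mul_right]
            refine tsum_of_norm_bounded (hLs.mul_right _).hasSum fun n => ?_
            rw [norm_mul, norm_tchar, one_mul]
            exact hL n _ _
          · refine (enorm_tsum_le_tsum_enorm ).trans ?_
            gcongr with n
            rw [enorm_mul, enorm_tchar, one_mul]
  have mV : Measurable V := measurable_locFun Q u
  have mW : Measurable W := measurable_locFun Q R
  have mX : ∀ n, Measurable (X n) := fun n => (measurable_locFun _ _).sub (measurable_locFun _ _)
  have mU : ∀ l, Measurable fun a : Torus d × (Fin d → ℤ) =>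
      ENNReal.ofReal (LL * ‖intVec l‖) * ‖u (a.2 - l)‖ₑ := fun l =>
    Measurable.const_mul ((measurable_of_countable fun k => ‖u (k - l)‖ₑ).comp measurable_snd) _
  set K : ℝ≥0∞ := (ENNReal.ofReal ((2 * π) ^ d) * (Q.card : ℝ≥0∞)) ^ (1 / 2 : ℝ) with hK
  have hcard : Q.card = N ^ d := card_cube d N
  have hK0 : K ≠ 0 := by
    rw [hK, hcard]
    refine (ENNReal.rpow_pos (ENNReal.mul_pos ?_ ?_) ?_).ne'
    · exact (ENNReal.ofReal_pos.mpr (by positivity)).ne'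
    · exact_mod_cast (pow_pos hN d).ne'
    · exact ENNReal.mul_ne_top ENNReal.ofReal_ne_top (by simp)
  have hKt : K ≠ ⊤ := ENNReal.rpow_ne_top_of_nonneg (by norm_num)
    (ENNReal.mul_ne_top ENNReal.ofReal_ne_top (by simp))
  have nV : l2norm (locMeasure d) (fun a => ‖V a‖ₑ) = K * ell2 u := l2norm_locFun Q u
  have nW : l2norm (locMeasure d) (fun a => ‖W a‖ₑ) = K * ell2 R := l2norm_locFun Q R
  have nU : ∀ l, l2norm (locMeasure d) (fun a => ENNReal.ofReal (LL * ‖intVec l‖) * ‖u (a.2 - l)‖ₑ)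
      ≤ ENNReal.ofReal (LL * ‖intVec l‖) * (K * ell2 u) := by
    intro l
    refine (l2norm_const_mul _ (f := fun a : Torus d × (Fin d → ℤ) => ‖u (a.2 - l)‖ₑ)
      ((measurable_of_countable fun k => ‖u (k - l)‖ₑ).comp measurable_snd).aemeasurable).trans_le ?_
    gcongr
    have h := l2norm_locFun {l} u
    have e : ∀ a : Torus d × (Fin d → ℤ), ‖∑ l ∈ {l}, tchar (-l) a.1 * u (a.2 - l)‖ₑ = ‖u (a.2 - l)‖ₑ := by
      intro a
      rw [Finset.sum_singleton, enorm_mul, enorm_tchar, one_mul]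
    simp_rw [e] at h
    rw [h, hK, Finset.card_singleton, hcard]
    gcongr
    exact Nat.one_le_pow _ _ hN
  have nX : ∀ n, l2norm (locMeasure d) (fun a => ‖X n a‖ₑ)
      ≤ K * (ENNReal.ofReal (2 * √(d / N) * ((1 + ‖n‖) * b n)) * ell2 u) := by
    intro n
    refine (l2norm_locFun_sub_le N n (z n)).trans ?_
    have h1 : ell2 (z n) ≤ ENNReal.ofReal (b n) * ell2 u := by
      refine ell2_mono_mul fun k => ?_
      rw [hz, enorm_mul]
      gcongr
      rw [← ofReal_norm]
      exact ENNReal.ofReal_le_ofReal (hp n k)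
    have hN' : (0 : ℝ) < N := by exact_mod_cast hN
    -- the fraction of the cube lost by the shift is at most `d 
    -- n
    --  / N`
    have h2 : (((cube d N \ (cube d N).map (addRightEmbedding n)).card : ℕ) : ℝ≥0∞)
        ≤ Q.card * ENNReal.ofReal (d * ‖n‖ / N) := by
      rw [hcard, ← ENNReal.ofReal_natCast, ← ENNReal.ofReal_natCast, ← ENNReal.ofReal_mul (by positivity)]
      refine ENNReal.ofReal_le_ofReal ?_
      have := card_cube_sdiff_le N n
      rw [← mul_div_assoc, le_div_iff₀ hN']
      push_cast
      linarith
    have h3 : (ENNReal.ofReal ((2 * π) ^ d) * (cube d N \ (cube d N).map (addRightEmbedding n)).card)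
          ^ (1 / 2 : ℝ) ≤ K * ENNReal.ofReal (√(d / N) * (1 + ‖n‖)) := by
      have : ENNReal.ofReal (d * ‖n‖ / N) ^ (1 / 2 : ℝ) ≤ ENNReal.ofReal (√(d / N) * (1 + ‖n‖)) := by
        rw [ENNReal.ofReal_rpow_of_nonneg (by positivity) (by norm_num), ← Real.sqrt_eq_rpow]
        refine ENNReal.ofReal_le_ofReal ?_
        rw [mul_div_right_comm, Real.sqrt_mul (by positivity)]
        gcongr
        rw [Real.sqrt_le_left (by positivity)]
        nlinarith [norm_nonneg n]
      refine le_trans ?_ (mul_le_mul_right this K)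
      rw [hK, ← ENNReal.mul_rpow_of_nonneg _ _ (by norm_num : (0:ℝ) ≤ 1 / 2), mul_assoc]
      gcongr
    calc _ ≤ 2 * (K * ENNReal.ofReal (√(d / N) * (1 + ‖n‖))) * (ENNReal.ofReal (b n) * ell2 u) := by
          gcongr
      _ = _ := by
          rw [show 2 * √(d / N) * ((1 + ‖n‖) * b n) = 2 * ((√(d / N) * (1 + ‖n‖)) * b n) by ring,
            ENNReal.ofReal_mul (p := 2) (by norm_num),
            ENNReal.ofReal_mul (p := √(d / N) * (1 + ‖n‖)) (by positivity), ENNReal.ofReal_ofNat]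
          ring
  have hfin : K * (ENNReal.ofReal c * ell2 u) ≤ K * (ell2 R
      + ENNReal.ofReal (LL * ∑ l ∈ Q, ‖intVec l‖) * ell2 u
      + ENNReal.ofReal (2 * √(d / N) * ∑' n, (1 + ‖n‖) * b n) * ell2 u) := by
    calc _ = l2norm (locMeasure d) (fun a => ENNReal.ofReal c * ‖V a‖ₑ) := by
          rw [l2norm_const_mul _ mV.enorm.aemeasurable, nV]
          ring
      _ ≤ _ := l2norm_mono_ae hpt
      _ ≤ _ := l2norm_add_le (mW.enorm.add (Finset.measurable_sum _ fun l _ => mU l)).aemeasurable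
          (Measurable.tsum fun n => (mX n).enorm).aemeasurable
      _ ≤ (K * ell2 R + ∑ l ∈ Q, ENNReal.ofReal (LL * ‖intVec l‖) * (K * ell2 u))
          + ∑' n, K * (ENNReal.ofReal (2 * √(d / N) * ((1 + ‖n‖) * b n)) * ell2 u) := by
          gcongr
          · refine (l2norm_add_le mW.enorm.aemeasurable (Finset.measurable_sum _ fun l _ => mU l).aemeasurable).trans ?_
            rw [nW]
            gcongr
            exact (l2norm_finset_sum_le Q mU).trans (Finset.sum_le_sum fun l _ => nU l)
          · refine (l2norm_tsum_le fun n => (mX n).enorm).trans ?_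
            gcongr with n
            exact nX n
      _ = _ := by
          rw [ENNReal.tsum_mul_left, ENNReal.tsum_mul_right, ← Finset.sum_mul,
            ← ENNReal.ofReal_tsum_of_nonneg (fun n => by have := hb0 n; positivity) (hb.mul_left _), tsum_mul_left,
            ← ENNReal.ofReal_sum_of_nonneg, ← Finset.mul_sum]
          · ring
          · intro l _
            exact mul_nonneg (tsum_nonneg hL0) (norm_nonneg _)
  exact (ENNReal.mul_le_mul_iff_right hK0 hKt).mp hfin

/-- The absorbed form of `frozen_symbol_estimate`: the symbol is allowed a large variation in `x`, but
its variation in the frequency has to be small. -/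
theorem ell2_le_of_symbol (d : ℕ) {c B : ℝ} (hc : 0 < c) (hB : 0 ≤ B) :
    ∃ Γ : ℝ, 0 < Γ ∧ ∀ (u R : (Fin d → ℤ) → ℂ) (p : (Fin d → ℤ) → (Fin d → ℤ) → ℂ)
      (b L : (Fin d → ℤ) → ℝ), ell2 u ≠ ⊤ → (Summable fun n => (1 + ‖n‖) * b n) →
      (∑' n, (1 + ‖n‖) * b n ≤ B) → (∀ n k, ‖p n k‖ ≤ b n) → Summable L → (∀ n, 0 ≤ L n) →
      (∀ n k l, ‖p n k - p n (k - l)‖ ≤ L n * ‖intVec l‖) → (∑' n, L n) * Γ ≤ c →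
      (∀ᵐ y : Torus d, ∀ k, c ≤ ‖1 - ∑' n, tchar n y * p n k‖) →
      (∀ k, R k = u k - ∑' n, p n (k - n) * u (k - n)) →
      ENNReal.ofReal (c / 2) * ell2 u ≤ ell2 R := by
  -- the side `N` of the cube makes the error `2 √(d / N) B` at most `c / 4`
  obtain ⟨N, hN⟩ := exists_nat_gt (64 * d * B ^ 2 / c ^ 2)
  have hN0 : (0 : ℝ) < N := lt_of_le_of_lt (by positivity) hN
  have hN1 : 0 < N := by exact_mod_cast hN0
  have hsq : 2 * √(d / N) * B ≤ c / 4 := by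
    have h1 : √(d / N) * (8 * B) ≤ c := by
      have : √(d / N) * (8 * B) = √(d / N * (8 * B) ^ 2) := by
        rw [Real.sqrt_mul (by positivity), Real.sqrt_sq (by positivity)]
      rw [this, Real.sqrt_le_left hc.le, div_mul_eq_mul_div, div_le_iff₀ hN0]
      rw [div_lt_iff₀ (by positivity)] at hN
      nlinarith
    linarith
  -- the factor `4` makes the error from the variation in the frequency at most `c / 4`
  refine ⟨4 * (1 + ∑ l ∈ cube d N, ‖intVec l‖), by positivity, ?_⟩
  intro u R p b L hu hb hbB hp hLs hL0 hL hLΓ hpen hR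
  have h := frozen_symbol_estimate hN1 hu hb hp hLs hL0 hL hpen hR
  have hL1 : (∑' n, L n) * ∑ l ∈ cube d N, ‖intVec l‖ ≤ c / 4 := by
    have : 0 ≤ ∑' n, L n := tsum_nonneg hL0
    nlinarith
  have hB1 : 2 * √(d / N) * ∑' n, (1 + ‖n‖) * b n ≤ c / 4 :=
    le_trans (by gcongr) hsq
  have h2 : ENNReal.ofReal (c / 2) * ell2 u + ENNReal.ofReal (c / 2) * ell2 u
      ≤ ell2 R + ENNReal.ofReal (c / 2) * ell2 u := by
    calc _ = ENNReal.ofReal c * ell2 u := by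
          rw [← add_mul, ← ENNReal.ofReal_add (by positivity) (by positivity), add_halves]
      _ ≤ _ := h
      _ ≤ ell2 R + ENNReal.ofReal (c / 4) * ell2 u + ENNReal.ofReal (c / 4) * ell2 u := by gcongr
      _ = _ := by
          rw [add_assoc, ← add_mul, ← ENNReal.ofReal_add (by positivity) (by positivity)]
          congr 3
          ring
  exact (ENNReal.add_le_add_iff_right (ENNReal.mul_ne_top ENNReal.ofReal_ne_top hu)).mp h2

/-! ### Volterra convolution operators on sequences of functions of time -/

/-- The measure on `ℤᵈ × ℝ`: counting times Lebesgue. -/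
abbrev seqMeasure (d : ℕ) : Measure ((Fin d → ℤ) × ℝ) := Measure.count.prod volume

/-- The `L²(ℝ; ℓ²(ℤᵈ))` norm of a family of nonnegative functions. -/
def seqNorm (g : (Fin d → ℤ) → ℝ → ℝ≥0∞) : ℝ≥0∞ :=
  l2norm (seqMeasure d) (fun z => g z.1 z.2)

theorem measurable_uncurry_seq {E : Type*} [MeasurableSpace E] {g : (Fin d → ℤ) → ℝ → E}
    (hg : ∀ k, Measurable (g k)) : Measurable (fun z : (Fin d → ℤ) × ℝ => g z.1 z.2) :=
  measurable_from_prod_countable_right hg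

theorem seqNorm_sq {g : (Fin d → ℤ) → ℝ → ℝ≥0∞} (hg : ∀ k, Measurable (g k)) :
    seqNorm g ^ 2 = ∑' k, ∫⁻ t, g k t ^ 2 := by
  unfold seqNorm
  rw [l2norm_sq, lintegral_prod _ ((measurable_uncurry_seq hg).pow_const 2).aemeasurable,
    lintegral_count]

theorem ae_seqMeasure {P : (Fin d → ℤ) → ℝ → Prop} (h : ∀ k, ∀ᵐ t, P k t) :
    ∀ᵐ z ∂(seqMeasure d), P z.1 z.2 := by
  have : ∀ k, ∃ s : Set ℝ, MeasurableSet s ∧ volume s = 0 ∧ ∀ t, t ∉ s → P k t := by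
    intro k
    obtain ⟨s, hs1, hs2, hs3⟩ := exists_measurable_superset_of_null (h k)
    exact ⟨s, hs2, hs3, fun t ht => by_contra fun hc => ht (hs1 hc)⟩
  choose s hs1 hs2 hs3 using this
  have hm : MeasurableSet {z : (Fin d → ℤ) × ℝ | z.2 ∈ s z.1} := by
    have : {z : (Fin d → ℤ) × ℝ | z.2 ∈ s z.1} = ⋃ k, ({k} : Set (Fin d → ℤ)) ×ˢ s k := by
      ext z
      simp [eq_comm]
    rw [this]
    exact MeasurableSet.iUnion fun k => (measurableSet_singleton k).prod (hs1 k)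
  have h0 : seqMeasure d {z | z.2 ∈ s z.1} = 0 := by
    rw [Measure.prod_apply hm]
    simp [hs2, Set.preimage]
  filter_upwards [compl_mem_ae_iff.mpr h0] with z hz
  exact hs3 _ _ hz

theorem seqNorm_mono_ae {f g : (Fin d → ℤ) → ℝ → ℝ≥0∞} (h : ∀ k, ∀ᵐ t, f k t ≤ g k t) :
    seqNorm f ≤ seqNorm g :=
  l2norm_mono_ae (ae_seqMeasure h)

theorem seqNorm_mono {f g : (Fin d → ℤ) → ℝ → ℝ≥0∞} (h : ∀ k t, f k t ≤ g k t) :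
    seqNorm f ≤ seqNorm g :=
  l2norm_mono fun _ => h _ _

theorem seqNorm_add_le {f g : (Fin d → ℤ) → ℝ → ℝ≥0∞} (hf : ∀ k, Measurable (f k))
    (hg : ∀ k, Measurable (g k)) :
    seqNorm (fun k t => f k t + g k t) ≤ seqNorm f + seqNorm g :=
  l2norm_add_le (measurable_uncurry_seq hf).aemeasurable (measurable_uncurry_seq hg).aemeasurable

/-- Monotone convergence for `seqNorm`. -/
theorem seqNorm_le_of_monotone {f : ℕ → (Fin d → ℤ) → ℝ → ℝ≥0∞} {g : (Fin d → ℤ) → ℝ → ℝ≥0∞}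
    {C : ℝ≥0∞} (hf : ∀ j k, Measurable (f j k)) (hmono : ∀ k t, Monotone fun j => f j k t)
    (hg : ∀ k t, g k t ≤ ⨆ j, f j k t) (hC : ∀ j, seqNorm (f j) ≤ C) : seqNorm g ≤ C := by
  refine (seqNorm_mono hg).trans ?_
  rw [← ennreal_sq_le_sq_iff]
  unfold seqNorm
  rw [l2norm_sq]
  have h1 : ∀ z : (Fin d → ℤ) × ℝ, (⨆ j, f j z.1 z.2) ^ 2 = ⨆ j, f j z.1 z.2 ^ 2 := by
    intro z
    simp only [← ENNReal.rpow_two]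
    exact (ENNReal.orderIsoRpow 2 (by norm_num)).map_iSup _
  simp_rw [h1]
  rw [lintegral_iSup (fun j => (measurable_uncurry_seq (hf j)).pow_const 2)]
  · refine iSup_le fun j => ?_
    rw [← l2norm_sq]
    exact ennreal_sq_le_sq_iff.mpr (hC j)
  · intro i j hij z
    exact pow_le_pow_left' (hmono _ _ hij) 2

/-- The convolution operator in time for nonnegative functions, with matrix kernel `w n k s`, which maps the mode `k`
to the mode `k + n`. -/
def posConv (w : (Fin d → ℤ) → (Fin d → ℤ) → ℝ → ℝ≥0∞) (g : (Fin d → ℤ) → ℝ → ℝ≥0∞)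
    (k : Fin d → ℤ) (t : ℝ) : ℝ≥0∞ :=
  ∑' n, ∫⁻ s, w n (k - n) s * g (k - n) (t - s)

theorem measurable_posConv_term {w : ℝ → ℝ≥0∞} {g : ℝ → ℝ≥0∞} (hw : Measurable w)
    (hg : Measurable g) : Measurable fun t => ∫⁻ s, w s * g (t - s) :=
  Measurable.lintegral_prod_right' (f := fun z : ℝ × ℝ => w z.2 * g (z.1 - z.2))
    ((hw.comp measurable_snd).mul (hg.comp (measurable_fst.sub measurable_snd)))

theorem measurable_posConv {w : (Fin d → ℤ) → (Fin d → ℤ) → ℝ → ℝ≥0∞}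
    {g : (Fin d → ℤ) → ℝ → ℝ≥0∞} (hw : ∀ n k, Measurable (w n k)) (hg : ∀ k, Measurable (g k))
    (k : Fin d → ℤ) : Measurable (posConv w g k) :=
  Measurable.tsum fun _ => measurable_posConv_term (hw _ _) (hg _)

/-- Young's inequality: a matrix convolution kernel acts on `L²(ℝ; ℓ²)`, with norm at most the sum
over the diagonals `n` of a bound for the `L¹` norms of its entries. -/
theorem seqNorm_posConv_le {w : (Fin d → ℤ) → (Fin d → ℤ) → ℝ → ℝ≥0∞}
    {g : (Fin d → ℤ) → ℝ → ℝ≥0∞} {β : (Fin d → ℤ) → ℝ≥0∞} (hw : ∀ n k, Measurable (w n k))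
    (hg : ∀ k, Measurable (g k)) (hβ : ∀ n k, ∫⁻ s, w n k s ≤ β n) :
    seqNorm (posConv w g) ≤ (∑' n, β n) * seqNorm g := by
  have hm : ∀ n k, Measurable fun t => ∫⁻ s, w n (k - n) s * g (k - n) (t - s) :=
    fun n k => measurable_posConv_term (hw _ _) (hg _)
  have h1 : seqNorm (posConv w g) ≤ ∑' n, seqNorm (fun k t => ∫⁻ s, w n (k - n) s * g (k - n) (t - s)) :=
    l2norm_tsum_le (fun n => measurable_uncurry_seq (hm n))
  refine h1.trans ?_
  rw [← ENNReal.tsum_mul_right]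
  gcongr with n
  rw [← ennreal_sq_le_sq_iff, mul_pow, seqNorm_sq (hm n), seqNorm_sq hg]
  have h2 : ∀ k, ∫⁻ t, (∫⁻ s, w n (k - n) s * g (k - n) (t - s)) ^ 2
      ≤ β n ^ 2 * ∫⁻ t, g (k - n) t ^ 2 := by
    intro k
    have hmm : Measurable fun z : ℝ × ℝ => w n (k - n) z.2 * g (k - n) (z.1 - z.2) ^ 2 :=
      ((hw n (k - n)).comp measurable_snd).mul
        (((hg (k - n)).comp (measurable_fst.sub measurable_snd)).pow_const 2)
    calc _ ≤ ∫⁻ t, β n * ∫⁻ s, w n (k - n) s * g (k - n) (t - s) ^ 2 := by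
          gcongr with t
          have ma : Measurable fun s => g (k - n) (t - s) :=
            (hg _).comp (measurable_const.sub measurable_id)
          refine (sq_lintegral_mul_le volume (hw _ _).aemeasurable ma.aemeasurable).trans ?_
          gcongr
          exact hβ _ _
      _ = β n * ∫⁻ s, ∫⁻ t, w n (k - n) s * g (k - n) (t - s) ^ 2 := by
          rw [lintegral_const_mul _ (Measurable.lintegral_prod_right' hmm),
            lintegral_lintegral_swap hmm.aemeasurable]
      _ = β n * ∫⁻ s, w n (k - n) s * ∫⁻ t, g (k - n) t ^ 2 := by
          congr 1
          refine lintegral_congr fun s => ?_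
          have ma : Measurable fun t => g (k - n) (t - s) :=
            (hg _).comp (measurable_id.sub measurable_const)
          rw [lintegral_const_mul _ (ma.pow_const 2)]
          congr 1
          exact lintegral_sub_right_eq_self (fun t => g (k - n) t ^ 2) s
      _ ≤ _ := by
          rw [lintegral_mul_const _ (hw _ _), sq, mul_assoc]
          gcongr
          exact hβ _ _
  calc _ ≤ ∑' k, β n ^ 2 * ∫⁻ t, g (k - n) t ^ 2 := ENNReal.tsum_le_tsum h2
    _ = _ := by
      rw [ENNReal.tsum_mul_left]
      congr 1
      exact (Equiv.subRight n).tsum_eq fun k => ∫⁻ t, g k t ^ 2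

/-! ### Coercivity of the Volterra operator -/

open FourierTransform in
/-- The properties of a matrix Volterra kernel `m n k s` (`s` is the time lag, and the kernel maps the
mode `k` to the mode `k + n`) on which the estimates rest: `b n`, `L n` and `D n` bound the `L¹` norm in
time, the Lipschitz constant in the frequency and the supremum along the `n`-th diagonal, and `c` is the
lower bound for the symbol of the identity minus the damped operator. -/
structure PenroseKernel (m : (Fin d → ℤ) → (Fin d → ℤ) → ℝ → ℂ) (b L D : (Fin d → ℤ) → ℝ)
    (c : ℝ) : Prop where
  meas : ∀ n k, Measurable (m n k)
  supp : ∀ n k s, s < 0 → m n k s = 0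
  nonneg : ∀ n, 0 ≤ b n
  summable : Summable fun n => (1 + ‖n‖) * b n
  lintegral_le : ∀ n k, ∫⁻ s, ‖m n k s‖ₑ ≤ ENNReal.ofReal (b n)
  lip_nonneg : ∀ n, 0 ≤ L n
  lip_summable : Summable L
  lip : ∀ n k l s, ‖m n k s - m n (k - l) s‖ ≤ L n * ‖intVec l‖
  sup_summable : Summable D
  norm_le : ∀ n k s, ‖m n k s‖ ≤ D n
  lower : ∀ᵐ y : Torus d, ∀ γ : ℝ, 0 < γ → ∀ (τ : ℝ) (k : Fin d → ℤ),
    c ≤ ‖1 - ∑' n, tchar n y * 𝓕 (fun s => (Real.exp (-γ * s) : ℂ) * m n k s) τ‖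

/-- The kernel with an exponential damping. -/
def damped (γ : ℝ) (m : (Fin d → ℤ) → (Fin d → ℤ) → ℝ → ℂ) (n k : Fin d → ℤ) (s : ℝ) : ℂ :=
  (Real.exp (-γ * s) : ℂ) * m n k s

/-- The Volterra operator with kernel `e^{-γ s} m n k s`. -/
def volterra (γ : ℝ) (m : (Fin d → ℤ) → (Fin d → ℤ) → ℝ → ℂ) (h : (Fin d → ℤ) → ℝ → ℂ)
    (k : Fin d → ℤ) (t : ℝ) : ℂ :=
  ∑' n, ∫ s, damped γ m n (k - n) s * h (k - n) (t - s)

theorem enorm_volterra_le (γ : ℝ) (m : (Fin d → ℤ) → (Fin d → ℤ) → ℝ → ℂ)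
    (h : (Fin d → ℤ) → ℝ → ℂ) (k : Fin d → ℤ) (t : ℝ) :
    ‖volterra γ m h k t‖ₑ
      ≤ posConv (fun n k s => ‖damped γ m n k s‖ₑ) (fun k t => ‖h k t‖ₑ) k t := by
  refine enorm_tsum_le_tsum_enorm.trans ?_
  unfold posConv
  gcongr with n
  refine (enorm_integral_le_lintegral_enorm _).trans_eq ?_
  simp only [enorm_mul]

namespace PenroseKernel
variable {m : (Fin d → ℤ) → (Fin d → ℤ) → ℝ → ℂ} {b L D : (Fin d → ℤ) → ℝ} {c : ℝ}

theorem summable_b (hm : PenroseKernel m b L D c) : Summable b := by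
  refine Summable.of_nonneg_of_le hm.nonneg (fun n => ?_) hm.summable
  have := mul_nonneg (norm_nonneg n) (hm.nonneg n)
  linarith

theorem tsum_ofReal_ne_top (hm : PenroseKernel m b L D c) : ∑' n, ENNReal.ofReal (b n) ≠ ⊤ :=
  hm.summable_b.tsum_ofReal_ne_top

theorem measurable_damped (hm : PenroseKernel m b L D c) (γ : ℝ) (n k : Fin d → ℤ) :
    Measurable (damped γ m n k) := by
  have := hm.meas n k
  unfold damped
  fun_prop

theorem norm_damped_le (hm : PenroseKernel m b L D c) {γ : ℝ} (hγ : 0 ≤ γ) (n k : Fin d → ℤ) (s : ℝ) :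
    ‖damped γ m n k s‖ ≤ ‖m n k s‖ := by
  unfold damped
  rcases lt_or_ge s 0 with hs | hs
  · simp [hm.supp n k s hs]
  · rw [norm_mul, Complex.norm_real, Real.norm_of_nonneg (Real.exp_pos _).le]
    refine mul_le_of_le_one_left (norm_nonneg _) (Real.exp_le_one_iff.mpr ?_)
    nlinarith

theorem lintegral_damped_le (hm : PenroseKernel m b L D c) {γ : ℝ} (hγ : 0 ≤ γ) (n k : Fin d → ℤ) :
    ∫⁻ s, ‖damped γ m n k s‖ₑ ≤ ENNReal.ofReal (b n) := by
  refine le_trans (lintegral_mono fun s => ?_) (hm.lintegral_le n k)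
  exact enorm_le_iff_norm_le.mpr (hm.norm_damped_le hγ n k s)

theorem integrable_damped (hm : PenroseKernel m b L D c) {γ : ℝ} (hγ : 0 ≤ γ) (n k : Fin d → ℤ) :
    Integrable (damped γ m n k) :=
  ⟨(hm.measurable_damped γ n k).aestronglyMeasurable,
    (hm.lintegral_damped_le hγ n k).trans_lt ENNReal.ofReal_lt_top⟩

open FourierTransform in
theorem norm_fourier_damped_le (hm : PenroseKernel m b L D c) {γ : ℝ} (hγ : 0 ≤ γ)
    (n k : Fin d → ℤ) (τ : ℝ) : ‖𝓕 (damped γ m n k) τ‖ ≤ b n := by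
  refine (VectorFourier.norm_fourierIntegral_le_integral_norm _ _ _ _ _).trans ?_
  rw [integral_norm_eq_lintegral_enorm (hm.integrable_damped hγ n k).1]
  exact ENNReal.toReal_le_of_le_ofReal (hm.nonneg n) (hm.lintegral_damped_le hγ n k)

open FourierTransform in
theorem norm_fourier_damped_sub_le (hm : PenroseKernel m b L D c) {γ : ℝ} (hγ : 0 < γ)
    (n k l : Fin d → ℤ) (τ : ℝ) :
    ‖𝓕 (damped γ m n k) τ - 𝓕 (damped γ m n (k - l)) τ‖ ≤ L n / γ * ‖intVec l‖ := by
  have e : 𝓕 (damped γ m n k) τ - 𝓕 (damped γ m n (k - l)) τ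
      = 𝓕 (fun s => damped γ m n k s - damped γ m n (k - l) s) τ := by
    simp only [Real.fourier_eq]
    rw [← integral_sub]
    · simp only [smul_sub]
    · simpa using! (Real.fourierIntegral_convergent_iff τ).mpr (hm.integrable_damped hγ.le n k)
    · simpa using! (Real.fourierIntegral_convergent_iff τ).mpr (hm.integrable_damped hγ.le n (k - l))
  rw [e]
  refine (VectorFourier.norm_fourierIntegral_le_integral_norm _ _ _ _ _).trans ?_
  have hexp : IntegrableOn (fun s => Real.exp (-γ * s)) (Ioi 0) := exp_neg_integrableOn_Ioi 0 hγ
  have h1 : ∫ s in Ioi (0 : ℝ), Real.exp (-γ * s) = 1 / γ := by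
    have := integral_exp_mul_Ioi (a := -γ) (by linarith) 0
    rw [this]
    simp [neg_div_neg_eq]
  calc ∫ s, ‖damped γ m n k s - damped γ m n (k - l) s‖
      ≤ ∫ s, (Ici (0:ℝ)).indicator (fun s => Real.exp (-γ * s) * (L n * ‖intVec l‖)) s := by
        refine integral_mono_of_nonneg (.of_forall fun s => norm_nonneg _) ?_ (.of_forall fun s => ?_)
        · rw [integrable_indicator_iff measurableSet_Ici, integrableOn_Ici_iff_integrableOn_Ioi]
          exact hexp.mul_const _
        · rcases lt_or_ge s 0 with hs | hs
          · simp [damped, hm.supp _ _ s hs, hs]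
          · rw [indicator_of_mem (mem_Ici.mpr hs)]
            dsimp only
            unfold damped
            rw [← mul_sub, norm_mul, Complex.norm_real, Real.norm_of_nonneg (Real.exp_pos _).le]
            gcongr
            exact hm.lip n k l s
    _ = _ := by
        rw [integral_indicator measurableSet_Ici, integral_Ici_eq_integral_Ioi, integral_mul_const, h1]
        ring

end PenroseKernel

open FourierTransform in
/-- The coercivity estimate, for functions which are square integrable and integrable in time: the
Fourier transform in time reduces it to `ell2_le_of_symbol`. -/
theorem seqNorm_le_of_penroseKernel (d : ℕ) {c B : ℝ} (hc : 0 < c) (hB : 0 ≤ B) :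
    ∃ Γ : ℝ, 0 < Γ ∧ ∀ (m : (Fin d → ℤ) → (Fin d → ℤ) → ℝ → ℂ) (b L D : (Fin d → ℤ) → ℝ),
      PenroseKernel m b L D c → (∑' n, (1 + ‖n‖) * b n ≤ B) → ∀ γ : ℝ, 0 < γ →
      (∑' n, L n) * Γ ≤ c * γ → ∀ (g : (Fin d → ℤ) → ℝ → ℂ) (A : ℝ≥0∞), (∀ k, Measurable (g k)) →
      seqNorm (fun k t => ‖g k t‖ₑ) ≠ ⊤ → A ≠ ⊤ → (∀ k, ∫⁻ t, ‖g k t‖ₑ ≤ A) →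
      ENNReal.ofReal (c / 2) * seqNorm (fun k t => ‖g k t‖ₑ)
        ≤ seqNorm (fun k t => ‖g k t - volterra γ m g k t‖ₑ) := by
  obtain ⟨Γ, hΓ0, hΓ⟩ := ell2_le_of_symbol d hc hB
  refine ⟨Γ, hΓ0, ?_⟩
  intro m b L D hm hbB γ hγ hLγ g A hg hgfin hA hgA
  have hgi : ∀ k, Integrable (g k) := fun k =>
    ⟨(hg k).aestronglyMeasurable, (hgA k).trans_lt hA.lt_top⟩
  have hgA' : ∀ k, ∫ t, ‖g k t‖ ≤ A.toReal := by
    intro k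
    rw [integral_norm_eq_lintegral_enorm (hgi k).1]
    exact ENNReal.toReal_mono hA (hgA k)
  set T : (Fin d → ℤ) → (Fin d → ℤ) → ℝ → ℂ := fun k n t =>
    ∫ s, damped γ m n (k - n) s * g (k - n) (t - s) with hT
  have hTconv : ∀ k n, T k n = convolution (damped γ m n (k - n)) (g (k - n))
      (ContinuousLinearMap.mul ℂ ℂ) volume := fun k n => rfl
  have hTi : ∀ k n, Integrable (T k n) := fun k n => by
    rw [hTconv]
    exact (hm.integrable_damped hγ.le _ _).integrable_convolution _ (hgi _)
  -- Young's inequality in `L¹` for the terms of the operator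
  have hTe : ∀ k n, ∫⁻ t, ‖T k n t‖ₑ ≤ ENNReal.ofReal (b n) * A := by
    intro k n
    have hmm : Measurable fun z : ℝ × ℝ => ‖damped γ m n (k - n) z.2‖ₑ * ‖g (k - n) (z.1 - z.2)‖ₑ :=
      ((hm.measurable_damped γ n (k - n)).comp measurable_snd).enorm.mul
        ((hg (k - n)).comp (measurable_fst.sub measurable_snd)).enorm
    calc _ ≤ ∫⁻ t, ∫⁻ s, ‖damped γ m n (k - n) s‖ₑ * ‖g (k - n) (t - s)‖ₑ := by
          gcongr with t
          refine (enorm_integral_le_lintegral_enorm _).trans_eq ?_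
          simp only [enorm_mul]
      _ = ∫⁻ s, ‖damped γ m n (k - n) s‖ₑ * ∫⁻ t, ‖g (k - n) t‖ₑ := by
          rw [lintegral_lintegral_swap hmm.aemeasurable]
          refine lintegral_congr fun s => ?_
          have ma : Measurable fun t => ‖g (k - n) (t - s)‖ₑ :=
            ((hg _).comp (measurable_id.sub measurable_const)).enorm
          rw [lintegral_const_mul _ ma]
          congr 1
          exact lintegral_sub_right_eq_self (fun t => ‖g (k - n) t‖ₑ) s
      _ ≤ _ := by
          rw [lintegral_mul_const _ (hm.measurable_damped γ n (k - n)).enorm]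
          gcongr
          · exact hm.lintegral_damped_le hγ.le _ _
          · exact hgA _
  have hTn : ∀ k n, ∫ t, ‖T k n t‖ ≤ b n * A.toReal := by
    intro k n
    rw [integral_norm_eq_lintegral_enorm (hTi k n).1]
    refine (ENNReal.toReal_mono (ENNReal.mul_ne_top ENNReal.ofReal_ne_top hA) (hTe k n)).trans_eq ?_
    rw [ENNReal.toReal_mul, ENNReal.toReal_ofReal (hm.nonneg n)]
  have hTs : ∀ k, Summable fun n => ∫ t, ‖T k n t‖ := fun k =>
    Summable.of_nonneg_of_le (fun n => integral_nonneg fun t => norm_nonneg _) (hTn k)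
      (hm.summable_b.mul_right _)
  have hVm : ∀ k, Measurable (volterra γ m g k) := by
    intro k
    refine Measurable.tsum fun n => ?_
    have : StronglyMeasurable fun z : ℝ × ℝ => damped γ m n (k - n) z.2 * g (k - n) (z.1 - z.2) :=
      (((hm.measurable_damped γ n (k - n)).comp measurable_snd).mul
        ((hg (k - n)).comp (measurable_fst.sub measurable_snd))).stronglyMeasurable
    exact this.integral_prod_right.measurable
  have hVi : ∀ k, Integrable (volterra γ m g k) := by
    intro k
    refine ⟨(hVm k).aestronglyMeasurable, ?_⟩
    calc ∫⁻ t, ‖volterra γ m g k t‖ₑ ≤ ∫⁻ t, ∑' n, ‖T k n t‖ₑ :=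
          lintegral_mono fun t => enorm_tsum_le_tsum_enorm
      _ = ∑' n, ∫⁻ t, ‖T k n t‖ₑ := lintegral_tsum fun n => (hTi k n).1.enorm
      _ ≤ ∑' n, ENNReal.ofReal (b n) * A := ENNReal.tsum_le_tsum (hTe k)
      _ < ⊤ := by
          rw [ENNReal.tsum_mul_right]
          exact (ENNReal.mul_ne_top hm.tsum_ofReal_ne_top hA).lt_top
  set S : (Fin d → ℤ) → ℝ → ℂ := fun k t => g k t - volterra γ m g k t with hS
  have hSi : ∀ k, Integrable (S k) := fun k => (hgi k).sub (hVi k)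
  have hSm : ∀ k, Measurable (S k) := fun k => (hg k).sub (hVm k)
  have hfs : ∀ {f : ℝ → ℂ}, Integrable f → ∀ τ : ℝ,
      Integrable fun v : ℝ => Real.fourierChar (-(inner ℝ v τ)) • f v := fun hf τ =>
    (Real.fourierIntegral_convergent_iff τ).mpr hf
  -- the equation after the Fourier transform in time
  have hFS : ∀ τ k, 𝓕 (S k) τ = 𝓕 (g k) τ
      - ∑' n, 𝓕 (damped γ m n (k - n)) τ * 𝓕 (g (k - n)) τ := by
    intro τ k
    have e1 : 𝓕 (S k) τ = 𝓕 (g k) τ - 𝓕 (volterra γ m g k) τ := by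
      simp only [Real.fourier_eq]
      rw [← integral_sub (hfs (hgi k) τ) (hfs (hVi k) τ)]
      simp only [hS, smul_sub]
    rw [e1]
    congr 1
    have e2 : ∀ n, 𝓕 (damped γ m n (k - n)) τ * 𝓕 (g (k - n)) τ = 𝓕 (T k n) τ := by
      intro n
      rw [hTconv, Real.fourier_mul_convolution_eq (hm.integrable_damped hγ.le _ _) (hgi _)]
    simp_rw [e2, Real.fourier_eq]
    rw [integral_tsum_of_summable_integral_norm (fun n => hfs (hTi k n) τ) (by simpa using hTs k)]
    refine integral_congr_ae (.of_forall fun t => ?_)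
    simp only [Circle.smul_def, smul_eq_mul, volterra]
    exact tsum_mul_left.symm
  by_cases hSfin : seqNorm (fun k t => ‖S k t‖ₑ) = ⊤
  · rw [hSfin]; exact le_top
  have hmemLp : ∀ {f : (Fin d → ℤ) → ℝ → ℂ}, (∀ k, Measurable (f k)) →
      seqNorm (fun k t => ‖f k t‖ₑ) ≠ ⊤ → ∀ k, MemLp (f k) 2 := by
    intro f hf hfin k
    replace hfin := ENNReal.pow_ne_top (n := 2) hfin
    rw [seqNorm_sq fun k => (hf k).enorm] at hfin
    refine ⟨(hf k).aestronglyMeasurable, ?_⟩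
    rw [eLpNorm_lt_top_iff_lintegral_rpow_enorm_lt_top (by norm_num) (by norm_num)]
    simp only [ENNReal.toReal_ofNat, ENNReal.rpow_two]
    exact (ENNReal.ne_top_of_tsum_ne_top hfin k).lt_top
  have hcont : ∀ {f : ℝ → ℂ}, Integrable f → Measurable (𝓕 f) := fun hf =>
    (VectorFourier.fourierIntegral_continuous Real.continuous_fourierChar
      (by exact continuous_inner) hf).measurable
  -- Plancherel's theorem in time
  have hplanch : ∀ {f : (Fin d → ℤ) → ℝ → ℂ}, (∀ k, Measurable (f k)) → (∀ k, Integrable (f k)) →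
      seqNorm (fun k t => ‖f k t‖ₑ) ≠ ⊤ →
      seqNorm (fun k t => ‖f k t‖ₑ) ^ 2 = ∫⁻ τ, ell2 (fun k => 𝓕 (f k) τ) ^ 2 := by
    intro f hf hfi hfin
    simp_rw [ell2_sq]
    rw [seqNorm_sq fun k => (hf k).enorm, lintegral_tsum fun k => ((hcont (hfi k)).enorm.pow_const 2).aemeasurable]
    refine tsum_congr fun k => ?_
    exact (lintegral_enorm_fourier_sq (hfi k) (hmemLp hf hfin k)).symm
  have hae : ∀ᵐ τ : ℝ, ell2 (fun k => 𝓕 (g k) τ) ≠ ⊤ := by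
    have h1 := hplanch hg hgi hgfin
    have h2 : ∫⁻ τ, ell2 (fun k => 𝓕 (g k) τ) ^ 2 ≠ ⊤ := by
      rw [← h1]
      exact ENNReal.pow_ne_top hgfin
    have h3 : Measurable fun τ => ell2 (fun k => 𝓕 (g k) τ) ^ 2 := by
      simp_rw [ell2_sq]
      exact Measurable.tsum fun k => (hcont (hgi k)).enorm.pow_const 2
    filter_upwards [ae_lt_top h3 h2] with τ hτ
    exact (ENNReal.pow_ne_top_iff.mp hτ.ne).resolve_right two_ne_zero
  -- the estimate at each time frequency `τ`; damping makes the symbol Lipschitz with constants `L n / γ`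
  have key : ∀ᵐ τ : ℝ, ENNReal.ofReal (c / 2) * ell2 (fun k => 𝓕 (g k) τ)
      ≤ ell2 (fun k => 𝓕 (S k) τ) := by
    filter_upwards [hae] with τ hτ
    refine hΓ _ _ (fun n k => 𝓕 (damped γ m n k) τ) b (fun n => L n / γ) hτ hm.summable hbB
      (fun n k => hm.norm_fourier_damped_le hγ.le n k τ) (hm.lip_summable.div_const γ)
      (fun n => div_nonneg (hm.lip_nonneg n) hγ.le)
      (fun n k l => hm.norm_fourier_damped_sub_le hγ n k l τ) ?_ ?_ (fun k => hFS τ k)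
    · rw [tsum_div_const, div_mul_eq_mul_div, div_le_iff₀ hγ]
      exact hLγ
    · filter_upwards [hm.lower] with y hy k
      exact hy γ hγ τ k
  rw [← ennreal_sq_le_sq_iff, mul_pow, hplanch hg hgi hgfin, hplanch hSm hSi hSfin,
    ← lintegral_const_mul' _ _ (ENNReal.pow_ne_top ENNReal.ofReal_ne_top)]
  refine lintegral_mono_ae ?_
  filter_upwards [key] with τ hτ
  rw [← mul_pow]
  exact ennreal_sq_le_sq_iff.mpr hτ

/-! ### Exponential weights -/

/-- The Volterra equation `h = V h + R` for families of functions of time `h k`, `k ∈ ℤᵈ`, which vanish for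
negative times. -/
structure ModeEq (γ : ℝ) (m : (Fin d → ℤ) → (Fin d → ℤ) → ℝ → ℂ)
    (h R : (Fin d → ℤ) → ℝ → ℂ) : Prop where
  meas : ∀ k, Measurable (h k)
  meas_source : ∀ k, Measurable (R k)
  supp : ∀ k t, t < 0 → h k t = 0
  supp_source : ∀ k t, t < 0 → R k t = 0
  eq : ∀ k, ∀ᵐ t, h k t = volterra γ m h k t + R k t

/-- Conjugation by an exponential weight amounts to a shift of `γ`. -/
theorem ModeEq.shift {γ : ℝ} {m : (Fin d → ℤ) → (Fin d → ℤ) → ℝ → ℂ}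
    {h R : (Fin d → ℤ) → ℝ → ℂ} (H : ModeEq γ m h R) (μ : ℝ) :
    ModeEq (γ + μ) m (fun k t => (Real.exp (-μ * t) : ℂ) * h k t)
      (fun k t => (Real.exp (-μ * t) : ℂ) * R k t) where
  meas k := by have := H.meas k; fun_prop
  meas_source k := by have := H.meas_source k; fun_prop
  supp k t ht := by simp [H.supp k t ht]
  supp_source k t ht := by simp [H.supp_source k t ht]
  eq k := by
    filter_upwards [H.eq k] with t ht
    have : volterra (γ + μ) m (fun k t => (Real.exp (-μ * t) : ℂ) * h k t) k t
        = (Real.exp (-μ * t) : ℂ) * volterra γ m h k t := by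
      unfold volterra damped
      rw [← tsum_mul_left]
      refine tsum_congr fun n => ?_
      rw [← integral_const_mul]
      congr 1
      ext s
      have e : (Real.exp (-(γ + μ) * s) : ℂ) * (Real.exp (-μ * (t - s)) : ℂ)
          = (Real.exp (-μ * t) : ℂ) * (Real.exp (-γ * s) : ℂ) := by
        rw [← Complex.ofReal_mul, ← Complex.ofReal_mul, ← Real.exp_add, ← Real.exp_add]
        congr 2
        ring
      linear_combination (m n (k - n) s * h (k - n) (t - s)) * e
    rw [this, ht, mul_add]

/-- A weight `v` passes through a convolution if `v(t) w(s) ≤ w'(s) v(t - s)`, that is, at the cost of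
replacing the kernel `w` by `w'`. -/
theorem mul_posConv_le {w w' : (Fin d → ℤ) → (Fin d → ℤ) → ℝ → ℝ≥0∞} {g : (Fin d → ℤ) → ℝ → ℝ≥0∞}
    {v : ℝ → ℝ≥0∞} (hv : ∀ n k t s, v t * w n k s ≤ w' n k s * v (t - s)) (k : Fin d → ℤ) (t : ℝ)
    (hvt : v t ≠ ⊤) :
    v t * posConv w g k t ≤ posConv w' (fun k t => v t * g k t) k t := by
  unfold posConv
  rw [← ENNReal.tsum_mul_left]
  gcongr with n
  rw [← lintegral_const_mul' _ _ hvt]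
  refine lintegral_mono fun s => ?_
  rw [← mul_assoc, ← mul_assoc]
  exact mul_le_mul_left (hv n _ t s) _

namespace PenroseKernel
variable {m : (Fin d → ℤ) → (Fin d → ℤ) → ℝ → ℂ} {b L D : (Fin d → ℤ) → ℝ} {c : ℝ}

theorem lintegral_damped_le_sup (hm : PenroseKernel m b L D c) {γ : ℝ} (hγ : 0 < γ)
    (n k : Fin d → ℤ) : ∫⁻ s, ‖damped γ m n k s‖ₑ ≤ ENNReal.ofReal (D n / γ) := by
  have hD : 0 ≤ D n := (norm_nonneg _).trans (hm.norm_le n k 0)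
  have hexp : IntegrableOn (fun s => Real.exp (-γ * s)) (Ioi 0) := exp_neg_integrableOn_Ioi 0 hγ
  have h1 : ∫ s in Ioi (0 : ℝ), D n * Real.exp (-γ * s) = D n / γ := by
    rw [integral_const_mul, integral_exp_mul_Ioi (a := -γ) (by linarith) 0]
    simp [div_eq_mul_inv]
  rw [← h1, ofReal_integral_eq_lintegral_ofReal (hexp.const_mul _)
    (.of_forall fun s => mul_nonneg hD (Real.exp_pos _).le), ← setLIntegral_congr Ioi_ae_eq_Ici.symm,
    ← lintegral_indicator measurableSet_Ici]
  refine lintegral_mono fun s => ?_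
  rcases lt_or_ge s 0 with hs | hs
  · simp [damped, hm.supp n k s hs]
  · rw [indicator_of_mem (mem_Ici.mpr hs), ← ofReal_norm]
    refine ENNReal.ofReal_le_ofReal ?_
    unfold damped
    rw [norm_mul, Complex.norm_real, Real.norm_of_nonneg (Real.exp_pos _).le, mul_comm]
    gcongr
    exact hm.norm_le n k s

/-- A solution which is square integrable on bounded time intervals grows at most exponentially: with the
weight `e^{-μ t}` the boundedness of the kernel makes the operator norm of the Volterra operator
`O(1 / μ)`. -/
theorem exists_exp_weight (hm : PenroseKernel m b L D c) {γ : ℝ} (hγ : 0 ≤ γ)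
    {h R : (Fin d → ℤ) → ℝ → ℂ} (H : ModeEq γ m h R) (hR : seqNorm (fun k t => ‖R k t‖ₑ) ≠ ⊤)
    (hloc : ∀ T : ℝ, seqNorm (fun k t => (Iic T).indicator (fun _ => 1) t * ‖h k t‖ₑ) ≠ ⊤) :
    ∃ μ₀ : ℝ, ∀ μ, μ₀ ≤ μ → seqNorm (fun k t => ‖(Real.exp (-μ * t) : ℂ) * h k t‖ₑ) ≠ ⊤ := by
  have hD : ∀ n, 0 ≤ D n := fun n => (norm_nonneg _).trans (hm.norm_le n 0 0)
  -- for these `μ` the norm of the weighted operator is at most `1 / 2`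
  refine ⟨2 * ∑' n, D n + 1, fun μ hμ => ?_⟩
  have hDs : 0 ≤ ∑' n, D n := tsum_nonneg hD
  have hμ0 : 0 < μ := by linarith
  -- the weight is cut off at time `T`, so that the norms of the solution are finite and can be absorbed
  set v : ℝ → ℝ → ℝ≥0∞ := fun T t => (Iic T).indicator (fun t => ENNReal.ofReal (Real.exp (-μ * t))) t with hv
  have mv : ∀ T, Measurable (v T) := fun T => by
    refine Measurable.indicator ?_ measurableSet_Iic
    fun_prop
  have hvt : ∀ T t, v T t ≠ ⊤ := by
    intro T t
    simp only [hv, indicator_apply]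
    split_ifs <;> simp
  have hbound : ∀ T : ℝ, seqNorm (fun k t => v T t * ‖h k t‖ₑ) ≤ 2 * seqNorm (fun k t => ‖R k t‖ₑ) := by
    intro T
    have hfin : seqNorm (fun k t => v T t * ‖h k t‖ₑ) ≠ ⊤ := by
      refine ne_top_of_le_ne_top (hloc T) (seqNorm_mono fun k t => ?_)
      rcases lt_or_ge t 0 with ht | ht
      · simp [H.supp k t ht]
      · gcongr
        simp only [hv, indicator_apply]
        split_ifs
        · refine ENNReal.ofReal_le_one.mpr (Real.exp_le_one_iff.mpr ?_)
          nlinarith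
        · exact le_rfl
    have h1 : seqNorm (fun k t => v T t * ‖h k t‖ₑ)
        ≤ seqNorm (fun k t => posConv (fun n k s => ‖damped (γ + μ) m n k s‖ₑ)
            (fun k t => v T t * ‖h k t‖ₑ) k t + ‖R k t‖ₑ) := by
      refine seqNorm_mono_ae fun k => ?_
      filter_upwards [H.eq k] with t ht
      have h2 : ‖h k t‖ₑ ≤ posConv (fun n k s => ‖damped γ m n k s‖ₑ) (fun k t => ‖h k t‖ₑ) k t
          + ‖R k t‖ₑ := by
        conv_lhs => rw [ht]
        exact (enorm_add_le _ _).trans (by gcongr; exact enorm_volterra_le _ _ _ _ _)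
      calc _ ≤ v T t * posConv (fun n k s => ‖damped γ m n k s‖ₑ) (fun k t => ‖h k t‖ₑ) k t
            + v T t * ‖R k t‖ₑ := by rw [← mul_add]; gcongr
        _ ≤ _ := by
          gcongr
          · refine mul_posConv_le (fun n k t s => ?_) k t (hvt T t)
            rcases lt_or_ge s 0 with hs | hs
            · simp [damped, hm.supp n k s hs]
            · have e : ‖damped (γ + μ) m n k s‖ₑ
                  = ENNReal.ofReal (Real.exp (-μ * s)) * ‖damped γ m n k s‖ₑ := by
                unfold damped
                rw [show -(γ + μ) * s = -μ * s + -γ * s by ring, Real.exp_add, Complex.ofReal_mul,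
                  mul_assoc, enorm_mul]
                congr 1
                rw [← ofReal_norm, Complex.norm_real, Real.norm_of_nonneg (Real.exp_pos _).le]
              -- the cut-off is compatible with the convolution:
              -- `t ≤ T` and `s ≥ 0` give `t - s ≤ T`
              rw [e]
              simp only [hv, indicator_apply, mem_Iic]
              split_ifs with h1 h2
              · rw [mul_right_comm, ← ENNReal.ofReal_mul (Real.exp_pos _).le, ← Real.exp_add]
                rw [show -μ * s + -μ * (t - s) = -μ * t by ring]
              · exact absurd (by linarith) h2
              · simp
              · simp
          · rcases lt_or_ge t 0 with ht | ht
            · simp [H.supp_source k t ht]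
            · refine mul_le_of_le_one_left (by simp) ?_
              simp only [hv, indicator_apply]
              split_ifs
              · refine ENNReal.ofReal_le_one.mpr (Real.exp_le_one_iff.mpr ?_)
                nlinarith
              · simp
    have mw : ∀ n k, Measurable fun s => ‖damped (γ + μ) m n k s‖ₑ := fun n k =>
      (hm.measurable_damped _ n k).enorm
    have mh : ∀ k, Measurable fun t => v T t * ‖h k t‖ₑ := fun k => (mv T).mul (H.meas k).enorm
    have h3 := h1.trans (seqNorm_add_le (measurable_posConv mw mh) fun k => (H.meas_source k).enorm)
    have h4 := seqNorm_posConv_le mw mh (hm.lintegral_damped_le_sup (by linarith : 0 < γ + μ))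
    have h5 : ∑' n, ENNReal.ofReal (D n / (γ + μ)) ≤ ENNReal.ofReal (1 / 2) := by
      rw [← ENNReal.ofReal_tsum_of_nonneg (fun n => div_nonneg (hD n) (by linarith))
        (hm.sup_summable.div_const _), tsum_div_const]
      refine ENNReal.ofReal_le_ofReal ?_
      rw [div_le_iff₀ (by linarith)]
      linarith
    set X := seqNorm (fun k t => v T t * ‖h k t‖ₑ)
    have h6 : X ≤ ENNReal.ofReal (1 / 2) * X + seqNorm (fun k t => ‖R k t‖ₑ) :=
      h3.trans (by gcongr; exact h4.trans (by gcongr))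
    have h7 : X = ENNReal.ofReal (1 / 2) * X + ENNReal.ofReal (1 / 2) * X := by
      rw [← add_mul, ← ENNReal.ofReal_add (by norm_num) (by norm_num)]
      norm_num
    have h8 : ENNReal.ofReal (1 / 2) * X ≤ seqNorm (fun k t => ‖R k t‖ₑ) := by
      have : ENNReal.ofReal (1 / 2) * X + ENNReal.ofReal (1 / 2) * X
          ≤ ENNReal.ofReal (1 / 2) * X + seqNorm (fun k t => ‖R k t‖ₑ) := h7 ▸ h6
      exact (ENNReal.add_le_add_iff_left (ENNReal.mul_ne_top ENNReal.ofReal_ne_top hfin)).mp this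
    calc X = 2 * (ENNReal.ofReal (1 / 2) * X) := by
          rw [two_mul]; exact h7
      _ ≤ _ := by gcongr
  refine ne_top_of_le_ne_top (ENNReal.mul_ne_top (by simp) hR) (seqNorm_le_of_monotone
    (f := fun j k t => v j t * ‖h k t‖ₑ) (fun j k => (mv j).mul (H.meas k).enorm) ?_ ?_ (fun j => hbound j))
  · intro k t i j hij
    dsimp only
    gcongr
    simp only [hv, indicator_apply, mem_Iic]
    have : (i : ℝ) ≤ j := by exact_mod_cast hij
    split_ifs with h1 h2
    · exact le_rfl
    · exact absurd (h1.trans this) h2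
    · simp
    · simp
  · intro k t
    obtain ⟨j, hj⟩ := exists_nat_ge t
    refine le_iSup_of_le j ?_
    simp only [hv, indicator_of_mem (mem_Iic.mpr hj)]
    rw [enorm_mul, ← ofReal_norm (Complex.ofReal _), Complex.norm_real, Real.norm_of_nonneg (Real.exp_pos _).le]

end PenroseKernel

/-! ### Removing the integrability in time -/

/-- A weight equal to `1` up to time `T`, then decaying like `e^{-2 δ t}`. The rate is `2 δ` so that the
product with a function whose multiple by `e^{-δ t}` is square integrable is integrable. -/
def cutWeight (δ T t : ℝ) : ℝ := Real.exp (-(2 * δ * max 0 (t - T)))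

theorem cutWeight_pos (δ T t : ℝ) : 0 < cutWeight δ T t := Real.exp_pos _

theorem cutWeight_le_one {δ : ℝ} (hδ : 0 ≤ δ) (T t : ℝ) : cutWeight δ T t ≤ 1 := by
  unfold cutWeight
  rw [Real.exp_le_one_iff, neg_nonpos]
  positivity

theorem cutWeight_le_exp {δ : ℝ} (hδ : 0 ≤ δ) (T t : ℝ) :
    cutWeight δ T t ≤ Real.exp (2 * δ * T) * Real.exp (-(2 * δ) * t) := by
  unfold cutWeight
  rw [← Real.exp_add]
  gcongr
  have := le_max_right 0 (t - T)
  nlinarith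

theorem cutWeight_mono {δ : ℝ} (hδ : 0 ≤ δ) (t : ℝ) : Monotone fun T => cutWeight δ T t := by
  intro a b hab
  unfold cutWeight
  dsimp only
  gcongr

theorem measurable_cutWeight (δ T : ℝ) : Measurable (cutWeight δ T) := by
  unfold cutWeight
  fun_prop

theorem cutWeight_anti {δ : ℝ} (hδ : 0 ≤ δ) (T t : ℝ) {s : ℝ} (hs : 0 ≤ s) :
    cutWeight δ T t ≤ cutWeight δ T (t - s) := by
  unfold cutWeight
  gcongr
  linarith

/-- The weight is logarithmically Lipschitz, with constant `2 δ`. -/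
theorem abs_cutWeight_sub_le {δ : ℝ} (hδ : 0 ≤ δ) (T t : ℝ) {s : ℝ} (hs : 0 ≤ s) :
    |cutWeight δ T t - cutWeight δ T (t - s)| ≤ 2 * δ * s * cutWeight δ T (t - s) := by
  have h1 : max 0 (t - T) ≤ max 0 (t - s - T) + s := by
    refine max_le ?_ ?_
    · have := le_max_left 0 (t - s - T); linarith
    · have := le_max_right 0 (t - s - T); linarith
  have h2 : cutWeight δ T (t - s) * (1 - 2 * δ * s) ≤ cutWeight δ T t := by
    have h3 := Real.add_one_le_exp (-(2 * δ * s))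
    calc _ ≤ cutWeight δ T (t - s) * Real.exp (-(2 * δ * s)) := by
          gcongr
          · exact (cutWeight_pos _ _ _).le
          · linarith
      _ ≤ _ := by
          unfold cutWeight
          rw [← Real.exp_add]
          gcongr
          nlinarith
  have h4 := cutWeight_anti hδ T t hs
  rw [abs_sub_comm, abs_of_nonneg (by linarith)]
  linarith

theorem mul_exp_neg_le_one {γ s : ℝ} (hγ : 1 ≤ γ) (hs : 0 ≤ s) : s * Real.exp (-γ * s) ≤ 1 := by
  have h1 : s + 1 ≤ Real.exp s := Real.add_one_le_exp s
  have h2 : Real.exp (-γ * s) ≤ Real.exp (-s) := by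
    gcongr
    nlinarith
  calc s * Real.exp (-γ * s) ≤ Real.exp s * Real.exp (-s) := by
        gcongr
        linarith
    _ = 1 := by rw [← Real.exp_add]; simp

/-- If the sum of the `L¹` norms of the terms is finite, a weight may be moved through the Volterra
operator, with an explicit commutator. -/
theorem enorm_weight_mul_volterra_sub_le {γ : ℝ} {m : (Fin d → ℤ) → (Fin d → ℤ) → ℝ → ℂ}
    {h : (Fin d → ℤ) → ℝ → ℂ} (hm : ∀ n k, Measurable (m n k)) (hh : ∀ k, Measurable (h k))
    {v : ℝ → ℝ} (hvm : Measurable v) (hv0 : ∀ t, 0 ≤ v t) (hv1 : ∀ t, v t ≤ 1)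
    (k : Fin d → ℤ) (t : ℝ)
    (hfin : posConv (fun n k s => ‖damped γ m n k s‖ₑ) (fun k t => ‖h k t‖ₑ) k t ≠ ⊤) :
    ‖(v t : ℂ) * volterra γ m h k t - volterra γ m (fun k t => (v t : ℂ) * h k t) k t‖ₑ
      ≤ ∑' n, ∫⁻ s, ‖damped γ m n (k - n) s‖ₑ * ‖((v t - v (t - s) : ℝ) : ℂ)‖ₑ * ‖h (k - n) (t - s)‖ₑ := by
  have hdm : ∀ n k, Measurable (damped γ m n k) := fun n k => by
    have := hm n k
    unfold damped
    fun_prop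
  have mh : ∀ n, Measurable fun s => h (k - n) (t - s) := fun n =>
    (hh _).comp (measurable_const.sub measurable_id)
  have mv : Measurable fun s => v (t - s) := hvm.comp (measurable_const.sub measurable_id)
  unfold posConv at hfin
  have h1 : ∀ n, Integrable fun s => damped γ m n (k - n) s * h (k - n) (t - s) := by
    intro n
    refine ⟨((hdm _ _).mul (mh n)).aestronglyMeasurable, ?_⟩
    have := ENNReal.ne_top_of_tsum_ne_top hfin n
    simp only [HasFiniteIntegral, enorm_mul]
    exact this.lt_top
  have hve : ∀ t, ‖(v t : ℂ)‖ₑ ≤ 1 := fun t => by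
    rw [← ofReal_norm, Complex.norm_real, Real.norm_of_nonneg (hv0 t)]
    exact ENNReal.ofReal_le_one.mpr (hv1 t)
  have hle : ∀ n, ∫⁻ s, ‖damped γ m n (k - n) s * ((v (t - s) : ℂ) * h (k - n) (t - s))‖ₑ
      ≤ ∫⁻ s, ‖damped γ m n (k - n) s‖ₑ * ‖h (k - n) (t - s)‖ₑ := by
    intro n
    refine lintegral_mono fun s => ?_
    rw [enorm_mul, enorm_mul]
    gcongr
    exact mul_le_of_le_one_left (by simp) (hve _)
  have h2 : ∀ n, Integrable fun s => damped γ m n (k - n) s * ((v (t - s) : ℂ) * h (k - n) (t - s)) := by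
    intro n
    refine ⟨((hdm _ _).mul ((Complex.measurable_ofReal.comp mv).mul (mh n))).aestronglyMeasurable, ?_⟩
    exact (hle n).trans_lt (ENNReal.ne_top_of_tsum_ne_top hfin n).lt_top
  have hsum : ∀ f : (Fin d → ℤ) → ℂ, (∀ n, ‖f n‖ₑ ≤ ∫⁻ s, ‖damped γ m n (k - n) s‖ₑ * ‖h (k - n) (t - s)‖ₑ) →
      Summable f := by
    intro f hf
    have : ∑' n, ‖f n‖ₑ ≠ ⊤ := ne_top_of_le_ne_top hfin (ENNReal.tsum_le_tsum hf)
    refine Summable.of_norm ?_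
    simpa using ENNReal.summable_toReal this
  have s1 : Summable fun n => (v t : ℂ) * ∫ s, damped γ m n (k - n) s * h (k - n) (t - s) := by
    refine Summable.mul_left _ (hsum _ fun n => ?_)
    refine (enorm_integral_le_lintegral_enorm _).trans_eq ?_
    simp only [enorm_mul]
  have s2 : Summable fun n => ∫ s, damped γ m n (k - n) s * ((v (t - s) : ℂ) * h (k - n) (t - s)) :=
    hsum _ fun n => (enorm_integral_le_lintegral_enorm _).trans (hle n)
  unfold volterra
  rw [← tsum_mul_left, ← Summable.tsum_sub s1 s2]
  refine enorm_tsum_le_tsum_enorm.trans ?_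
  gcongr with n
  rw [← integral_const_mul, ← integral_sub ((h1 n).const_mul _) (h2 n)]
  refine (enorm_integral_le_lintegral_enorm _).trans_eq ?_
  refine lintegral_congr fun s => ?_
  rw [← enorm_mul, ← enorm_mul]
  congr 1
  push_cast
  ring

/-- The coercivity estimate for solutions, whose integrability in time is not assumed: it is gained
in finitely many steps, each of which improves the exponential rate by `δ`. -/
theorem seqNorm_le_of_modeEq (d : ℕ) {c B : ℝ} (hc : 0 < c) (hB : 0 ≤ B) :
    ∃ Γ : ℝ, 0 < Γ ∧ ∀ (m : (Fin d → ℤ) → (Fin d → ℤ) → ℝ → ℂ) (b L D : (Fin d → ℤ) → ℝ),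
      PenroseKernel m b L D c → (∑' n, (1 + ‖n‖) * b n ≤ B) → ∀ γ : ℝ, 1 ≤ γ →
      (∑' n, L n) * Γ ≤ c * γ → ∀ h R : (Fin d → ℤ) → ℝ → ℂ, ModeEq γ m h R →
      seqNorm (fun k t => ‖R k t‖ₑ) ≠ ⊤ →
      (∀ T : ℝ, seqNorm (fun k t => (Iic T).indicator (fun _ => 1) t * ‖h k t‖ₑ) ≠ ⊤) →
      ENNReal.ofReal (c / 4) * seqNorm (fun k t => ‖h k t‖ₑ) ≤ seqNorm (fun k t => ‖R k t‖ₑ) := by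
  obtain ⟨Γ, hΓ0, hΓ⟩ := seqNorm_le_of_penroseKernel d hc hB
  refine ⟨Γ, hΓ0, ?_⟩
  intro m b L D hm hbB γ₀ hγ₀ hLγ₀ h₀ R₀ H₀ hR₀ hloc
  -- the gain of rate: `2 δ B ≤ c / 4`
  set δ : ℝ := c / (8 * (B + 1)) with hδ
  have hδ0 : 0 < δ := by positivity
  have hδB : 2 * δ * B ≤ c / 4 := by
    rw [hδ, ← sub_nonneg]
    have : c / 4 - 2 * (c / (8 * (B + 1))) * B = c / (4 * (B + 1)) := by
      field_simp
      ring
    rw [this]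
    positivity
  have hbs : ∑' n, b n ≤ B := le_trans (hm.summable_b.tsum_le_tsum (fun n => by
    have := mul_nonneg (norm_nonneg n) (hm.nonneg n); linarith) hm.summable) hbB
  -- one step: the estimate, if `e^{-δ t} h` is square integrable
  have step : ∀ γ : ℝ, 1 ≤ γ → (∑' n, L n) * Γ ≤ c * γ → ∀ h R : (Fin d → ℤ) → ℝ → ℂ,
      ModeEq γ m h R → seqNorm (fun k t => ‖R k t‖ₑ) ≠ ⊤ →
      seqNorm (fun k t => ‖(Real.exp (-δ * t) : ℂ) * h k t‖ₑ) ≠ ⊤ →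
      ENNReal.ofReal (c / 4) * seqNorm (fun k t => ‖h k t‖ₑ) ≤ seqNorm (fun k t => ‖R k t‖ₑ) := by
    intro γ hγ hLγ h R H hR hδh
    have md : ∀ n k, Measurable fun s => ‖damped γ m n k s‖ₑ := fun n k =>
      (hm.measurable_damped _ n k).enorm
    -- almost everywhere absolute convergence of the Volterra operator
    have hae : ∀ k, ∀ᵐ t, posConv (fun n k s => ‖damped γ m n k s‖ₑ) (fun k t => ‖h k t‖ₑ) k t ≠ ⊤ := by
      have mg : ∀ k, Measurable fun t => ENNReal.ofReal (Real.exp (-δ * t)) * ‖h k t‖ₑ := fun k => by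
        have := H.meas k
        fun_prop
      have e1 : seqNorm (fun k t => ENNReal.ofReal (Real.exp (-δ * t)) * ‖h k t‖ₑ) ≠ ⊤ := by
        convert! hδh using 3 with k
        ext t
        rw [enorm_mul, ← ofReal_norm (Complex.ofReal _), Complex.norm_real, Real.norm_of_nonneg (Real.exp_pos _).le]
      have e2 := ne_top_of_le_ne_top (ENNReal.mul_ne_top hm.tsum_ofReal_ne_top e1)
        (seqNorm_posConv_le md mg (hm.lintegral_damped_le (by linarith : 0 ≤ γ)))
      have e3 := ENNReal.pow_ne_top (n := 2) e2
      rw [seqNorm_sq (measurable_posConv md mg)] at e3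
      intro k
      filter_upwards [ae_lt_top ((measurable_posConv md mg k).pow_const 2) (ENNReal.ne_top_of_tsum_ne_top e3 k)] with t ht
      have e4 : posConv (fun n k s => ‖damped γ m n k s‖ₑ) (fun k t => ENNReal.ofReal (Real.exp (-δ * t)) * ‖h k t‖ₑ) k t ≠ ⊤ :=
        (ENNReal.pow_ne_top_iff.mp ht.ne).resolve_right two_ne_zero
      have e5 := ne_top_of_le_ne_top e4 (mul_posConv_le (v := fun t => ENNReal.ofReal (Real.exp (-δ * t)))
        (w := fun n k s => ‖damped γ m n k s‖ₑ) (w' := fun n k s => ‖damped γ m n k s‖ₑ)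
        (g := fun k t => ‖h k t‖ₑ) (fun n k t s => ?_) k t ENNReal.ofReal_ne_top)
      · intro hcon
        rw [hcon, ENNReal.mul_top (ENNReal.ofReal_pos.mpr (Real.exp_pos _)).ne'] at e5
        exact e5 rfl
      · rcases lt_or_ge s 0 with hs | hs
        · simp [damped, hm.supp n k s hs]
        · rw [mul_comm]
          refine mul_le_mul_right (ENNReal.ofReal_le_ofReal (Real.exp_le_exp.mpr ?_)) _
          nlinarith
    -- the estimate for the solution with the weight, uniformly in `T`
    have hT : ∀ T : ℝ, ENNReal.ofReal (c / 4) * seqNorm (fun k t => ‖(cutWeight δ T t : ℂ) * h k t‖ₑ)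
        ≤ seqNorm (fun k t => ‖R k t‖ₑ) := by
      intro T
      set g : (Fin d → ℤ) → ℝ → ℂ := fun k t => (cutWeight δ T t : ℂ) * h k t with hg
      have mgc : ∀ k, Measurable (g k) := fun k => by
        have h1 := H.meas k
        have h2 := measurable_cutWeight δ T
        fun_prop
      have hgle : ∀ k t, ‖g k t‖ₑ ≤ ENNReal.ofReal (Real.exp (2 * δ * T)) *
          (ENNReal.ofReal (Real.exp (-δ * t)) * ‖(Real.exp (-δ * t) : ℂ) * h k t‖ₑ) := by
        intro k t
        rw [hg, enorm_mul, enorm_mul, ← mul_assoc, ← mul_assoc]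
        gcongr
        rw [← ofReal_norm, ← ofReal_norm, Complex.norm_real, Complex.norm_real,
          Real.norm_of_nonneg (cutWeight_pos _ _ _).le, Real.norm_of_nonneg (Real.exp_pos _).le,
          ← ENNReal.ofReal_mul (Real.exp_pos _).le, ← ENNReal.ofReal_mul (by positivity)]
        refine ENNReal.ofReal_le_ofReal ((cutWeight_le_exp hδ0.le T t).trans_eq ?_)
        rw [mul_assoc (Real.exp _), ← Real.exp_add (-δ * t)]
        congr 2
        ring
      have meh : ∀ k, Measurable fun t => ‖(Real.exp (-δ * t) : ℂ) * h k t‖ₑ := fun k => by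
        have := H.meas k
        fun_prop
      set N := seqNorm (fun k t => ‖(Real.exp (-δ * t) : ℂ) * h k t‖ₑ) with hN
      have hgfin : seqNorm (fun k t => ‖g k t‖ₑ) ≠ ⊤ := by
        have : seqNorm (fun k t => ‖g k t‖ₑ) ≤ seqNorm (fun k t => ENNReal.ofReal (Real.exp (2 * δ * T)) * ‖(Real.exp (-δ * t) : ℂ) * h k t‖ₑ) := by
          refine seqNorm_mono fun k t => ?_
          rcases lt_or_ge t 0 with ht | ht
          · simp [hg, H.supp k t ht]
          · refine (hgle k t).trans ?_
            gcongr
            refine mul_le_of_le_one_left (by simp) (ENNReal.ofReal_le_one.mpr (Real.exp_le_one_iff.mpr ?_))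
            nlinarith
        refine ne_top_of_le_ne_top ?_ this
        unfold seqNorm
        rw [l2norm_const_mul _ (measurable_uncurry_seq meh).aemeasurable]
        exact ENNReal.mul_ne_top ENNReal.ofReal_ne_top hδh
      -- the weighted solution is integrable in time, by the Cauchy–Schwarz inequality
      obtain ⟨A, hA, hgA⟩ : ∃ A : ℝ≥0∞, A ≠ ⊤ ∧ ∀ k, ∫⁻ t, ‖g k t‖ₑ ≤ A := by
        have hE : ∫⁻ t in Ici (0:ℝ), ENNReal.ofReal (Real.exp (-δ * t)) ^ 2 ≠ ⊤ := by
          have h1 : IntegrableOn (fun t => Real.exp (-(2 * δ) * t)) (Ici 0) := by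
            rw [integrableOn_Ici_iff_integrableOn_Ioi]
            exact exp_neg_integrableOn_Ioi 0 (by positivity)
          have h2 := h1.2.ne
          convert! h2 using 3 with t
          rw [← ENNReal.ofReal_pow (Real.exp_pos _).le, ← Real.exp_nat_mul, Real.enorm_of_nonneg (Real.exp_pos _).le]
          congr 2
          push_cast
          ring
        refine ⟨ENNReal.ofReal (Real.exp (2 * δ * T)) *
          ((∫⁻ t in Ici (0:ℝ), ENNReal.ofReal (Real.exp (-δ * t)) ^ 2) ^ (1 / 2 : ℝ) * N), ?_, fun k => ?_⟩
        · exact ENNReal.mul_ne_top ENNReal.ofReal_ne_top (ENNReal.mul_ne_top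
            (ENNReal.rpow_ne_top_of_nonneg (by norm_num) hE) hδh)
        · have h1 : ∫⁻ t, ‖g k t‖ₑ = ∫⁻ t in Ici (0:ℝ), ‖g k t‖ₑ := by
            rw [← lintegral_indicator measurableSet_Ici]
            refine lintegral_congr fun t => ?_
            rcases lt_or_ge t 0 with ht | ht
            · simp [hg, H.supp k t ht, ht]
            · rw [indicator_of_mem (mem_Ici.mpr ht)]
          have h2 : (∫⁻ t in Ici (0:ℝ), ‖(Real.exp (-δ * t) : ℂ) * h k t‖ₑ ^ 2) ^ (1 / 2 : ℝ) ≤ N := by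
            rw [← ennreal_sq_le_sq_iff, ennreal_rpow_half_sq, hN, seqNorm_sq meh]
            exact (setLIntegral_le_lintegral _ _).trans
              (ENNReal.le_tsum (f := fun k => ∫⁻ t, ‖(Real.exp (-δ * t) : ℂ) * h k t‖ₑ ^ 2) k)
          rw [h1]
          calc _ ≤ ∫⁻ t in Ici (0:ℝ), ENNReal.ofReal (Real.exp (2 * δ * T)) *
                (ENNReal.ofReal (Real.exp (-δ * t)) * ‖(Real.exp (-δ * t) : ℂ) * h k t‖ₑ) :=
                lintegral_mono fun t => hgle k t
            _ ≤ _ := by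
                rw [lintegral_const_mul' _ _ ENNReal.ofReal_ne_top]
                gcongr
                refine (lintegral_mul_le_sqrt _ (by fun_prop) (meh k).aemeasurable).trans ?_
                gcongr
      have hco := hΓ m b L D hm hbB γ (by linarith) hLγ g A mgc hgfin hA hgA
      -- the commutator of the weight with the operator has norm at most `2 δ B`: since `γ ≥ 1`, the
      -- factor `s` from the logarithmic Lipschitz bound is absorbed by `e^{-γ s}`
      have hS : seqNorm (fun k t => ‖g k t - volterra γ m g k t‖ₑ) ≤ seqNorm (fun k t => ‖R k t‖ₑ)
          + ENNReal.ofReal (c / 4) * seqNorm (fun k t => ‖g k t‖ₑ) := by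
        have mw : ∀ n k, Measurable fun s => ENNReal.ofReal (2 * δ) * ‖m n k s‖ₑ := fun n k =>
          (hm.meas n k).enorm.const_mul _
        have hp1 : seqNorm (fun k t => ‖g k t - volterra γ m g k t‖ₑ) ≤ seqNorm (fun k t => ‖R k t‖ₑ +
            posConv (fun n k s => ENNReal.ofReal (2 * δ) * ‖m n k s‖ₑ) (fun k t => ‖g k t‖ₑ) k t) := by
          refine seqNorm_mono_ae fun k => ?_
          filter_upwards [H.eq k, hae k] with t ht hfin
          have e1 : g k t - volterra γ m g k t = (cutWeight δ T t : ℂ) * R k t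
              + ((cutWeight δ T t : ℂ) * volterra γ m h k t - volterra γ m g k t) := by
            simp only [hg]
            rw [ht]
            ring
          rw [e1]
          refine (enorm_add_le _ _).trans ?_
          gcongr
          · rw [enorm_mul]
            refine mul_le_of_le_one_left (by simp) ?_
            rw [← ofReal_norm, Complex.norm_real, Real.norm_of_nonneg (cutWeight_pos _ _ _).le]
            exact ENNReal.ofReal_le_one.mpr (cutWeight_le_one hδ0.le _ _)
          · refine (enorm_weight_mul_volterra_sub_le hm.meas H.meas (measurable_cutWeight δ T)
              (fun t => (cutWeight_pos _ _ _).le) (cutWeight_le_one hδ0.le T) k t hfin).trans ?_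
            refine ENNReal.tsum_le_tsum fun n => lintegral_mono fun s => ?_
            rcases lt_or_ge s 0 with hs | hs
            · simp [damped, hm.supp _ _ s hs]
            · simp only [hg, enorm_mul]
              rw [← mul_assoc]
              refine mul_le_mul_left ?_ _
              unfold damped
              rw [enorm_mul, mul_right_comm, mul_right_comm _ _ ‖(cutWeight δ T (t - s) : ℂ)‖ₑ]
              refine mul_le_mul_left ?_ _
              simp only [← ofReal_norm, Complex.norm_real]
              rw [← ENNReal.ofReal_mul (norm_nonneg _), ← ENNReal.ofReal_mul (by positivity)]
              refine ENNReal.ofReal_le_ofReal ?_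
              rw [Real.norm_of_nonneg (Real.exp_pos _).le, Real.norm_of_nonneg (cutWeight_pos _ _ _).le, Real.norm_eq_abs]
              calc _ ≤ Real.exp (-γ * s) * (2 * δ * s * cutWeight δ T (t - s)) := by
                    gcongr
                    exact abs_cutWeight_sub_le hδ0.le T t hs
                _ = 2 * δ * (s * Real.exp (-γ * s)) * cutWeight δ T (t - s) := by ring
                _ ≤ 2 * δ * 1 * cutWeight δ T (t - s) := by
                    gcongr
                    · exact (cutWeight_pos _ _ _).le
                    · exact mul_exp_neg_le_one hγ hs
                _ = _ := by ring
        refine hp1.trans ((seqNorm_add_le (fun k => (H.meas_source k).enorm)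
          (measurable_posConv mw fun k => (mgc k).enorm)).trans ?_)
        gcongr
        refine (seqNorm_posConv_le (β := fun n => ENNReal.ofReal (2 * δ * b n)) mw (fun k => (mgc k).enorm) fun n k => ?_).trans ?_
        · rw [lintegral_const_mul _ (hm.meas n k).enorm, ENNReal.ofReal_mul (by positivity : 0 ≤ 2 * δ)]
          exact mul_le_mul_right (hm.lintegral_le n k) _
        · gcongr
          rw [← ENNReal.ofReal_tsum_of_nonneg (fun n => by have := hm.nonneg n; positivity)
            (hm.summable_b.mul_left _), tsum_mul_left]
          refine ENNReal.ofReal_le_ofReal (le_trans ?_ hδB)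
          gcongr
      have hfin2 := hco.trans hS
      have e : ENNReal.ofReal (c / 2) * seqNorm (fun k t => ‖g k t‖ₑ)
          = ENNReal.ofReal (c / 4) * seqNorm (fun k t => ‖g k t‖ₑ)
            + ENNReal.ofReal (c / 4) * seqNorm (fun k t => ‖g k t‖ₑ) := by
        rw [← add_mul, ← ENNReal.ofReal_add (by positivity) (by positivity)]
        congr 2
        ring
      rw [e] at hfin2
      exact (ENNReal.add_le_add_iff_right (ENNReal.mul_ne_top ENNReal.ofReal_ne_top hgfin)).mp hfin2
    -- the limit `T → ∞`, by monotone convergence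
    have hc4 : ENNReal.ofReal (c / 4) ≠ 0 := (ENNReal.ofReal_pos.mpr (by positivity)).ne'
    rw [mul_comm, ← ENNReal.le_div_iff_mul_le (.inl hc4) (.inl ENNReal.ofReal_ne_top)]
    refine seqNorm_le_of_monotone (f := fun j k t => ‖(cutWeight δ j t : ℂ) * h k t‖ₑ) ?_ ?_ ?_ ?_
    · intro j k
      have h1 := H.meas k
      have h2 := measurable_cutWeight δ j
      fun_prop
    · intro k t i j hij
      simp only [enorm_mul]
      gcongr
      simp only [← ofReal_norm, Complex.norm_real, Real.norm_of_nonneg (cutWeight_pos _ _ _).le]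
      exact ENNReal.ofReal_le_ofReal (cutWeight_mono hδ0.le t (by exact_mod_cast hij))
    · intro k t
      obtain ⟨j, hj⟩ := exists_nat_ge t
      refine le_iSup_of_le j ?_
      simp [cutWeight, hj]
    · intro j
      rw [ENNReal.le_div_iff_mul_le (.inl hc4) (.inl ENNReal.ofReal_ne_top), mul_comm]
      exact hT j
  -- descend from a large exponential rate
  obtain ⟨μ₀, hμ₀⟩ := hm.exists_exp_weight (by linarith) H₀ hR₀ hloc
  have hRle : ∀ μ : ℝ, 0 ≤ μ → seqNorm (fun k t => ‖(Real.exp (-μ * t) : ℂ) * R₀ k t‖ₑ) ≠ ⊤ := by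
    intro μ hμ
    refine ne_top_of_le_ne_top hR₀ (seqNorm_mono fun k t => ?_)
    rcases lt_or_ge t 0 with ht | ht
    · simp [H₀.supp_source k t ht]
    · rw [enorm_mul]
      refine mul_le_of_le_one_left (by simp) ?_
      rw [← ofReal_norm, Complex.norm_real, Real.norm_of_nonneg (Real.exp_pos _).le]
      refine ENNReal.ofReal_le_one.mpr (Real.exp_le_one_iff.mpr ?_)
      nlinarith
  have hLΓ : 0 ≤ (∑' n, L n) * Γ := mul_nonneg (tsum_nonneg hm.lip_nonneg) hΓ0.le
  have hstep : ∀ j : ℕ, seqNorm (fun k t => ‖(Real.exp (-((j + 1 : ℕ) * δ) * t) : ℂ) * h₀ k t‖ₑ) ≠ ⊤ →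
      ENNReal.ofReal (c / 4) * seqNorm (fun k t => ‖(Real.exp (-(j * δ) * t) : ℂ) * h₀ k t‖ₑ)
        ≤ seqNorm (fun k t => ‖(Real.exp (-(j * δ) * t) : ℂ) * R₀ k t‖ₑ) := by
    intro j hj
    have hjδ : 0 ≤ j * δ := by positivity
    refine step (γ₀ + j * δ) (by linarith) (by nlinarith) _ _ (H₀.shift (j * δ)) (hRle _ hjδ) ?_
    convert! hj using 5 with k t
    rw [← mul_assoc, ← Complex.ofReal_mul, ← Real.exp_add]
    congr 3
    push_cast
    ring
  have hdesc : ∀ j : ℕ, seqNorm (fun k t => ‖(Real.exp (-(j * δ) * t) : ℂ) * h₀ k t‖ₑ) ≠ ⊤ →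
      seqNorm (fun k t => ‖(Real.exp (-((0 : ℕ) * δ) * t) : ℂ) * h₀ k t‖ₑ) ≠ ⊤ := by
    intro j
    induction j with
    | zero => exact id
    | succ j ih =>
      intro hj
      refine ih ?_
      have h1 := ne_top_of_le_ne_top (hRle _ (by positivity : 0 ≤ j * δ)) (hstep j hj)
      intro hcon
      rw [hcon, ENNReal.mul_top (ENNReal.ofReal_pos.mpr (by positivity)).ne'] at h1
      exact h1 rfl
  obtain ⟨J, hJ⟩ := exists_nat_ge (μ₀ / δ)
  have h0 := hdesc J (hμ₀ _ (by rwa [div_le_iff₀ hδ0] at hJ))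
  simp only [Nat.cast_zero, zero_mul, neg_zero, Real.exp_zero, Complex.ofReal_one, one_mul] at h0
  refine step γ₀ hγ₀ hLγ₀ h₀ R₀ H₀ hR₀ (ne_top_of_le_ne_top h0 (seqNorm_mono fun k t => ?_))
  rcases lt_or_ge t 0 with ht | ht
  · simp [H₀.supp k t ht]
  · rw [enorm_mul]
    refine mul_le_of_le_one_left (by simp) ?_
    rw [← ofReal_norm, Complex.norm_real, Real.norm_of_nonneg (Real.exp_pos _).le]
    refine ENNReal.ofReal_le_one.mpr (Real.exp_le_one_iff.mpr ?_)
    nlinarith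

/-! ### Calculus on the torus -/

theorem toTorus_add (y z : Vel d) : toTorus (y + z) = toTorus y + toTorus z := by
  ext i
  simp [toTorus]

theorem toTorus_single (i : Fin d) (s : ℝ) :
    toTorus (EuclideanSpace.single i s) = Pi.single i (s : AddCircle (2 * π)) := by
  ext j
  by_cases hj : j = i
  · subst hj; simp [toTorus]
  · simp [toTorus, hj]

theorem isOpenQuotientMap_toTorus : IsOpenQuotientMap (toTorus (d := d)) := by
  have h1 : IsOpenQuotientMap (Pi.map (fun (_ : Fin d) (x : ℝ) => (x : AddCircle (2 * π)))) :=
    IsOpenQuotientMap.piMap fun _ => QuotientAddGroup.isOpenQuotientMap_mk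
  exact h1.comp (PiLp.homeomorph 2 (fun _ : Fin d => ℝ)).isOpenQuotientMap

theorem toTorus_surjective : Function.Surjective (toTorus (d := d)) :=
  isOpenQuotientMap_toTorus.surjective

@[fun_prop]
theorem continuous_toTorus : Continuous (toTorus (d := d)) := isOpenQuotientMap_toTorus.continuous

theorem torusSmooth_tchar (k : Fin d → ℤ) : TorusSmooth (tchar k) := by
  have : (fun y : Vel d => tchar k (toTorus y))
      = fun y => Complex.exp (Complex.I * ((inner ℝ (intVec k) y : ℝ) : ℂ)) :=
    funext fun y => tchar_toTorus k y
  unfold TorusSmooth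
  rw [this]
  have h : ContDiff ℝ ∞ fun y : Vel d => ((inner ℝ (intVec k) y : ℝ) : ℂ) :=
    Complex.ofRealCLM.contDiff.comp (contDiff_const.inner ℝ contDiff_id)
  exact (contDiff_const.mul h).cexp

theorem torusPd_tchar (i : Fin d) (k : Fin d → ℤ) :
    torusPd i (tchar k) = fun x => Complex.I * (k i : ℂ) * tchar k x := by
  ext x
  unfold torusPd
  simp only [tchar_add_right, tchar_single]
  have h1 : HasDerivAt (fun s : ℝ => Complex.I * (k i : ℂ) * (s : ℂ)) (Complex.I * (k i : ℂ)) 0 := by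
    simpa using (Complex.ofRealCLM.hasDerivAt (x := (0 : ℝ))).const_mul (Complex.I * (k i : ℂ))
  have := (h1.cexp.const_mul (tchar k x)).deriv
  rw [this]
  simp
  ring

namespace TorusSmooth
variable {φ ψ : Torus d → ℂ}

theorem continuous (h : TorusSmooth φ) : Continuous φ :=
  isOpenQuotientMap_toTorus.isQuotientMap.continuous_iff.mpr (ContDiff.continuous h)

theorem mul (h : TorusSmooth φ) (h' : TorusSmooth ψ) : TorusSmooth (fun x => φ x * ψ x) :=
  ContDiff.mul h h'

theorem torusPd_toTorus (h : TorusSmooth φ) (i : Fin d) (y : Vel d) :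
    torusPd i φ (toTorus y)
      = fderiv ℝ (fun y : Vel d => φ (toTorus y)) y (EuclideanSpace.single i 1) := by
  unfold VlasovPenrose.torusPd
  simp only [← toTorus_single, ← toTorus_add]
  have h0 : HasDerivAt (fun s : ℝ => y + EuclideanSpace.single i s) (EuclideanSpace.single i 1) 0 := by
    have : (fun s : ℝ => y + EuclideanSpace.single i s) = fun s => y + s • EuclideanSpace.single i (1 : ℝ) := by
      ext s j
      simp
    rw [this]
    simpa using ((hasDerivAt_id (0 : ℝ)).smul_const (EuclideanSpace.single i (1 : ℝ))).const_add y
  have h1 : HasFDerivAt (fun y : Vel d => φ (toTorus y))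
      (fderiv ℝ (fun y : Vel d => φ (toTorus y)) y) (y + EuclideanSpace.single i (0 : ℝ)) := by
    have e : y + EuclideanSpace.single i (0 : ℝ) = y := by
      ext j
      simp
    rw [e]
    exact (ContDiff.differentiable h (by simp) y).hasFDerivAt
  exact (h1.comp_hasDerivAt 0 h0).deriv

protected theorem torusPd (h : TorusSmooth φ) (i : Fin d) : TorusSmooth (torusPd i φ) := by
  unfold TorusSmooth
  simp only [h.torusPd_toTorus]
  exact (ContDiff.fderiv_right h (m := ∞) (by simp)).clm_apply contDiff_const

theorem hasDerivAt (h : TorusSmooth φ) (i : Fin d) (x : Torus d) (s : ℝ) :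
    HasDerivAt (fun s : ℝ => φ (x + Pi.single i (s : AddCircle (2 * π))))
      (torusPd i φ (x + Pi.single i (s : AddCircle (2 * π)))) s := by
  obtain ⟨y, rfl⟩ := toTorus_surjective x
  simp only [← toTorus_single, ← toTorus_add]
  rw [h.torusPd_toTorus]
  have h0 : HasDerivAt (fun s : ℝ => y + EuclideanSpace.single i s) (EuclideanSpace.single i 1) s := by
    have : (fun s : ℝ => y + EuclideanSpace.single i s) = fun s => y + s • EuclideanSpace.single i (1 : ℝ) := by
      ext s j
      simp
    rw [this]
    simpa using ((hasDerivAt_id s).smul_const (EuclideanSpace.single i (1 : ℝ))).const_add y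
  exact (ContDiff.differentiable h (by simp) _).hasFDerivAt.comp_hasDerivAt s h0

theorem integrable (h : TorusSmooth φ) : Integrable φ :=
  h.continuous.integrable_of_hasCompactSupport (HasCompactSupport.of_compactSpace φ)

theorem memLp (h : TorusSmooth φ) : MemLp φ 2 :=
  h.continuous.memLp_of_hasCompactSupport (HasCompactSupport.of_compactSpace φ)

/-- Derivatives on the torus have mean zero, by translation invariance of the measure. -/
theorem integral_torusPd (h : TorusSmooth φ) (i : Fin d) : ∫ x, torusPd i φ x = 0 := by
  have hc := (h.torusPd i).continuous
  have cts : Continuous fun p : Torus d × ℝ => p.1 + Pi.single i (p.2 : AddCircle (2 * π)) := by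
    have : Continuous fun s : ℝ => toTorus (EuclideanSpace.single i s : Vel d) := by
      refine continuous_toTorus.comp ?_
      have : (EuclideanSpace.single i : ℝ → Vel d) = fun s => s • EuclideanSpace.single i (1 : ℝ) := by
        ext s j
        simp
      rw [this]
      fun_prop
    simp only [toTorus_single] at this
    exact continuous_fst.add (this.comp continuous_snd)
  obtain ⟨C, hC⟩ := IsCompact.exists_bound_of_continuousOn isCompact_univ hc.continuousOn
  have h1 : ∀ x, ∫ s in (0 : ℝ)..1, torusPd i φ (x + Pi.single i (s : AddCircle (2 * π)))
      = φ (x + Pi.single i ((1 : ℝ) : AddCircle (2 * π))) - φ x := by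
    intro x
    have e : Continuous fun s : ℝ => torusPd i φ (x + Pi.single i (s : AddCircle (2 * π))) :=
      hc.comp (cts.comp (Continuous.prodMk_right x))
    rw [intervalIntegral.integral_eq_sub_of_hasDerivAt (fun s _ => h.hasDerivAt i x s)
      (e.intervalIntegrable 0 1)]
    simp
  have h2 : ∫ x : Torus d, ∫ s in (0 : ℝ)..1, torusPd i φ (x + Pi.single i (s : AddCircle (2 * π))) = 0 := by
    simp only [h1]
    rw [integral_sub (h.integrable.comp_add_right _) h.integrable,
      integral_add_right_eq_self (μ := volume) φ, sub_self]
  simp only [intervalIntegral.integral_of_le zero_le_one] at h2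
  rw [integral_integral_swap] at h2
  · simpa [integral_add_right_eq_self (μ := (volume : Measure (Torus d))) (torusPd i φ)] using h2
  · refine Integrable.of_bound (hc.comp cts).aestronglyMeasurable C (.of_forall fun p => hC _ (mem_univ _))

theorem integral_torusPd_mul (h : TorusSmooth φ) (h' : TorusSmooth ψ) (i : Fin d) :
    ∫ x, torusPd i φ x * ψ x = -∫ x, φ x * torusPd i ψ x := by
  have h1 := (h.mul h').integral_torusPd i
  have h2 : torusPd i (fun x => φ x * ψ x) = fun x => torusPd i φ x * ψ x + φ x * torusPd i ψ x := by
    ext x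
    have := ((h.hasDerivAt i x 0).fun_mul (h'.hasDerivAt i x 0)).deriv
    simpa [VlasovPenrose.torusPd] using this
  rw [h2, integral_add ((h.torusPd i).mul h').integrable (h.mul (h'.torusPd i)).integrable] at h1
  exact eq_neg_of_add_eq_zero_left h1

theorem coef_torusPd (h : TorusSmooth φ) (i : Fin d) (k : Fin d → ℤ) :
    coef k (torusPd i φ) = Complex.I * (k i : ℂ) * coef k φ := by
  unfold coef
  have h1 := h.integral_torusPd_mul (torusSmooth_tchar (-k)) i
  simp only [torusPd_tchar] at h1
  simp only [mul_comm (tchar (-k) _)]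
  rw [h1, mul_left_comm, ← integral_const_mul, ← integral_neg]
  congr 2
  ext x
  push_cast [Pi.neg_apply]
  ring

theorem coef_sub_laplacian (h : TorusSmooth φ) (c : ℂ) (k : Fin d → ℤ) :
    coef k (fun x => φ x - c * torusLaplacian φ x) = (1 + c * ((‖intVec k‖ ^ 2 : ℝ) : ℂ)) * coef k φ := by
  have e : (fun x => φ x - c * torusLaplacian φ x)
      = fun x => φ x + (-c) * torusLaplacian φ x := by
    ext x; ring
  have hi : Integrable (torusLaplacian φ) := integrable_finsetSum _ fun i _ => ((h.torusPd i).torusPd i).integrable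
  have hl : coef k (torusLaplacian φ) = -((‖intVec k‖ ^ 2 : ℝ) : ℂ) * coef k φ := by
    have : coef k (torusLaplacian φ) = ∑ i, coef k (torusPd i (torusPd i φ)) :=
      coef_finset_sum _ (fun i _ => ((h.torusPd i).torusPd i).integrable) k
    rw [this]
    simp only [(h.torusPd _).coef_torusPd, h.coef_torusPd]
    rw [EuclideanSpace.norm_sq_eq]
    push_cast
    rw [← Finset.sum_neg_distrib, Finset.sum_mul]
    refine Finset.sum_congr rfl fun i _ => ?_
    simp only [intVec_apply, Real.norm_eq_abs, ← Complex.ofReal_pow, sq_abs]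
    push_cast
    linear_combination ((k i : ℂ) ^ 2 * coef k φ) * Complex.I_sq
  rw [e, coef_add h.integrable (hi.const_mul _), coef_const_mul, hl]
  ring

end TorusSmooth

theorem torusLaplacian_tchar (k : Fin d → ℤ) :
    torusLaplacian (tchar k) = fun x => -((‖intVec k‖ ^ 2 : ℝ) : ℂ) * tchar k x := by
  ext x
  have : ∀ i, torusPd i (torusPd i (tchar k)) x = -((k i : ℂ) ^ 2) * tchar k x := by
    intro i
    rw [torusPd_tchar]
    have : torusPd i (fun x => Complex.I * (k i : ℂ) * tchar k x) x
        = Complex.I * (k i : ℂ) * torusPd i (tchar k) x := by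
      unfold torusPd
      exact deriv_const_mul_field _
    rw [this, torusPd_tchar]
    linear_combination ((k i : ℂ) ^ 2 * tchar k x) * Complex.I_sq
  unfold torusLaplacian
  simp only [this]
  rw [EuclideanSpace.norm_sq_eq]
  push_cast
  rw [← Finset.sum_mul, Finset.sum_neg_distrib]
  simp only [intVec_apply, Real.norm_eq_abs, ← Complex.ofReal_pow, sq_abs]
  push_cast
  rfl

/-! ### Functions with prescribed Fourier modes -/

theorem ae_memLp_two_of_memLp_prod {α : Type*} [MeasurableSpace α] {μ : Measure α} [SFinite μ]
    {U : α × Torus d → ℂ} (hU : MemLp U 2 (μ.prod volume)) :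
    ∀ᵐ t ∂μ, MemLp (fun x => U (t, x)) 2 := by
  have h1 := hU.1.prodMk_left
  have h2 : ∫⁻ z, ‖U z‖ₑ ^ 2 ∂(μ.prod volume) ≠ ⊤ := by
    have := (eLpNorm_lt_top_iff_lintegral_rpow_enorm_lt_top (by simp) (by simp)).mp hU.2
    simpa using this.ne
  rw [lintegral_prod _ (hU.1.enorm.pow_const 2)] at h2
  filter_upwards [h1, ae_lt_top' (hU.1.enorm.pow_const 2).lintegral_prod_right' h2] with t ht1 ht2
  refine ⟨ht1, (eLpNorm_lt_top_iff_lintegral_rpow_enorm_lt_top (by simp) (by simp)).mpr ?_⟩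
  simpa using ht2

theorem aestronglyMeasurable_coef {α : Type*} [MeasurableSpace α] {μ : Measure α} [SFinite μ]
    {U : α × Torus d → ℂ} (hU : AEStronglyMeasurable U (μ.prod volume)) (k : Fin d → ℤ) :
    AEStronglyMeasurable (fun t => coef k fun x => U (t, x)) μ := by
  unfold coef
  refine AEStronglyMeasurable.const_mul ?_ _
  refine AEStronglyMeasurable.integral_prod_right' (f := fun z : α × Torus d => tchar (-k) z.2 * U z) ?_
  exact ((tchar (-k)).continuous.measurable.comp measurable_snd).aestronglyMeasurable.mul hU

theorem measurable_coef {α : Type*} [MeasurableSpace α]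
    {U : α × Torus d → ℂ} (hU : StronglyMeasurable U) (k : Fin d → ℤ) :
    Measurable (fun t => coef k fun x => U (t, x)) := by
  unfold coef
  refine Measurable.const_mul ?_ _
  refine (StronglyMeasurable.integral_prod_right' (f := fun z : α × Torus d => tchar (-k) z.2 * U z) ?_).measurable
  exact ((tchar (-k)).continuous.measurable.comp measurable_snd).stronglyMeasurable.mul hU

theorem enorm_coef_sq_le {f : Torus d → ℂ} (hf : MemLp f 2) (k : Fin d → ℤ) :
    ENNReal.ofReal ((2 * π) ^ d) * ‖coef k f‖ₑ ^ 2 ≤ ∫⁻ x, ‖f x‖ₑ ^ 2 := by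
  rw [lintegral_enorm_sq_eq_tsum_coef hf]
  gcongr
  exact ENNReal.le_tsum (f := fun k => ‖coef k f‖ₑ ^ 2) k

theorem coef_finset_sum_mul_tchar (F : Finset (Fin d → ℤ)) (z : (Fin d → ℤ) → ℂ) (k : Fin d → ℤ) :
    coef k (fun x => ∑ l ∈ F, z l * tchar l x) = if k ∈ F then z k else 0 := by
  rw [coef_finset_sum _ fun l _ => (torusSmooth_tchar l).integrable.const_mul _]
  simp only [coef_const_mul, coef_tchar, mul_ite, mul_one, mul_zero, Finset.sum_ite_eq']

theorem memLp_mul_tchar {a : ℝ → ℂ} (ha : Measurable a) (hs : ∫⁻ t, ‖a t‖ₑ ^ 2 ≠ ⊤) (k : Fin d → ℤ) :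
    MemLp (fun z : ℝ × Torus d => a z.1 * tchar k z.2) 2 := by
  have hm : Measurable (fun z : ℝ × Torus d => a z.1 * tchar k z.2) :=
    (ha.comp measurable_fst).mul ((tchar k).continuous.measurable.comp measurable_snd)
  refine ⟨hm.aestronglyMeasurable, (eLpNorm_lt_top_iff_lintegral_rpow_enorm_lt_top (by simp) (by simp)).mpr ?_⟩
  have : ∫⁻ z : ℝ × Torus d, ‖a z.1 * tchar k z.2‖ₑ ^ 2 < ⊤ := by
    rw [Measure.volume_eq_prod, lintegral_prod _ (hm.enorm.pow_const 2).aemeasurable]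
    simp only [enorm_mul, enorm_tchar, mul_one, lintegral_const]
    rw [lintegral_mul_const _ (ha.enorm.pow_const 2)]
    exact ENNReal.mul_lt_top hs.lt_top (measure_lt_top _ _)
  simpa using this

/-- Square summable Fourier modes, depending measurably on `t`, are those of a jointly measurable
square integrable function. -/
theorem exists_memLp_of_coef {a : (Fin d → ℤ) → ℝ → ℂ} (ha : ∀ k, Measurable (a k))
    (hs : ∑' k, ∫⁻ t, ‖a k t‖ₑ ^ 2 ≠ ⊤) :
    ∃ U : ℝ × Torus d → ℂ, MemLp U 2 ∧ ∀ᵐ t, ∀ k, coef k (fun x => U (t, x)) = a k t := by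
  have hs1 : ∀ k, ∫⁻ t, ‖a k t‖ₑ ^ 2 ≠ ⊤ := fun k => ENNReal.ne_top_of_tsum_ne_top hs k
  have hA := fun k => memLp_mul_tchar (ha k) (hs1 k) k
  set A : (Fin d → ℤ) → Lp ℂ 2 (volume : Measure (ℝ × Torus d)) := fun k => (hA k).toLp _ with hAdef
  have hnorm : ∀ k, ‖A k‖ₑ ^ 2 = volume (univ : Set (Torus d)) * ∫⁻ t, ‖a k t‖ₑ ^ 2 := by
    intro k
    have e : ‖A k‖ₑ = eLpNorm (fun z : ℝ × Torus d => a k z.1 * tchar k z.2) 2 volume := by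
      rw [hAdef, Lp.enorm_def]
      exact eLpNorm_congr_ae (hA k).coeFn_toLp
    rw [e, eLpNorm_eq_lintegral_rpow_enorm_toReal (by simp) (by simp)]
    simp only [ENNReal.toReal_ofNat, ENNReal.rpow_ofNat]
    have hm : Measurable fun z : ℝ × Torus d => a k z.1 * tchar k z.2 :=
      ((ha k).comp measurable_fst).mul ((tchar k).continuous.measurable.comp measurable_snd)
    rw [ennreal_rpow_half_sq, Measure.volume_eq_prod, lintegral_prod _ (hm.enorm.pow_const 2).aemeasurable]
    simp only [enorm_mul, enorm_tchar, mul_one, lintegral_const]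
    rw [lintegral_mul_const _ ((ha k).enorm.pow_const 2), mul_comm]
  -- the functions `a k(t) e_k(x)` are orthogonal in `L²`, so their sum converges
  have horth : ∀ k l, k ≠ l → inner ℂ (A k) (A l) = 0 := by
    intro k l hkl
    rw [L2.inner_def]
    have e : (fun z => inner ℂ (A k z) (A l z)) =ᵐ[volume]
        fun z : ℝ × Torus d => (a l z.1 * starRingEnd ℂ (a k z.1)) * (tchar (-k) z.2 * tchar l z.2) := by
      filter_upwards [(hA k).coeFn_toLp, (hA l).coeFn_toLp] with z h1 h2
      rw [hAdef, h1, h2, RCLike.inner_apply, map_mul, tchar_neg]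
      ring
    rw [integral_congr_ae e, Measure.volume_eq_prod,
      integral_prod_mul (fun t => a l t * starRingEnd ℂ (a k t)) (fun x => tchar (-k) x * tchar l x)]
    have h0 := coef_tchar k l
    rw [if_neg (Ne.symm hkl)] at h0
    unfold coef at h0
    rw [(mul_eq_zero.mp h0).resolve_left (inv_ne_zero two_pi_pow_ne_zero), mul_zero]
  have hfam : OrthogonalFamily ℂ (fun k => (ℂ ∙ A k : Submodule ℂ (Lp ℂ 2 (volume : Measure (ℝ × Torus d)))))
      (fun k => (ℂ ∙ A k).subtypeₗᵢ) := by
    refine OrthogonalFamily.of_pairwise fun k l hkl => ?_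
    rw [Function.onFun, Submodule.isOrtho_span]
    rintro _ rfl _ rfl
    exact horth k l hkl
  have hsum : Summable A := by
    have := (hfam.summable_iff_norm_sq_summable fun k => ⟨A k, Submodule.mem_span_singleton_self _⟩).mpr ?_
    · simpa using this
    · have h1 : ∑' k, ‖A k‖ₑ ^ 2 ≠ ⊤ := by
        simp only [hnorm, ENNReal.tsum_mul_left]
        exact ENNReal.mul_ne_top (measure_ne_top _ _) hs
      simpa using ENNReal.summable_toReal h1
  set U := ∑' k, A k with hU
  refine ⟨U, Lp.memLp U, ae_all_iff.mpr fun k => ?_⟩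
  have hUm : AEStronglyMeasurable (U : ℝ × Torus d → ℂ) (volume.prod volume) := (Lp.memLp U).1
  have hm : AEMeasurable (fun t => ‖coef k (fun x => U (t, x)) - a k t‖ₑ ^ 2) := by
    exact (((aestronglyMeasurable_coef hUm k).aemeasurable.sub (ha k).aemeasurable).enorm).pow_const 2
  -- compare with the partial sums, whose modes are known
  have key : ∀ F : Finset (Fin d → ℤ), k ∈ F →
      ENNReal.ofReal ((2 * π) ^ d) * ∫⁻ t, ‖coef k (fun x => U (t, x)) - a k t‖ₑ ^ 2
        ≤ ‖U - ∑ l ∈ F, A l‖ₑ ^ 2 := by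
    intro F hk
    set V := U - ∑ l ∈ F, A l with hV
    have hVe : (V : ℝ × Torus d → ℂ) =ᵐ[volume.prod volume]
        fun z => U z - ∑ l ∈ F, a l z.1 * tchar l z.2 := by
      have h1 : ∀ l ∈ F, (A l : ℝ × Torus d → ℂ) =ᵐ[volume] fun z => a l z.1 * tchar l z.2 :=
        fun l _ => (hA l).coeFn_toLp
      have h2 : ((∑ l ∈ F, A l : Lp ℂ 2 (volume : Measure (ℝ × Torus d))) : ℝ × Torus d → ℂ)
          =ᵐ[volume] fun z => ∑ l ∈ F, a l z.1 * tchar l z.2 := by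
        refine (Lp.coeFn_fun_finsetSum _ _).trans ?_
        filter_upwards [(Finset.eventually_all F).mpr h1] with z hz
        exact Finset.sum_congr rfl hz
      filter_upwards [Lp.coeFn_sub U (∑ l ∈ F, A l), h2] with z h3 h4
      rw [h3, Pi.sub_apply, h4]
    have e1 : ‖V‖ₑ ^ 2 = ∫⁻ t, ∫⁻ x, ‖V (t, x)‖ₑ ^ 2 := by
      rw [Lp.enorm_def, eLpNorm_eq_lintegral_rpow_enorm_toReal (by simp) (by simp)]
      simp only [ENNReal.toReal_ofNat, ENNReal.rpow_ofNat]
      rw [ennreal_rpow_half_sq]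
      exact lintegral_prod _ ((Lp.memLp V).1.enorm.pow_const 2)
    rw [e1, ← lintegral_const_mul' _ _ ENNReal.ofReal_ne_top]
    refine lintegral_mono_ae ?_
    filter_upwards [ae_memLp_two_of_memLp_prod (μ := volume) (Lp.memLp V), Measure.ae_ae_of_ae_prod hVe,
      ae_memLp_two_of_memLp_prod (μ := volume) (Lp.memLp U)] with t h1 h2 h3
    refine le_trans (le_of_eq ?_) (enorm_coef_sq_le h1 k)
    have h4 : coef k (fun x => V (t, x)) = coef k (fun x => U (t, x)) - a k t := by
      rw [coef_congr_ae h2]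
      have h5 : Integrable fun x => ∑ l ∈ F, a l t * tchar l x :=
        integrable_finsetSum _ fun l _ => (torusSmooth_tchar l).integrable.const_mul _
      simp only [sub_eq_add_neg, ← neg_one_mul (∑ l ∈ F, _)]
      rw [coef_add (h3.integrable (by norm_num)) (h5.const_mul _), coef_const_mul,
        coef_finset_sum_mul_tchar, if_pos hk, neg_one_mul]
    rw [h4]
  have h0 : ENNReal.ofReal ((2 * π) ^ d) * ∫⁻ t, ‖coef k (fun x => U (t, x)) - a k t‖ₑ ^ 2 ≤ 0 := by
    have ht : Filter.Tendsto (fun F : Finset (Fin d → ℤ) => ‖U - ∑ l ∈ F, A l‖ₑ ^ 2) Filter.atTop (nhds 0) := by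
      have h1 : Filter.Tendsto (fun F : Finset (Fin d → ℤ) => U - ∑ l ∈ F, A l) Filter.atTop (nhds (U - U)) :=
        hsum.hasSum.const_sub U
      have h2 := (ENNReal.continuous_pow 2).continuousAt.tendsto.comp (continuous_enorm.continuousAt.tendsto.comp h1)
      simpa [Function.comp_def] using h2
    refine ge_of_tendsto ht ?_
    filter_upwards [Filter.eventually_ge_atTop {k}] with F hF
    exact key F (hF (Finset.mem_singleton_self k))
  have h1 : ∫⁻ t, ‖coef k (fun x => U (t, x)) - a k t‖ₑ ^ 2 = 0 := by
    refine (mul_eq_zero.mp (le_antisymm h0 bot_le)).resolve_left ?_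
    exact (ENNReal.ofReal_pos.mpr (by positivity)).ne'
  rw [lintegral_eq_zero_iff' hm] at h1
  filter_upwards [h1] with t ht
  simpa [sub_eq_zero] using ht

/-- Fourier modes which depend measurably on `t` and are square summable for almost every `t` are
those of a jointly measurable function. -/
theorem exists_of_coef_ae {c : (Fin d → ℤ) → ℝ → ℂ} (hc : ∀ k, Measurable (c k))
    (hs : ∀ᵐ t, ∑' k, ‖c k t‖ₑ ^ 2 ≠ ⊤) :
    ∃ U : ℝ × Torus d → ℂ, AEStronglyMeasurable U ∧
      ∀ᵐ t, MemLp (fun x => U (t, x)) 2 ∧ ∀ k, coef k (fun x => U (t, x)) = c k t := by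
  set S : ℝ → ℝ≥0∞ := fun t => ∑' k, ‖c k t‖ₑ ^ 2 with hS
  have mS : Measurable S := Measurable.tsum fun k => (hc k).enorm.pow_const 2
  -- a positive weight making the modes square integrable in time
  set w : ℝ → ℝ := fun t => Real.exp (-t ^ 2) * (1 + (S t).toReal)⁻¹ with hw
  have mw : Measurable w := by fun_prop
  have w0 : ∀ t, 0 < w t := fun t => by positivity
  have hsum : ∑' k, ∫⁻ t, ‖(w t : ℂ) * c k t‖ₑ ^ 2 ≠ ⊤ := by
    rw [← lintegral_tsum fun k => by fun_prop]
    have hle : ∫⁻ t, ∑' k, ‖(w t : ℂ) * c k t‖ₑ ^ 2 ≤ ∫⁻ t, ENNReal.ofReal (Real.exp (-1 * t ^ 2)) := by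
      refine lintegral_mono_ae ?_
      filter_upwards [hs] with t ht
      have ht : S t ≠ ⊤ := ht
      simp only [enorm_mul, mul_pow, ENNReal.tsum_mul_left]
      change _ * S t ≤ _
      rw [← ENNReal.ofReal_toReal ht, ← ofReal_norm, Complex.norm_real, Real.norm_of_nonneg (w0 t).le,
        ← ENNReal.ofReal_pow (w0 t).le, ← ENNReal.ofReal_mul (by positivity)]
      refine ENNReal.ofReal_le_ofReal ?_
      set X := (S t).toReal with hX
      have hX0 : 0 ≤ X := ENNReal.toReal_nonneg
      have e1 : Real.exp (-t ^ 2) ≤ 1 := Real.exp_le_one_iff.mpr (by nlinarith [sq_nonneg t])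
      calc w t ^ 2 * X = Real.exp (-t ^ 2) * (Real.exp (-t ^ 2) * ((1 + X)⁻¹ * (X * (1 + X)⁻¹))) := by
            simp only [hw, ← hX]; ring
        _ ≤ Real.exp (-t ^ 2) * (1 * (1 * 1)) := by
            gcongr
            · exact inv_le_one_of_one_le₀ (by linarith)
            · rw [← div_eq_mul_inv, div_le_one (by linarith)]
              linarith
        _ = _ := by rw [neg_one_mul]; ring
    refine ne_top_of_le_ne_top ?_ hle
    have := (integrable_exp_neg_mul_sq (b := 1) one_pos).2.ne
    convert! this using 3 with t
    rw [Real.enorm_of_nonneg (Real.exp_pos _).le]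
  obtain ⟨U, hU, hUc⟩ := exists_memLp_of_coef (a := fun k t => (w t : ℂ) * c k t) (fun k => by fun_prop) hsum
  refine ⟨fun z => ((w z.1)⁻¹ : ℂ) * U z, ?_, ?_⟩
  · refine AEStronglyMeasurable.mul ?_ hU.1
    exact Measurable.aestronglyMeasurable (by fun_prop)
  · filter_upwards [hUc, ae_memLp_two_of_memLp_prod (μ := volume) hU] with t h1 h2
    refine ⟨h2.const_mul _, fun k => ?_⟩
    rw [coef_const_mul, h1]
    have : (w t : ℂ) ≠ 0 := by exact_mod_cast (w0 t).ne'
    field_simp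

/-! ### The resolvent and its gradient in Fourier modes -/

theorem norm_intVec_neg (k : Fin d → ℤ) : ‖intVec (-k)‖ = ‖intVec k‖ := by
  have : intVec (-k) = -intVec k := by
    ext i
    simp [intVec]
  rw [this, norm_neg]

theorem abs_apply_le_norm_intVec (k : Fin d → ℤ) (i : Fin d) : |(k i : ℝ)| ≤ ‖intVec k‖ := by
  simpa using PiLp.norm_apply_le (intVec k) i

theorem tsum_enorm_coef_sq_ne_top {f : Torus d → ℂ} (hf : MemLp f 2) : ∑' k, ‖coef k f‖ₑ ^ 2 ≠ ⊤ := by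
  have h1 : ∫⁻ x, ‖f x‖ₑ ^ 2 ≠ ⊤ := by
    have := (eLpNorm_lt_top_iff_lintegral_rpow_enorm_lt_top (by simp) (by simp)).mp hf.2
    simpa using this.ne
  rw [lintegral_enorm_sq_eq_tsum_coef hf] at h1
  intro h2
  rw [h2, ENNReal.mul_top (ENNReal.ofReal_pos.mpr (by positivity)).ne'] at h1
  exact h1 rfl

/-- A jointly measurable function with measurable Fourier modes obtained from those of `h` by a
bounded multiplier. -/
theorem exists_of_multiplier {h : ℝ × Torus d → ℂ} (hm : AEStronglyMeasurable h)
    (h2 : ∀ᵐ t : ℝ, MemLp (fun x => h (t, x)) 2) (q : (Fin d → ℤ) → ℝ → ℂ)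
    (hq : ∀ k, Measurable (q k)) (C : ℝ → ℝ) (hC : ∀ k t, ‖q k t‖ ≤ C t) :
    ∃ U : ℝ × Torus d → ℂ, AEStronglyMeasurable U ∧ ∀ᵐ t : ℝ, MemLp (fun x => U (t, x)) 2 ∧
      ∀ k, coef k (fun x => U (t, x)) = q k t * coef k (fun x => h (t, x)) := by
  have hm' : AEStronglyMeasurable h ((volume : Measure ℝ).prod (volume : Measure (Torus d))) := hm
  have e : ∀ᵐ t : ℝ, (fun x => h (t, x)) =ᵐ[volume] fun x => hm'.mk h (t, x) :=
    Measure.ae_ae_of_ae_prod hm'.ae_eq_mk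
  obtain ⟨U, hU, hUc⟩ := exists_of_coef_ae (c := fun k t => q k t * coef k (fun x => hm'.mk h (t, x)))
    (fun k => (hq k).mul (measurable_coef hm'.stronglyMeasurable_mk k)) (by
      filter_upwards [e, h2] with t h3 h4
      simp only [← coef_congr_ae h3]
      have h5 := tsum_enorm_coef_sq_ne_top h4
      refine ne_top_of_le_ne_top (ENNReal.mul_ne_top (ENNReal.ofReal_ne_top (r := C t ^ 2)) h5) ?_
      rw [← ENNReal.tsum_mul_left]
      refine ENNReal.tsum_le_tsum fun k => ?_
      rw [enorm_mul, mul_pow]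
      refine mul_le_mul_left ?_ _
      rw [← ofReal_norm, ← ENNReal.ofReal_pow (norm_nonneg _)]
      gcongr
      exact hC k t)
  refine ⟨U, hU, ?_⟩
  filter_upwards [hUc, e] with t h3 h4
  exact ⟨h3.1, fun k => by rw [h3.2 k, coef_congr_ae h4]⟩

theorem one_add_sq_mul_ne_zero (ε x : ℝ) : (1 + (ε : ℂ) ^ 2 * ((x ^ 2 : ℝ) : ℂ)) ≠ 0 := by
  have : (1 + ε ^ 2 * x ^ 2 : ℝ) ≠ 0 := by positivity
  exact_mod_cast this

theorem norm_inv_one_add_sq_mul (ε x : ℝ) :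
    ‖(1 + (ε : ℂ) ^ 2 * ((x ^ 2 : ℝ) : ℂ))⁻¹‖ = (1 + ε ^ 2 * x ^ 2)⁻¹ := by
  have : (1 + (ε : ℂ) ^ 2 * ((x ^ 2 : ℝ) : ℂ)) = ((1 + ε ^ 2 * x ^ 2 : ℝ) : ℂ) := by push_cast; rfl
  rw [this, norm_inv, Complex.norm_real, Real.norm_of_nonneg (by positivity)]

theorem exists_isResolvent (ε : ℝ) {h : ℝ × Torus d → ℂ} (hm : AEStronglyMeasurable h)
    (h2 : ∀ᵐ t : ℝ, MemLp (fun x => h (t, x)) 2) : ∃ u, IsResolvent ε h u := by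
  obtain ⟨U, hU, hUc⟩ := exists_of_multiplier hm h2
    (fun k _ => (1 + (ε : ℂ) ^ 2 * ((‖intVec k‖ ^ 2 : ℝ) : ℂ))⁻¹) (fun k => measurable_const) (fun _ => 1)
    (fun k _ => by
      rw [norm_inv_one_add_sq_mul]
      exact inv_le_one_of_one_le₀ (by nlinarith [mul_nonneg (sq_nonneg ε) (sq_nonneg ‖intVec k‖)]))
  refine ⟨U, hU, ?_⟩
  filter_upwards [hUc, h2] with t h3 h4
  refine ⟨h3.1, fun φ hφ => ?_⟩
  have hL : MemLp (fun x => φ x - (ε : ℂ) ^ 2 * torusLaplacian φ x) 2 :=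
    hφ.memLp.sub ((memLp_finsetSum _ fun i _ => ((hφ.torusPd i).torusPd i).memLp).const_mul _)
  rw [← (hasSum_coef_mul_coef h3.1 hL).tsum_eq, ← (hasSum_coef_mul_coef h4 hφ.memLp).tsum_eq]
  refine tsum_congr fun k => ?_
  rw [h3.2, hφ.coef_sub_laplacian, norm_intVec_neg]
  have := one_add_sq_mul_ne_zero ε ‖intVec k‖
  field_simp

theorem IsResolvent.coef_eq {ε : ℝ} {h u : ℝ × Torus d → ℂ} (H : IsResolvent ε h u) :
    ∀ᵐ t : ℝ, MemLp (fun x => u (t, x)) 2 ∧ ∀ k, coef k (fun x => u (t, x))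
      = (1 + (ε : ℂ) ^ 2 * ((‖intVec k‖ ^ 2 : ℝ) : ℂ))⁻¹ * coef k (fun x => h (t, x)) := by
  filter_upwards [H.weak] with t ht
  refine ⟨ht.1, fun k => ?_⟩
  have h1 := ht.2 _ (torusSmooth_tchar (-k))
  simp only [torusLaplacian_tchar, norm_intVec_neg] at h1
  rw [eq_inv_mul_iff_mul_eq₀ (one_add_sq_mul_ne_zero ε ‖intVec k‖)]
  unfold coef
  simp only [mul_comm (tchar (-k) _)]
  rw [← h1, mul_left_comm, ← integral_const_mul]
  congr 2
  ext x
  ring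

theorem IsWeakPdX.coef_eq {i : Fin d} {F w : ℝ × Torus d → ℂ} (H : IsWeakPdX i F w) :
    ∀ᵐ t : ℝ, Integrable (fun x => w (t, x)) ∧ ∀ k, coef k (fun x => w (t, x))
      = Complex.I * (k i : ℂ) * coef k (fun x => F (t, x)) := by
  filter_upwards [H.weak] with t ht
  refine ⟨ht.2.1, fun k => ?_⟩
  have h1 := ht.2.2 _ (torusSmooth_tchar (-k))
  simp only [torusPd_tchar] at h1
  unfold coef
  simp only [mul_comm (tchar (-k) _)]
  rw [eq_comm, mul_left_comm]
  congr 1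
  rw [← neg_eq_iff_eq_neg] at h1
  rw [← h1, ← integral_const_mul, ← integral_neg]
  congr 1
  ext x
  push_cast [Pi.neg_apply]
  ring

theorem isWeakPdX_of_coef {i : Fin d} {F w : ℝ × Torus d → ℂ} (hw : AEStronglyMeasurable w)
    (H : ∀ᵐ t : ℝ, MemLp (fun x => F (t, x)) 2 ∧ MemLp (fun x => w (t, x)) 2 ∧
      ∀ k, coef k (fun x => w (t, x)) = Complex.I * (k i : ℂ) * coef k (fun x => F (t, x))) :
    IsWeakPdX i F w where
  meas := hw
  weak := by
    filter_upwards [H] with t ht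
    refine ⟨ht.1.integrable (by norm_num), ht.2.1.integrable (by norm_num), fun φ hφ => ?_⟩
    rw [← (hasSum_coef_mul_coef ht.1 (hφ.torusPd i).memLp).tsum_eq,
      ← (hasSum_coef_mul_coef ht.2.1 hφ.memLp).tsum_eq, ← tsum_neg]
    refine tsum_congr fun k => ?_
    rw [ht.2.2, hφ.coef_torusPd]
    push_cast [Pi.neg_apply]
    ring

/-- The frequency `k` part of `∂_j (I - ε²Δ)⁻¹`. -/
def gradResolventSymbol (ε : ℝ) (j : Fin d) (k : Fin d → ℤ) : ℂ :=
  Complex.I * (k j : ℂ) * (1 + (ε : ℂ) ^ 2 * ((‖intVec k‖ ^ 2 : ℝ) : ℂ))⁻¹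

theorem norm_gradResolventSymbol_le {ε : ℝ} (hε : 0 < ε) (j : Fin d) (k : Fin d → ℤ) :
    ‖gradResolventSymbol ε j k‖ ≤ ε⁻¹ := by
  unfold gradResolventSymbol
  rw [norm_mul, norm_inv_one_add_sq_mul, norm_mul, Complex.norm_I, one_mul, Complex.norm_intCast]
  have h1 := abs_apply_le_norm_intVec k j
  rw [← div_eq_mul_inv, div_le_iff₀ (by positivity)]
  have h2 : ε⁻¹ * (1 + ε ^ 2 * ‖intVec k‖ ^ 2) = ε⁻¹ + ε * ‖intVec k‖ ^ 2 := by
    field_simp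
  rw [h2]
  refine h1.trans ?_
  have h3 : ε * ε⁻¹ = 1 := mul_inv_cancel₀ hε.ne'
  have h4 : 0 < ε⁻¹ := by positivity
  nlinarith [sq_nonneg (ε * ‖intVec k‖ - 1), norm_nonneg (intVec k), mul_pos hε h4]

/-- The gradient of the resolvent that enters the integral operator: its measurability and its
Fourier modes. -/
theorem weakPdX_resolvent {ε : ℝ} (hε : 0 < ε) (γ : ℝ) {h : ℝ × Torus d → ℂ} (hm : AEStronglyMeasurable h)
    (h2 : ∀ᵐ t : ℝ, MemLp (fun x => h (t, x)) 2) (j : Fin d) :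
    AEStronglyMeasurable (weakPdX j fun y => (Real.exp (γ * y.1) : ℂ) * resolvent ε h y) ∧
    ∀ᵐ t : ℝ, MemLp (fun x => weakPdX j (fun y => (Real.exp (γ * y.1) : ℂ) * resolvent ε h y) (t, x)) 2 ∧
      ∀ k, coef k (fun x => weakPdX j (fun y => (Real.exp (γ * y.1) : ℂ) * resolvent ε h y) (t, x))
        = (Real.exp (γ * t) : ℂ) * gradResolventSymbol ε j k * coef k (fun x => h (t, x)) := by
  set F : ℝ × Torus d → ℂ := fun y => (Real.exp (γ * y.1) : ℂ) * resolvent ε h y with hF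
  have hres := (resolvent_spec (exists_isResolvent ε hm h2)).coef_eq
  have hFc : ∀ᵐ t : ℝ, MemLp (fun x => F (t, x)) 2 ∧ ∀ k, coef k (fun x => F (t, x))
      = (Real.exp (γ * t) : ℂ) * ((1 + (ε : ℂ) ^ 2 * ((‖intVec k‖ ^ 2 : ℝ) : ℂ))⁻¹ * coef k (fun x => h (t, x))) := by
    filter_upwards [hres] with t ht
    exact ⟨ht.1.const_mul (Real.exp (γ * t) : ℂ), fun k => by rw [← ht.2 k, ← coef_const_mul]⟩
  obtain ⟨U, hU, hUc⟩ := exists_of_multiplier hm h2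
    (fun k t => (Real.exp (γ * t) : ℂ) * gradResolventSymbol ε j k) (fun k => by fun_prop)
    (fun t => Real.exp (γ * t) * ε⁻¹) (fun k t => by
      rw [norm_mul, Complex.norm_real, Real.norm_of_nonneg (Real.exp_pos _).le]
      gcongr
      exact norm_gradResolventSymbol_le hε j k)
  have hex : ∃ w, IsWeakPdX j F w := by
    refine ⟨U, isWeakPdX_of_coef hU ?_⟩
    filter_upwards [hUc, hFc] with t h3 h4
    refine ⟨h4.1, h3.1, fun k => ?_⟩
    rw [h3.2, h4.2, gradResolventSymbol]
    ring
  have hspec := weakPdX_spec hex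
  refine ⟨hspec.meas, ?_⟩
  filter_upwards [hspec.coef_eq, hUc, hFc] with t h3 h4 h5
  have e : ∀ k, coef k (fun x => weakPdX j F (t, x)) = coef k (fun x => U (t, x)) := fun k => by
    rw [h3.2, h5.2, h4.2, gradResolventSymbol]
    ring
  refine ⟨(memLp_congr_ae (ae_eq_of_coef_eq h3.1 (h4.1.integrable (by norm_num)) e)).mpr h4.1, fun k => ?_⟩
  rw [e, h4.2]

/-! ### Modes in `x` of functions of `(x, v)` -/

/-- The partial derivative `∂_{v_i}` of a complex function on `ℝᵈ`. -/
def velPd (i : Fin d) (g : Vel d → ℂ) : Vel d → ℂ := fun v => fderiv ℝ g v (EuclideanSpace.single i 1)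

/-- The test function `Re (c e^{-i n·x} g(v))`: test functions are real, and the arbitrary constant `c`
recovers complex identities from their real parts. -/
def waveTest (n : Fin d → ℤ) (c : ℂ) (g : Vel d → ℂ) : Torus d × Vel d → ℝ :=
  fun z => (c * tchar (-n) z.1 * g z.2).re

theorem contDiff_velPd {g : Vel d → ℂ} (hg : ContDiff ℝ ∞ g) (i : Fin d) : ContDiff ℝ ∞ (velPd i g) :=
  (hg.fderiv_right (m := ∞) (by simp)).clm_apply contDiff_const

theorem hasCompactSupport_velPd {g : Vel d → ℂ} (hg : HasCompactSupport g) (i : Fin d) :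
    HasCompactSupport (velPd i g) :=
  hg.fderiv_apply ℝ _

theorem contDiff_velPd_iterate {g : Vel d → ℂ} (hg : ContDiff ℝ ∞ g) (i : Fin d) (q : ℕ) :
    ContDiff ℝ ∞ ((velPd i)^[q] g) := by
  induction q with
  | zero => exact hg
  | succ q ih => rw [Function.iterate_succ_apply']; exact contDiff_velPd ih i

theorem isTest_waveTest (n : Fin d → ℤ) (c : ℂ) {g : Vel d → ℂ} (hg : ContDiff ℝ ∞ g)
    (hc : HasCompactSupport g) : IsTest (waveTest n c g) where
  smooth := by
    have h1 : ContDiff ℝ ∞ fun y : Vel d × Vel d => tchar (-n) (toTorus y.1) :=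
      (show ContDiff ℝ ∞ fun y : Vel d => tchar (-n) (toTorus y) from torusSmooth_tchar (-n)).comp contDiff_fst
    exact Complex.reCLM.contDiff.comp ((contDiff_const.mul h1).mul (hg.comp contDiff_snd))
  bounded_support := by
    obtain ⟨ρ, hρ⟩ := hc.isCompact.isBounded.subset_closedBall (0 : Vel d)
    refine ⟨ρ, fun z hz => ?_⟩
    have : g z.2 = 0 := by
      by_contra h
      have := hρ (subset_tsupport g h)
      rw [mem_closedBall_zero_iff] at this
      linarith
    simp [waveTest, this]

theorem pdX_waveTest (i : Fin d) (n : Fin d → ℤ) (c : ℂ) (g : Vel d → ℂ) :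
    pdX i (waveTest n c g) = waveTest n (-Complex.I * (n i : ℂ) * c) g := by
  ext z
  unfold pdX waveTest
  have h1 := ((torusSmooth_tchar (-n)).hasDerivAt i z.1 0).const_mul c
  have h2 := (Complex.reCLM.hasFDerivAt.comp_hasDerivAt 0 (h1.mul_const (g z.2))).deriv
  simp only [Function.comp_def, Complex.reCLM_apply] at h2
  rw [h2, torusPd_tchar]
  have e : z.1 + Pi.single i ((0 : ℝ) : AddCircle (2 * π)) = z.1 := by simp
  rw [e]
  congr 1
  push_cast [Pi.neg_apply]
  ring

theorem pdV_waveTest (i : Fin d) (n : Fin d → ℤ) (c : ℂ) {g : Vel d → ℂ} (hg : ContDiff ℝ ∞ g) :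
    pdV i (waveTest n c g) = waveTest n c (velPd i g) := by
  ext z
  unfold pdV waveTest
  have h0 : HasDerivAt (fun s : ℝ => z.2 + EuclideanSpace.single i s) (EuclideanSpace.single i 1) 0 := by
    have : (fun s : ℝ => z.2 + EuclideanSpace.single i s) = fun s => z.2 + s • EuclideanSpace.single i (1 : ℝ) := by
      ext s j
      simp
    rw [this]
    simpa using ((hasDerivAt_id (0 : ℝ)).smul_const (EuclideanSpace.single i (1 : ℝ))).const_add z.2
  have e : z.2 + EuclideanSpace.single i (0 : ℝ) = z.2 := by
    ext j
    simp
  have h1 : HasFDerivAt g (fderiv ℝ g z.2) (z.2 + EuclideanSpace.single i (0 : ℝ)) := by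
    rw [e]
    exact (hg.differentiable (by simp) z.2).hasFDerivAt
  have h2 := (Complex.reCLM.hasFDerivAt.comp_hasDerivAt 0
    ((h1.comp_hasDerivAt 0 h0).const_mul (c * tchar (-n) z.1))).deriv
  simp only [Function.comp_def, Complex.reCLM_apply] at h2
  rw [h2]
  rfl

theorem pdX_iterate_waveTest (i : Fin d) (n : Fin d → ℤ) (c : ℂ) (g : Vel d → ℂ) (a : ℕ) :
    (pdX i)^[a] (waveTest n c g) = waveTest n ((-Complex.I * (n i : ℂ)) ^ a * c) g := by
  induction a with
  | zero => simp
  | succ a ih =>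
    rw [Function.iterate_succ_apply', ih, pdX_waveTest]
    congr 1
    ring

theorem pdV_iterate_waveTest (i : Fin d) (n : Fin d → ℤ) (c : ℂ) {g : Vel d → ℂ} (hg : ContDiff ℝ ∞ g) (q : ℕ) :
    (pdV i)^[q] (waveTest n c g) = waveTest n c ((velPd i)^[q] g) := by
  induction q with
  | zero => simp
  | succ q ih =>
    rw [Function.iterate_succ_apply', ih, pdV_waveTest _ _ _ (contDiff_velPd_iterate hg i q),
      Function.iterate_succ_apply']

theorem foldr_iterate_single {ι α : Type*} [DecidableEq ι] (T : ι → α → α) (j : ι) (a : ℕ) (φ : α)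
    {l : List ι} (hl : l.Nodup) :
    l.foldr (fun i ψ => (T i)^[(Pi.single j a : ι → ℕ) i] ψ) φ = if j ∈ l then (T j)^[a] φ else φ := by
  induction l with
  | nil => simp
  | cons i l ih =>
    rw [List.foldr_cons, ih hl.of_cons]
    rw [List.nodup_cons] at hl
    by_cases hij : i = j
    · subst hij
      simp [hl.1]
    · simp [hij, Ne.symm hij]

theorem pdIter_single (j i : Fin d) (a q : ℕ) (φ : Torus d × Vel d → ℝ) :
    pdIter (Pi.single j a) (Pi.single i q) φ = (pdX j)^[a] ((pdV i)^[q] φ) := by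
  unfold pdIter
  rw [foldr_iterate_single pdV i q φ (List.nodup_finRange d),
    foldr_iterate_single pdX j a _ (List.nodup_finRange d)]
  simp

theorem sum_single_nat (j : Fin d) (a : ℕ) : ∑ i, (Pi.single j a : Fin d → ℕ) i = a := by
  simp

theorem IsWeakDeriv.integral_waveTest {j i : Fin d} {a q : ℕ} {f F : Torus d × Vel d → ℝ}
    (H : IsWeakDeriv (Pi.single j a) (Pi.single i q) f F) (n : Fin d → ℤ) (c : ℂ) {g : Vel d → ℂ}
    (hg : ContDiff ℝ ∞ g) (hc : HasCompactSupport g) :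
    ∫ z, f z * waveTest n ((-Complex.I * (n j : ℂ)) ^ a * c) ((velPd i)^[q] g) z
      = (-1) ^ (a + q) * ∫ z, F z * waveTest n c g z := by
  have h := H.integral_eq _ (isTest_waveTest n c hg hc)
  rw [pdIter_single, pdV_iterate_waveTest _ _ _ hg, pdX_iterate_waveTest, sum_single_nat, sum_single_nat] at h
  exact h

/-- The `n`-th Fourier mode in `x` of a function of `(x, v)`. -/
def modeV (n : Fin d → ℤ) (F : Torus d × Vel d → ℝ) (v : Vel d) : ℂ := coef n fun x => (F (x, v) : ℂ)

theorem memLp_swap {F : Torus d × Vel d → ℝ} (hF : MemLp F 2) :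
    MemLp (fun p : Vel d × Torus d => (F (p.2, p.1) : ℂ)) 2
      ((volume : Measure (Vel d)).prod (volume : Measure (Torus d))) :=
  (hF.comp_measurePreserving (Measure.measurePreserving_swap
    (μ := (volume : Measure (Vel d))) (ν := (volume : Measure (Torus d))))).ofReal

theorem aestronglyMeasurable_modeV {F : Torus d × Vel d → ℝ} (hF : MemLp F 2) (n : Fin d → ℤ) :
    AEStronglyMeasurable (modeV n F) := aestronglyMeasurable_coef (memLp_swap hF).1 n

theorem ae_memLp_slice {F : Torus d × Vel d → ℝ} (hF : MemLp F 2) :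
    ∀ᵐ v, MemLp (fun x => (F (x, v) : ℂ)) 2 := ae_memLp_two_of_memLp_prod (memLp_swap hF)

theorem integrable_mul_wave {F : Torus d × Vel d → ℝ} (hF : MemLp F 2) (n : Fin d → ℤ) (c : ℂ)
    {g : Vel d → ℂ} (hg : Continuous g) (hc : HasCompactSupport g) :
    Integrable (fun p : Vel d × Torus d => (F (p.2, p.1) : ℂ) * (c * tchar (-n) p.2 * g p.1))
      ((volume : Measure (Vel d)).prod (volume : Measure (Torus d))) := by
  have h1 : MemLp (fun p : Vel d × Torus d => c * tchar (-n) p.2 * g p.1) 2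
      ((volume : Measure (Vel d)).prod (volume : Measure (Torus d))) := by
    refine Continuous.memLp_of_hasCompactSupport (by fun_prop) ?_
    refine HasCompactSupport.of_support_subset_isCompact (hc.isCompact.prod isCompact_univ) fun p hp => ?_
    exact ⟨subset_tsupport g (right_ne_zero_of_mul hp), mem_univ _⟩
  exact (memLp_swap hF).integrable_mul h1

theorem integral_mul_waveTest {F : Torus d × Vel d → ℝ} (hF : MemLp F 2) (n : Fin d → ℤ) (c : ℂ)
    {g : Vel d → ℂ} (hg : Continuous g) (hc : HasCompactSupport g) :
    ∫ z, F z * waveTest n c g z = (c * (((2 * π : ℝ) : ℂ) ^ d * ∫ v, modeV n F v * g v)).re := by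
  have hi := integrable_mul_wave hF n c hg hc
  have e1 : ∫ p : Vel d × Torus d, (F (p.2, p.1) : ℂ) * (c * tchar (-n) p.2 * g p.1)
        ∂((volume : Measure (Vel d)).prod (volume : Measure (Torus d)))
      = c * (((2 * π : ℝ) : ℂ) ^ d * ∫ v, modeV n F v * g v) := by
    rw [integral_prod _ hi, ← integral_const_mul, ← integral_const_mul]
    congr 1
    ext v
    unfold modeV coef
    rw [mul_assoc _ _ (g v), mul_inv_cancel_left₀ two_pi_pow_ne_zero, mul_comm _ (g v),
      ← mul_assoc, ← integral_const_mul]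
    congr 1
    ext x
    ring
  rw [← e1]
  have e2 : ∫ z, F z * waveTest n c g z
      = ∫ p : Vel d × Torus d, F (p.2, p.1) * waveTest n c g (p.2, p.1)
        ∂((volume : Measure (Vel d)).prod (volume : Measure (Torus d))) :=
    (Measure.measurePreserving_swap (μ := (volume : Measure (Vel d))) (ν := (volume : Measure (Torus d)))
      |>.integral_comp MeasurableEquiv.prodComm.measurableEmbedding
      (fun z => F z * waveTest n c g z)).symm
  have e3 := integral_re (𝕜 := ℂ) hi
  simp only [RCLike.re_to_complex] at e3
  rw [e2, ← e3]
  congr 1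
  ext p
  simp only [waveTest, Complex.re_ofReal_mul]

theorem eq_of_forall_mul_re {X Y : ℂ} (h : ∀ c : ℂ, (c * X).re = (c * Y).re) : X = Y := by
  apply Complex.ext
  · simpa using h 1
  · simpa using h (-Complex.I)

/-- Derivatives in `x` act on the modes by multiplication. Both sides are compared with the weak derivative
of `f`, tested against the plane wave of frequency `n` times `g`. -/
theorem integral_modeV_mul_of_isWeakDeriv {j i : Fin d} {a q : ℕ} {f F F₀ : Torus d × Vel d → ℝ}
    (H : IsWeakDeriv (Pi.single j a) (Pi.single i q) f F) (H₀ : IsWeakDeriv 0 (Pi.single i q) f F₀)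
    (hF : MemLp F 2) (hF₀ : MemLp F₀ 2) (n : Fin d → ℤ) {g : Vel d → ℂ}
    (hg : ContDiff ℝ ∞ g) (hc : HasCompactSupport g) :
    ∫ v, modeV n F v * g v = (Complex.I * (n j : ℂ)) ^ a * ∫ v, modeV n F₀ v * g v := by
  have hpi := two_pi_pow_ne_zero (d := d)
  refine mul_left_cancel₀ hpi (eq_of_forall_mul_re fun c => ?_)
  have H₀' : IsWeakDeriv (Pi.single j 0) (Pi.single i q) f F₀ := by rwa [Pi.single_zero]
  have h1 := H.integral_waveTest n c hg hc
  have h2 := H₀'.integral_waveTest n ((-Complex.I * (n j : ℂ)) ^ a * c) hg hc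
  rw [pow_zero, one_mul, h1, zero_add, integral_mul_waveTest hF n _ hg.continuous hc,
    integral_mul_waveTest hF₀ n _ hg.continuous hc, pow_add, mul_comm ((-1 : ℝ) ^ a), mul_assoc] at h2
  have h3 := mul_left_cancel₀ (pow_ne_zero q (by norm_num : (-1 : ℝ) ≠ 0)) h2
  have h4 : ((-1 : ℝ) ^ a) * ((-1 : ℝ) ^ a) = 1 := by rw [← mul_pow]; norm_num
  have h5 : ∀ x y : ℝ, (-1 : ℝ) ^ a * x = y → x = (-1 : ℝ) ^ a * y := by
    rintro x y rfl
    rw [← mul_assoc, h4, one_mul]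
  rw [h5 _ _ h3, ← Complex.re_ofReal_mul]
  congr 1
  rw [show -Complex.I * (n j : ℂ) = -1 * (Complex.I * (n j : ℂ)) by ring, mul_pow]
  have h6 : ((-1 : ℂ) ^ a) * ((-1 : ℂ) ^ a) = 1 := by rw [← mul_pow]; norm_num
  push_cast
  linear_combination ((Complex.I * (n j : ℂ)) ^ a * (c * ((2 * (π : ℂ)) ^ d * ∫ v, modeV n F₀ v * g v))) * h6

/-- The modes of two successive velocity derivatives: the second is the weak derivative of the
first. -/
theorem integral_modeV_succ {i : Fin d} {q : ℕ} {f F F₁ : Torus d × Vel d → ℝ}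
    (H : IsWeakDeriv 0 (Pi.single i q) f F) (H₁ : IsWeakDeriv 0 (Pi.single i (q + 1)) f F₁)
    (hF : MemLp F 2) (hF₁ : MemLp F₁ 2) (n : Fin d → ℤ) {g : Vel d → ℂ}
    (hg : ContDiff ℝ ∞ g) (hc : HasCompactSupport g) :
    ∫ v, modeV n F₁ v * g v = -∫ v, modeV n F v * velPd i g v := by
  have hpi := two_pi_pow_ne_zero (d := d)
  refine mul_left_cancel₀ hpi (eq_of_forall_mul_re fun c => ?_)
  rw [← Pi.single_zero i] at H H₁
  have h1 := H.integral_waveTest n c (contDiff_velPd hg i) (hasCompactSupport_velPd hc i)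
  have h2 := H₁.integral_waveTest n c hg hc
  rw [← Function.iterate_succ_apply, h2, integral_mul_waveTest hF₁ n _ hg.continuous hc,
    integral_mul_waveTest hF n _ (contDiff_velPd hg i).continuous (hasCompactSupport_velPd hc i),
    zero_add, zero_add, pow_succ, mul_assoc] at h1
  have h3 := mul_left_cancel₀ (pow_ne_zero q (by norm_num : (-1 : ℝ) ≠ 0)) h1
  rw [mul_neg, mul_neg, Complex.neg_re, ← h3]
  ring

/-! ### The Fourier transform in velocity -/

/-- The Fourier transform in velocity of a complex function. -/
def velFourier (u : Vel d → ℂ) (ξ : Vel d) : ℂ :=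
  ∫ v : Vel d, Complex.exp (-Complex.I * ((inner ℝ ξ v : ℝ) : ℂ)) * u v

theorem norm_cexp_neg_I_mul (x : ℝ) : ‖Complex.exp (-Complex.I * (x : ℂ))‖ = 1 := by
  rw [show -Complex.I * (x : ℂ) = ((-x : ℝ) : ℂ) * Complex.I by push_cast; ring, Complex.norm_exp_ofReal_mul_I]

theorem norm_cexp_neg_I_mul_sub_le (x y : ℝ) :
    ‖Complex.exp (-Complex.I * (x : ℂ)) - Complex.exp (-Complex.I * (y : ℂ))‖ ≤ |x - y| := by
  have e : Complex.exp (-Complex.I * (x : ℂ)) - Complex.exp (-Complex.I * (y : ℂ))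
      = Complex.exp (-Complex.I * (y : ℂ)) * (Complex.exp (Complex.I * ((y - x : ℝ) : ℂ)) - 1) := by
    rw [mul_sub, ← Complex.exp_add, mul_one]
    congr 2
    push_cast
    ring
  rw [e, norm_mul, norm_cexp_neg_I_mul, one_mul, abs_sub_comm]
  exact Real.norm_exp_I_mul_ofReal_sub_one_le

theorem continuous_wave (ξ : Vel d) :
    Continuous fun v : Vel d => Complex.exp (-Complex.I * ((inner ℝ ξ v : ℝ) : ℂ)) := by
  have : Continuous fun v : Vel d => (inner ℝ ξ v : ℝ) := continuous_const.inner continuous_id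
  fun_prop

theorem integrable_wave_mul {u : Vel d → ℂ} (hu : Integrable u) (ξ : Vel d) :
    Integrable fun v => Complex.exp (-Complex.I * ((inner ℝ ξ v : ℝ) : ℂ)) * u v :=
  hu.bdd_mul (c := 1) (continuous_wave ξ).aestronglyMeasurable
    (.of_forall fun _ => (norm_cexp_neg_I_mul _).le)

theorem norm_velFourier_le (u : Vel d → ℂ) (ξ : Vel d) : ‖velFourier u ξ‖ ≤ ∫ v, ‖u v‖ := by
  refine (norm_integral_le_integral_norm _).trans_eq ?_
  simp only [norm_mul, norm_cexp_neg_I_mul, one_mul]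

theorem continuous_velFourier {u : Vel d → ℂ} (hu : Integrable u) : Continuous (velFourier u) := by
  refine continuous_of_dominated (bound := fun v => ‖u v‖) (fun ξ => (integrable_wave_mul hu ξ).1)
    (fun ξ => .of_forall fun v => ?_) hu.norm (.of_forall fun v => ?_)
  · rw [norm_mul, norm_cexp_neg_I_mul, one_mul]
  · have : Continuous fun ξ : Vel d => (inner ℝ ξ v : ℝ) := continuous_id.inner continuous_const
    fun_prop

theorem norm_velFourier_sub_le {u : Vel d → ℂ} (hu : Integrable u) (hu' : Integrable fun v => ‖v‖ * ‖u v‖)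
    (ξ ξ' : Vel d) : ‖velFourier u ξ - velFourier u ξ'‖ ≤ ‖ξ - ξ'‖ * ∫ v, ‖v‖ * ‖u v‖ := by
  unfold velFourier
  rw [← integral_sub (integrable_wave_mul hu ξ) (integrable_wave_mul hu ξ'), ← integral_const_mul]
  refine norm_integral_le_of_norm_le (hu'.const_mul _) (.of_forall fun v => ?_)
  rw [← sub_mul, norm_mul, ← mul_assoc]
  gcongr
  refine (norm_cexp_neg_I_mul_sub_le _ _).trans ?_
  rw [← inner_sub_left]
  exact abs_real_inner_le_norm _ _

/-- The Fourier transform of a weak derivative, when the function and the derivative are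
integrable: the wave is cut off at a large radius to make it a test function. -/
theorem velFourier_of_weak {u u' : Vel d → ℂ} (hu : Integrable u) (hu' : Integrable u') (i : Fin d)
    (H : ∀ g : Vel d → ℂ, ContDiff ℝ ∞ g → HasCompactSupport g →
      ∫ v, u' v * g v = -∫ v, u v * velPd i g v) (ξ : Vel d) :
    velFourier u' ξ = Complex.I * (ξ i : ℂ) * velFourier u ξ := by
  set e : Vel d → ℂ := fun v => Complex.exp (-Complex.I * ((inner ℝ ξ v : ℝ) : ℂ)) with he
  have hen : ∀ v, ‖e v‖ = 1 := fun v => norm_cexp_neg_I_mul _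
  have hes : ContDiff ℝ ∞ e := by
    have h : ContDiff ℝ ∞ fun y : Vel d => ((inner ℝ ξ y : ℝ) : ℂ) :=
      Complex.ofRealCLM.contDiff.comp (contDiff_const.inner ℝ contDiff_id)
    exact (contDiff_const.mul h).cexp
  have hed : ∀ v, fderiv ℝ e v (EuclideanSpace.single i 1) = -Complex.I * (ξ i : ℂ) * e v := by
    intro v
    have h1 : HasFDerivAt (fun y : Vel d => (inner ℝ ξ y : ℝ)) (innerSL ℝ ξ) v :=
      (innerSL ℝ ξ).hasFDerivAt
    have h2 := ((Complex.ofRealCLM.hasFDerivAt.comp v h1).const_mul (-Complex.I)).cexp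
    have h3 : fderiv ℝ e v = _ := h2.fderiv
    rw [h3]
    simp [he, EuclideanSpace.inner_single_right]
    ring
  -- the cut-offs are `χ (a N • v)` with `a N → 0`; their gradients are `O(a N)`
  let χ : ContDiffBump (0 : Vel d) := ⟨1, 2, one_pos, one_lt_two⟩
  have hχs : ContDiff ℝ ∞ (χ : Vel d → ℝ) := χ.contDiff
  set dχ : Vel d → ℝ := fun v => fderiv ℝ χ v (EuclideanSpace.single i 1) with hdχ
  obtain ⟨C, hC⟩ : ∃ C, ∀ v, ‖dχ v‖ ≤ C :=
    Continuous.bounded_above_of_compact_support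
      ((hχs.continuous_fderiv (by simp)).clm_apply continuous_const) (χ.hasCompactSupport.fderiv_apply ℝ _)
  set a : ℕ → ℝ := fun N => ((N : ℝ) + 1)⁻¹ with ha
  have ha0 : ∀ N, 0 < a N := fun N => by positivity
  have hat : Filter.Tendsto a Filter.atTop (nhds 0) := tendsto_inv_atTop_zero.comp
    (Filter.tendsto_atTop_add_const_right _ _ tendsto_natCast_atTop_atTop)
  set g : ℕ → Vel d → ℂ := fun N v => e v * ((χ (a N • v) : ℝ) : ℂ) with hg
  have hsc : ∀ N, ContDiff ℝ ∞ fun v : Vel d => ((χ (a N • v) : ℝ) : ℂ) := fun N =>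
    Complex.ofRealCLM.contDiff.comp (hχs.comp (contDiff_const_smul _))
  have hgs : ∀ N, ContDiff ℝ ∞ (g N) := fun N => hes.mul (hsc N)
  have hgc : ∀ N, HasCompactSupport (g N) := by
    intro N
    refine HasCompactSupport.mul_left ?_
    have := χ.hasCompactSupport.comp_smul (ha0 N).ne'
    exact this.comp_left (g := Complex.ofReal) (by simp)
  have hgd : ∀ N v, velPd i (g N) v = -Complex.I * (ξ i : ℂ) * g N v + e v * ((a N * dχ (a N • v) : ℝ) : ℂ) := by
    intro N v
    have h1 : HasFDerivAt e (fderiv ℝ e v) v := (hes.differentiable (by simp) v).hasFDerivAt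
    have h2 : HasFDerivAt (χ : Vel d → ℝ) (fderiv ℝ χ (a N • v)) (a N • v) :=
      (hχs.differentiable (by simp) _).hasFDerivAt
    have h3 : HasFDerivAt (fun v : Vel d => a N • v) (a N • ContinuousLinearMap.id ℝ (Vel d)) v :=
      (hasFDerivAt_id v).const_smul (a N)
    have h4 := Complex.ofRealCLM.hasFDerivAt.comp v (h2.comp v h3)
    have h5 := (h1.mul h4).fderiv
    unfold velPd
    have h6 : fderiv ℝ (g N) v = _ := h5
    rw [h6]
    simp [hed, hdχ, hg]
    ring
  have hχ0 : ∀ v, Filter.Tendsto (fun N => ((χ (a N • v) : ℝ) : ℂ)) Filter.atTop (nhds 1) := by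
    intro v
    have h1 : Filter.Tendsto (fun N => a N • v) Filter.atTop (nhds 0) := by
      simpa using hat.smul_const v
    have h2 := (χ.continuous.tendsto 0).comp h1
    rw [χ.one_of_mem_closedBall (by simp [χ.rIn_pos.le])] at h2
    exact_mod_cast (Complex.continuous_ofReal.tendsto 1).comp h2
  have hgle : ∀ N v, ‖g N v‖ ≤ 1 := by
    intro N v
    rw [hg, norm_mul, hen, one_mul, Complex.norm_real, Real.norm_of_nonneg χ.nonneg]
    exact χ.le_one
  have lim1 : ∀ {w : Vel d → ℂ}, Integrable w →
      Filter.Tendsto (fun N => ∫ v, w v * g N v) Filter.atTop (nhds (velFourier w ξ)) := by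
    intro w hw
    refine tendsto_integral_of_dominated_convergence (fun v => ‖w v‖)
      (fun N => hw.1.mul (hgs N).continuous.aestronglyMeasurable) hw.norm
      (fun N => .of_forall fun v => ?_) (.of_forall fun v => ?_)
    · rw [norm_mul]
      exact mul_le_of_le_one_right (norm_nonneg _) (hgle N v)
    · have := ((hχ0 v).const_mul (e v)).const_mul (w v)
      rw [mul_one, mul_comm (w v)] at this
      exact this
  have lim2 : Filter.Tendsto (fun N => ∫ v, u v * (e v * ((a N * dχ (a N • v) : ℝ) : ℂ))) Filter.atTop (nhds 0) := by
    have hC0 : 0 ≤ C := (norm_nonneg _).trans (hC 0)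
    have h1 : ∀ N, ‖∫ v, u v * (e v * ((a N * dχ (a N • v) : ℝ) : ℂ))‖ ≤ a N * (C * ∫ v, ‖u v‖) := by
      intro N
      rw [← mul_assoc, ← integral_const_mul]
      refine norm_integral_le_of_norm_le (hu.norm.const_mul _) (.of_forall fun v => ?_)
      rw [norm_mul, norm_mul, hen, one_mul, Complex.norm_real, norm_mul, Real.norm_of_nonneg (ha0 N).le, mul_comm]
      gcongr
      exact hC _
    refine squeeze_zero_norm h1 ?_
    simpa using hat.mul_const (C * ∫ v, ‖u v‖)
  have hid : ∀ N, ∫ v, u' v * g N v = Complex.I * (ξ i : ℂ) * (∫ v, u v * g N v)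
      - ∫ v, u v * (e v * ((a N * dχ (a N • v) : ℝ) : ℂ)) := by
    intro N
    rw [H _ (hgs N) (hgc N), ← integral_const_mul, ← integral_sub, ← integral_neg]
    · congr 1
      ext v
      rw [hgd]
      ring
    · refine Integrable.const_mul ?_ _
      refine Integrable.mul_bdd hu (c := 1) (hgs N).continuous.aestronglyMeasurable (.of_forall (hgle N))
    · refine Integrable.mul_bdd hu (c := a N * C) ?_ (.of_forall fun v => ?_)
      · refine (hes.continuous.mul (Complex.continuous_ofReal.comp (continuous_const.mul ?_))).aestronglyMeasurable
        exact ((hχs.continuous_fderiv (by simp)).clm_apply continuous_const).comp (continuous_const_smul _)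
      · rw [norm_mul, hen, one_mul, Complex.norm_real, norm_mul, Real.norm_of_nonneg (ha0 N).le]
        gcongr
        exact hC _
  have l1 := lim1 hu'
  simp only [hid] at l1
  have l2 := ((lim1 hu).const_mul (Complex.I * (ξ i : ℂ))).sub lim2
  rw [sub_zero] at l2
  exact tendsto_nhds_unique l1 l2

/-! ### Weighted `L¹` norms of the modes -/

/-- The velocity weight `(1 + |v|²)^p`, with values in `[0, ∞]`. -/
def velWeight (p : ℝ) (v : Vel d) : ℝ≥0∞ := ENNReal.ofReal ((1 + ‖v‖ ^ 2) ^ p)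

theorem measurable_velWeight (p : ℝ) : Measurable (velWeight (d := d) p) := by
  unfold velWeight
  fun_prop

theorem one_le_velWeight {p : ℝ} (hp : 0 ≤ p) (v : Vel d) : 1 ≤ velWeight p v := by
  unfold velWeight
  rw [ENNReal.one_le_ofReal]
  exact Real.one_le_rpow (by nlinarith [sq_nonneg ‖v‖]) hp

theorem memLp_two_of_velWeight {p : ℝ} (hp : 0 ≤ p) {F : Torus d × Vel d → ℝ} (hm : AEStronglyMeasurable F)
    (hF : ∫⁻ z, velWeight p z.2 * ‖F z‖ₑ ^ 2 ≠ ⊤) : MemLp F 2 := by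
  refine ⟨hm, (eLpNorm_lt_top_iff_lintegral_rpow_enorm_lt_top (by simp) (by simp)).mpr ?_⟩
  have : ∫⁻ z, ‖F z‖ₑ ^ 2 < ⊤ := by
    refine lt_of_le_of_lt (lintegral_mono fun z => ?_) hF.lt_top
    exact le_mul_of_one_le_left (by simp) (one_le_velWeight hp z.2)
  simpa using this

/-- Parseval's identity in `x`, integrated in `v` against a weight. -/
theorem lintegral_mul_enorm_sq_eq_tsum_modeV {F : Torus d × Vel d → ℝ} (hF : MemLp F 2) {w : Vel d → ℝ≥0∞}
    (hw : Measurable w) :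
    ∫⁻ z, w z.2 * ‖F z‖ₑ ^ 2
      = ENNReal.ofReal ((2 * π) ^ d) * ∑' n, ∫⁻ v, w v * ‖modeV n F v‖ₑ ^ 2 := by
  have hm : AEMeasurable (fun z : Torus d × Vel d => w z.2 * ‖F z‖ₑ ^ 2) :=
    (hw.comp measurable_snd).aemeasurable.mul (hF.1.enorm.pow_const 2)
  have hT : ∑' n, ∫⁻ v, w v * ‖modeV n F v‖ₑ ^ 2 = ∫⁻ v, ∑' n, w v * ‖modeV n F v‖ₑ ^ 2 :=
    (lintegral_tsum fun n => hw.aemeasurable.mul ((aestronglyMeasurable_modeV hF n).enorm.pow_const 2)).symm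
  rw [Measure.volume_eq_prod, lintegral_prod_symm _ hm, hT, ← lintegral_const_mul' _ _ ENNReal.ofReal_ne_top]
  refine lintegral_congr_ae ?_
  filter_upwards [ae_memLp_slice hF] with v hv
  have h1 := lintegral_enorm_sq_eq_tsum_coef hv
  rw [ENNReal.tsum_mul_left, mul_left_comm]
  unfold modeV
  rw [← h1, ← lintegral_const_mul'' _ (hv.1.enorm.pow_const 2)]
  refine lintegral_congr fun x => ?_
  simp only [← ofReal_norm, Complex.norm_real]

/-- The `L¹` norm of the `n`-th mode in `x`, with weight `1 + |v|`. -/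
def modeL1 (n : Fin d → ℤ) (F : Torus d × Vel d → ℝ) : ℝ≥0∞ :=
  ∫⁻ v, ENNReal.ofReal (1 + ‖v‖) * ‖modeV n F v‖ₑ

/-- The constant in the bound of the norm `modeL1` by the `L²` norm with weight `(1 + |v|²)^p`. -/
def velConst (d : ℕ) (p : ℝ) : ℝ≥0∞ :=
  ∫⁻ v : Vel d, ENNReal.ofReal ((1 + ‖v‖) * (1 + ‖v‖ ^ 2) ^ (-p / 2)) ^ 2

theorem velConst_ne_top {p : ℝ} (hp : (d : ℝ) < 2 * (p - 1)) : velConst d p ≠ ⊤ := by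
  have h1 : Integrable fun v : Vel d => (1 + ‖v‖ ^ 2) ^ (-(2 * (p - 1)) / 2) :=
    integrable_rpow_neg_one_add_norm_sq (by simpa using hp)
  have h2 := (h1.const_mul 2).2.ne
  refine ne_top_of_le_ne_top h2 (lintegral_mono fun v => ?_)
  have hx : 0 < 1 + ‖v‖ ^ 2 := by positivity
  rw [Real.enorm_of_nonneg (by positivity), ← ENNReal.ofReal_pow (by positivity)]
  refine ENNReal.ofReal_le_ofReal ?_
  rw [mul_pow, ← Real.rpow_natCast ((1 + ‖v‖ ^ 2) ^ (-p / 2)), ← Real.rpow_mul hx.le]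
  have e : (1 + ‖v‖ ^ 2) ^ (-(2 * (p - 1)) / 2) = (1 + ‖v‖ ^ 2) * (1 + ‖v‖ ^ 2) ^ (-p / 2 * (2 : ℕ)) := by
    rw [← Real.rpow_one_add' hx.le]
    · congr 1
      push_cast
      ring
    · push_cast
      have : (0 : ℝ) ≤ d := by positivity
      intro h
      linarith
  change _ ≤ 2 * (1 + ‖v‖ ^ 2) ^ (-(2 * (p - 1)) / 2)
  rw [e, ← mul_assoc]
  gcongr
  nlinarith [sq_nonneg (1 - ‖v‖)]

theorem modeL1_sq_le (p : ℝ) {F : Torus d × Vel d → ℝ} (hF : MemLp F 2) (n : Fin d → ℤ) :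
    modeL1 n F ^ 2 ≤ velConst d p * ∫⁻ v, velWeight p v * ‖modeV n F v‖ₑ ^ 2 := by
  have hm := (aestronglyMeasurable_modeV hF n).enorm
  have h1 : modeL1 n F = ∫⁻ v, ENNReal.ofReal ((1 + ‖v‖) * (1 + ‖v‖ ^ 2) ^ (-p / 2)) *
      (velWeight (p / 2) v * ‖modeV n F v‖ₑ) := by
    refine lintegral_congr fun v => ?_
    have hx : 0 < 1 + ‖v‖ ^ 2 := by positivity
    unfold velWeight
    rw [← mul_assoc, ← ENNReal.ofReal_mul (by positivity), mul_assoc, ← Real.rpow_add hx]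
    rw [show -p / 2 + p / 2 = 0 by ring, Real.rpow_zero, mul_one]
  have h2 := lintegral_mul_le_sqrt volume (f := fun v : Vel d => ENNReal.ofReal ((1 + ‖v‖) * (1 + ‖v‖ ^ 2) ^ (-p / 2)))
    (g := fun v => velWeight (p / 2) v * ‖modeV n F v‖ₑ) (by fun_prop)
    ((measurable_velWeight _).aemeasurable.mul hm)
  rw [← h1] at h2
  calc modeL1 n F ^ 2 ≤ _ := pow_le_pow_left₀ bot_le h2 2
    _ = _ := by
      rw [mul_pow, ennreal_rpow_half_sq, ennreal_rpow_half_sq]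
      congr 1
      refine lintegral_congr fun v => ?_
      have hx : 0 < 1 + ‖v‖ ^ 2 := by positivity
      rw [mul_pow]
      congr 1
      unfold velWeight
      rw [← ENNReal.ofReal_pow (by positivity), ← Real.rpow_natCast, ← Real.rpow_mul hx.le]
      congr 2
      push_cast
      ring

theorem pow_norm_le_sum [Nonempty (Fin d)] (n : Fin d → ℤ) (a : ℕ) : ‖n‖ ^ a ≤ ∑ j, |(n j : ℝ)| ^ a := by
  obtain ⟨j, -, hj⟩ := Finset.exists_mem_eq_sup Finset.univ Finset.univ_nonempty (fun i => ‖n i‖₊)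
  have h1 : ‖n‖ = |(n j : ℝ)| := by
    rw [Pi.norm_def, hj, coe_nnnorm, Int.norm_eq_abs]
  rw [h1]
  exact Finset.single_le_sum (f := fun j => |(n j : ℝ)| ^ a) (fun i _ => by positivity) (Finset.mem_univ j)

/-- The constant in the Cauchy–Schwarz inequality for the sum over the frequencies, when `a` derivatives in
`x` are available. -/
def freqConst (d a : ℕ) : ℝ≥0∞ := ∑' n : Fin d → ℤ, ENNReal.ofReal ((1 + ‖n‖) / (1 + ‖n‖ ^ a)) ^ 2

theorem summable_norm_rpow_int {s : ℝ} (hs : s < -d) : Summable fun n : Fin d → ℤ => ‖n‖ ^ s := by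
  set L := Submodule.span ℤ (Set.range (Pi.basisFun ℝ (Fin d))) with hL
  have hrank : Module.finrank ℤ L = d := by
    rw [ZLattice.rank ℝ L]
    simp
  have hsum := ZLattice.summable_norm_rpow L s (by rw [hrank]; exact hs)
  have hmem : ∀ n : Fin d → ℤ, (fun i => (n i : ℝ)) ∈ L := by
    intro n
    have : (fun i => (n i : ℝ)) = ∑ i, n i • Pi.basisFun ℝ (Fin d) i := by
      ext j
      simp [Finset.sum_apply, Pi.single_apply]
    rw [this]
    exact Submodule.sum_mem _ fun i _ => Submodule.smul_mem _ _ (Submodule.subset_span ⟨i, rfl⟩)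
  have hinj : Function.Injective fun n : Fin d → ℤ => (⟨fun i => (n i : ℝ), hmem n⟩ : L) := by
    intro n n' h
    ext i
    have : (n i : ℝ) = n' i := congrFun (congrArg Subtype.val h) i
    exact_mod_cast this
  have := hsum.comp_injective hinj
  refine this.congr fun n => ?_
  simp only [Function.comp_def]
  congr 1

theorem freqConst_ne_top {a : ℕ} (ha : (d : ℝ) + 2 < 2 * a) : freqConst d a ≠ ⊤ := by
  have h1 : Summable fun n : Fin d → ℤ => ‖n‖ ^ (2 - 2 * a : ℝ) :=
    summable_norm_rpow_int (by linarith)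
  have h2 : Summable fun n : Fin d → ℤ => 4 * ‖n‖ ^ (2 - 2 * a : ℝ) + Pi.single (M := fun _ => ℝ) (0 : Fin d → ℤ) 1 n :=
    (h1.mul_left 4).add (summable_of_hasFiniteSupport ((Set.finite_singleton (0 : Fin d → ℤ)).subset
      Pi.support_single_subset))
  refine ne_top_of_le_ne_top h2.tsum_ofReal_ne_top (ENNReal.tsum_le_tsum fun n => ?_)
  rw [← ENNReal.ofReal_pow (by positivity)]
  refine ENNReal.ofReal_le_ofReal ?_
  have hd0 : (0 : ℝ) ≤ d := by positivity
  have ha0 : a ≠ 0 := by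
    rintro rfl
    norm_num at ha
    linarith
  by_cases hn : n = 0
  · subst hn
    rw [norm_zero, Real.zero_rpow (by intro h; linarith)]
    simp [ha0]
  · have hn1 : 1 ≤ ‖n‖ := by
      obtain ⟨j, hj⟩ := Function.ne_iff.mp hn
      refine le_trans ?_ (norm_le_pi_norm n j)
      rw [Int.norm_eq_abs]
      exact_mod_cast Int.one_le_abs hj
    rw [Pi.single_eq_of_ne hn, add_zero]
    have hx : 0 < ‖n‖ := by linarith
    have e : ‖n‖ ^ (2 - 2 * a : ℝ) = (‖n‖ / ‖n‖ ^ a) ^ 2 := by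
      rw [Real.rpow_sub hx, div_pow, ← pow_mul, ← Real.rpow_natCast ‖n‖ (a * 2)]
      congr 1
      · exact_mod_cast Real.rpow_natCast ‖n‖ 2
      · congr 1
        push_cast
        ring
    rw [e, show (4 : ℝ) * (‖n‖ / ‖n‖ ^ a) ^ 2 = (2 * ‖n‖ / ‖n‖ ^ a) ^ 2 by ring]
    gcongr
    · linarith
    · linarith [pow_pos hx a]

/-- Summation of the modes: the `a`-th derivatives `F j` of `F₀` in the directions `x_j` are traded for the
decay in `n`. -/
theorem tsum_modeL1_le [Nonempty (Fin d)] (p : ℝ) (a : ℕ) {F₀ : Torus d × Vel d → ℝ}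
    {F : Fin d → Torus d × Vel d → ℝ} (hF₀ : MemLp F₀ 2) (hF : ∀ j, MemLp (F j) 2)
    (hmode : ∀ j n, ∀ᵐ v, modeV n (F j) v = (Complex.I * (n j : ℂ)) ^ a * modeV n F₀ v)
    {N : ℝ≥0∞} (hN₀ : ∫⁻ z, velWeight p z.2 * ‖F₀ z‖ₑ ^ 2 ≤ N ^ 2)
    (hN : ∀ j, ∫⁻ z, velWeight p z.2 * ‖F j z‖ₑ ^ 2 ≤ N ^ 2) :
    (∑' n, ENNReal.ofReal (1 + ‖n‖) * modeL1 n F₀) ^ 2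
      ≤ freqConst d a * (velConst d p * (2 * ((d + 1) * N ^ 2))) := by
  have h2π : 1 ≤ ENNReal.ofReal ((2 * π) ^ d) := by
    rw [ENNReal.one_le_ofReal]
    exact one_le_pow₀ (by linarith [Real.pi_gt_three])
  have hsum : ∀ G : Torus d × Vel d → ℝ, MemLp G 2 → ∫⁻ z, velWeight p z.2 * ‖G z‖ₑ ^ 2 ≤ N ^ 2 →
      ∑' n, ∫⁻ v, velWeight p v * ‖modeV n G v‖ₑ ^ 2 ≤ N ^ 2 := by
    intro G hG hGN
    rw [lintegral_mul_enorm_sq_eq_tsum_modeV hG (measurable_velWeight p)] at hGN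
    exact (le_mul_of_one_le_left (by simp) h2π).trans hGN
  -- the Cauchy–Schwarz inequality in `n`, with the weight `1 + 
  -- n
  -- ^a`
  have hCS : (∑' n, ENNReal.ofReal (1 + ‖n‖) * modeL1 n F₀) ^ 2
      ≤ freqConst d a * ∑' n : Fin d → ℤ, (ENNReal.ofReal (1 + ‖n‖ ^ a) * modeL1 n F₀) ^ 2 := by
    have h1 := lintegral_mul_le_sqrt (Measure.count : Measure (Fin d → ℤ))
      (f := fun n => ENNReal.ofReal ((1 + ‖n‖) / (1 + ‖n‖ ^ a)))
      (g := fun n => ENNReal.ofReal (1 + ‖n‖ ^ a) * modeL1 n F₀) (by fun_prop)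
      (measurable_of_countable _).aemeasurable
    simp only [lintegral_count] at h1
    have h2 : ∀ n : Fin d → ℤ, ENNReal.ofReal ((1 + ‖n‖) / (1 + ‖n‖ ^ a)) * (ENNReal.ofReal (1 + ‖n‖ ^ a) * modeL1 n F₀)
        = ENNReal.ofReal (1 + ‖n‖) * modeL1 n F₀ := by
      intro n
      have : 0 < 1 + ‖n‖ ^ a := by positivity
      rw [← mul_assoc, ← ENNReal.ofReal_mul (by positivity), div_mul_cancel₀ _ this.ne']
    simp only [h2] at h1
    calc _ ≤ _ := pow_le_pow_left₀ bot_le h1 2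
      _ = _ := by rw [mul_pow, ennreal_rpow_half_sq, ennreal_rpow_half_sq]; rfl
  refine hCS.trans ?_
  gcongr
  have hn : ∀ n : Fin d → ℤ, (ENNReal.ofReal (1 + ‖n‖ ^ a) * modeL1 n F₀) ^ 2
      ≤ velConst d p * (2 * ((∫⁻ v, velWeight p v * ‖modeV n F₀ v‖ₑ ^ 2)
        + ∑ j, ∫⁻ v, velWeight p v * ‖modeV n (F j) v‖ₑ ^ 2)) := by
    intro n
    set X := ∫⁻ v, velWeight p v * ‖modeV n F₀ v‖ₑ ^ 2 with hX
    have e : ∀ j, ∫⁻ v, velWeight p v * ‖modeV n (F j) v‖ₑ ^ 2 = ENNReal.ofReal (|(n j : ℝ)| ^ (2 * a)) * X := by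
      intro j
      rw [hX, ← lintegral_const_mul' _ _ ENNReal.ofReal_ne_top]
      refine lintegral_congr_ae ?_
      filter_upwards [hmode j n] with v hv
      rw [hv, enorm_mul, mul_pow, mul_left_comm]
      congr 1
      rw [← ofReal_norm, norm_pow, norm_mul, Complex.norm_I, one_mul, Complex.norm_intCast,
        ← ENNReal.ofReal_pow (by positivity), ← pow_mul, mul_comm a 2]
    simp only [e]
    rw [← Finset.sum_mul, ← ENNReal.ofReal_sum_of_nonneg (fun j _ => by positivity), mul_pow]
    have h3 : ENNReal.ofReal (1 + ‖n‖ ^ a) ^ 2 ≤ 2 * (1 + ENNReal.ofReal (∑ j, |(n j : ℝ)| ^ (2 * a))) := by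
      rw [← ENNReal.ofReal_pow (by positivity), ← ENNReal.ofReal_one, ← ENNReal.ofReal_add (by positivity) (by positivity),
        show (2 : ℝ≥0∞) = ENNReal.ofReal 2 by simp, ← ENNReal.ofReal_mul (by norm_num)]
      refine ENNReal.ofReal_le_ofReal ?_
      have := pow_norm_le_sum n (2 * a)
      have h4 : ‖n‖ ^ (2 * a) = (‖n‖ ^ a) ^ 2 := by rw [mul_comm, pow_mul]
      rw [h4] at this
      nlinarith [sq_nonneg (1 - ‖n‖ ^ a)]
    calc _ ≤ (2 * (1 + ENNReal.ofReal (∑ j, |(n j : ℝ)| ^ (2 * a)))) * (velConst d p * X) := by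
          gcongr
          exact modeL1_sq_le p hF₀ n
      _ = _ := by ring
  refine (ENNReal.tsum_le_tsum hn).trans ?_
  rw [ENNReal.tsum_mul_left, ENNReal.tsum_mul_left, ENNReal.tsum_add]
  gcongr
  rw [Summable.tsum_finsetSum fun j _ => ENNReal.summable]
  calc _ ≤ N ^ 2 + ∑ j : Fin d, N ^ 2 := by
        gcongr with j
        · exact hsum F₀ hF₀ hN₀
        · exact hsum (F j) (hF j) (hN j)
    _ = _ := by
      simp
      ring

/-! ### Profiles in the weighted Sobolev space -/

theorem MemH.isWeakDeriv {k : ℕ} {p : ℝ} {f : Torus d × Vel d → ℝ} (hf : MemH k p f) {α β : Fin d → ℕ}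
    (h : ∑ i, α i + ∑ i, β i ≤ k) : IsWeakDeriv α β f (weakDeriv α β f) :=
  weakDeriv_spec (hf α β h).1

theorem MemH.lintegral_weakDeriv_le {k : ℕ} {p : ℝ} {f : Torus d × Vel d → ℝ} (hf : MemH k p f)
    {α β : Fin d → ℕ} (h : ∑ i, α i + ∑ i, β i ≤ k) :
    ∫⁻ z, velWeight p z.2 * ‖weakDeriv α β f z‖ₑ ^ 2 ≤ ENNReal.ofReal (normH k p f) ^ 2 := by
  have h0 : ∀ q : (Fin d → ℕ) × (Fin d → ℕ),
      0 ≤ ∫ z : Torus d × Vel d, (1 + ‖z.2‖ ^ 2) ^ p * weakDeriv q.1 q.2 f z ^ 2 :=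
    fun q => integral_nonneg fun z => by positivity
  have hmem : (α, β) ∈ multiIndices d k := by
    unfold multiIndices
    simp only [Finset.mem_filter, Finset.mem_product, Fintype.mem_piFinset, Finset.mem_range]
    refine ⟨⟨fun i => ?_, fun i => ?_⟩, h⟩
    · have := Finset.single_le_sum (f := α) (fun i _ => Nat.zero_le _) (Finset.mem_univ i)
      omega
    · have := Finset.single_le_sum (f := β) (fun i _ => Nat.zero_le _) (Finset.mem_univ i)
      omega
  have h1 : ∫ z : Torus d × Vel d, (1 + ‖z.2‖ ^ 2) ^ p * weakDeriv α β f z ^ 2 ≤ normH k p f ^ 2 := by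
    unfold normH
    rw [Real.sq_sqrt (Finset.sum_nonneg fun q _ => h0 q)]
    exact Finset.single_le_sum (f := fun q : (Fin d → ℕ) × (Fin d → ℕ) =>
      ∫ z : Torus d × Vel d, (1 + ‖z.2‖ ^ 2) ^ p * weakDeriv q.1 q.2 f z ^ 2) (fun q _ => h0 q) hmem
  have hN : 0 ≤ normH k p f := Real.sqrt_nonneg _
  rw [← ENNReal.ofReal_pow hN]
  refine le_trans (le_of_eq ?_) (ENNReal.ofReal_le_ofReal h1)
  rw [ofReal_integral_eq_lintegral_ofReal (hf α β h).2 (.of_forall fun z => by positivity)]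
  refine lintegral_congr fun z => ?_
  unfold velWeight
  rw [ENNReal.ofReal_mul (by positivity), ← ofReal_norm, Real.norm_eq_abs, ← ENNReal.ofReal_pow (abs_nonneg _), sq_abs]

theorem MemH.memLp_weakDeriv {k : ℕ} {p : ℝ} (hp : 0 ≤ p) {f : Torus d × Vel d → ℝ} (hf : MemH k p f)
    {α β : Fin d → ℕ} (h : ∑ i, α i + ∑ i, β i ≤ k) : MemLp (weakDeriv α β f) 2 :=
  memLp_two_of_velWeight hp (hf.isWeakDeriv h).locInt_right.aestronglyMeasurable
    (ne_top_of_le_ne_top (by finiteness) (hf.lintegral_weakDeriv_le h))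

theorem integrable_of_modeL1 {F : Torus d × Vel d → ℝ} (hF : MemLp F 2) {n : Fin d → ℤ} (h : modeL1 n F ≠ ⊤) :
    Integrable (modeV n F) ∧ Integrable (fun v => ‖v‖ * ‖modeV n F v‖) ∧
      ∫ v, ‖modeV n F v‖ ≤ (modeL1 n F).toReal ∧ ∫ v, ‖v‖ * ‖modeV n F v‖ ≤ (modeL1 n F).toReal := by
  have hm := aestronglyMeasurable_modeV hF n
  have h1 : Integrable fun v => (1 + ‖v‖) * ‖modeV n F v‖ := by
    refine ⟨(Continuous.aestronglyMeasurable (by fun_prop)).mul hm.norm, ?_⟩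
    unfold HasFiniteIntegral
    refine lt_of_eq_of_lt (lintegral_congr fun v => ?_) h.lt_top
    rw [enorm_mul, Real.enorm_of_nonneg (by positivity), enorm_norm]
  have h2 : ∫ v, (1 + ‖v‖) * ‖modeV n F v‖ = (modeL1 n F).toReal := by
    rw [integral_eq_lintegral_of_nonneg_ae (.of_forall fun v => by positivity) h1.1]
    congr 1
    refine lintegral_congr fun v => ?_
    rw [ENNReal.ofReal_mul (by positivity), ofReal_norm]
  have h3 : Integrable (modeV n F) := by
    refine h1.mono hm (.of_forall fun v => ?_)
    rw [Real.norm_of_nonneg (by positivity)]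
    nlinarith [norm_nonneg v, norm_nonneg (modeV n F v), mul_nonneg (norm_nonneg v) (norm_nonneg (modeV n F v))]
  have h4 : Integrable (fun v => ‖v‖ * ‖modeV n F v‖) := by
    refine h1.mono (continuous_norm.aestronglyMeasurable.mul hm.norm) (.of_forall fun v => ?_)
    rw [Real.norm_of_nonneg (by positivity), Real.norm_of_nonneg (by positivity)]
    nlinarith [norm_nonneg (modeV n F v)]
  refine ⟨h3, h4, ?_, ?_⟩
  · rw [← h2]
    refine integral_mono h3.norm h1 fun v => ?_
    have := mul_nonneg (norm_nonneg v) (norm_nonneg (modeV n F v))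
    dsimp only
    linarith
  · rw [← h2]
    refine integral_mono h4 h1 fun v => ?_
    have := norm_nonneg (modeV n F v)
    dsimp only
    linarith

/-- A field `G(x, v)` whose modes in `x` are gradients in `v`: the Fourier transform of the `n`-th
mode of `G` is `i ξ φ_n(ξ)`. The bounds `decay` and `lip` are those of the symbol of the integral operator:
its integrability in the time lag and its Lipschitz continuity in the frequency. -/
structure ProfileModes (G : Torus d × Vel d → Fin d → ℝ) (φ : (Fin d → ℤ) → Vel d → ℂ)
    (A : (Fin d → ℤ) → ℝ) : Prop where
  memLp : ∀ j, MemLp (fun z => G z j) 2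
  nonneg : ∀ n, 0 ≤ A n
  summable : Summable fun n => (1 + ‖n‖) * A n
  modeL1_le : ∀ j n, modeL1 n (fun z => G z j) ≤ ENNReal.ofReal (A n)
  continuous : ∀ n, Continuous (φ n)
  fourier : ∀ j n ξ, velFourier (modeV n fun z => G z j) ξ = Complex.I * (ξ j : ℂ) * φ n ξ
  decay : ∀ n ξ, ‖ξ‖ * ‖φ n ξ‖ * (1 + ‖ξ‖ ^ 2) ≤ A n
  lip : ∀ n ξ ξ', ‖((‖ξ‖ ^ 2 : ℝ) : ℂ) * φ n ξ - ((‖ξ'‖ ^ 2 : ℝ) : ℂ) * φ n ξ'‖ ≤ A n * ‖ξ - ξ'‖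

theorem norm_le_sum_abs (ξ : Vel d) : ‖ξ‖ ≤ ∑ i, |ξ i| := by
  have h : ξ = ∑ i, ξ i • EuclideanSpace.single i (1 : ℝ) := by
    ext j
    simp [Finset.sum_apply, Pi.single_apply]
  conv_lhs => rw [h]
  refine (norm_sum_le _ _).trans (Finset.sum_le_sum fun i _ => ?_)
  rw [norm_smul, PiLp.norm_single]
  simp

theorem norm_pow_three_le (hd : 1 ≤ d) (ξ : Vel d) : ‖ξ‖ ^ 3 ≤ (d : ℝ) ^ 2 * ∑ i, |ξ i| ^ 3 := by
  have h1 := pow_sum_div_card_le_sum_pow (s := Finset.univ) (f := fun i => |ξ i|) (fun i _ => abs_nonneg _) 2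
  have hd' : (0 : ℝ) < (d : ℝ) ^ 2 := by positivity
  rw [Finset.card_univ, Fintype.card_fin, div_le_iff₀ hd', mul_comm] at h1
  exact (pow_le_pow_left₀ (norm_nonneg _) (norm_le_sum_abs ξ) 3).trans h1

/-- The modes of a profile in the weighted Sobolev space are summable, with the norm of the profile
as a bound. -/
theorem exists_profileModes (m : ℕ) (r : ℝ) (hd : 1 ≤ d) (hm : 4 + (d : ℝ) / 2 < 2 * (m : ℝ))
    (hr : 2 + (d : ℝ) / 2 < 2 * r) :
    ∃ C : ℝ, 0 ≤ C ∧ ∀ f : Torus d × Vel d → ℝ, MemH (2 * m) (2 * r) f →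
      ∃ (φ : (Fin d → ℤ) → Vel d → ℂ) (A : (Fin d → ℤ) → ℝ), ProfileModes (gradV f) φ A ∧
        ∑' n, (1 + ‖n‖) * A n ≤ C * normH (2 * m) (2 * r) f := by
  have : Nonempty (Fin d) := ⟨⟨0, hd⟩⟩
  have hd0 : (1 : ℝ) ≤ d := by exact_mod_cast hd
  have hm3 : 3 ≤ m := by
    have : (2 : ℝ) < m := by linarith
    exact_mod_cast this
  -- three derivatives are spent in velocity, the others in space
  obtain ⟨a, ha⟩ : ∃ a, 2 * m = a + 3 := ⟨2 * m - 3, by omega⟩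
  have haR : 2 * (m : ℝ) = a + 3 := by exact_mod_cast ha
  have hK : freqConst d a * (velConst d (2 * r) * (2 * (d + 1))) ≠ ⊤ :=
    ENNReal.mul_ne_top (freqConst_ne_top (by linarith)) (ENNReal.mul_ne_top (velConst_ne_top (by linarith)) (by finiteness))
  set K : ℝ≥0∞ := (freqConst d a * (velConst d (2 * r) * (2 * (d + 1)))) ^ (1 / 2 : ℝ) with hKdef
  have hKtop : K ≠ ⊤ := ENNReal.rpow_ne_top_of_nonneg (by norm_num) hK
  refine ⟨(1 + (d : ℝ) ^ 2) * (d * (4 * K.toReal)), by positivity, fun f hf => ?_⟩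
  have hp : 0 ≤ 2 * r := by linarith
  set N := normH (2 * m) (2 * r) f with hN
  have hN0 : 0 ≤ N := Real.sqrt_nonneg _
  -- the pure velocity derivatives of order `q ≤ 3`
  set F : ℕ → Fin d → Torus d × Vel d → ℝ := fun q i => weakDeriv 0 (Pi.single i q) f with hF
  have ord : ∀ q, q < 4 → ∀ i : Fin d, ∑ k, (0 : Fin d → ℕ) k + ∑ k, (Pi.single i q : Fin d → ℕ) k ≤ 2 * m := by
    intro q hq i
    rw [sum_single_nat]
    simp
    omega
  have ord' : ∀ q, q < 4 → ∀ i j : Fin d,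
      ∑ k, (Pi.single j a : Fin d → ℕ) k + ∑ k, (Pi.single i q : Fin d → ℕ) k ≤ 2 * m := by
    intro q hq i j
    rw [sum_single_nat, sum_single_nat]
    omega
  have hFm : ∀ q, q < 4 → ∀ i, MemLp (F q i) 2 := fun q hq i => hf.memLp_weakDeriv hp (ord q hq i)
  -- each of them has `a` further derivatives in `x`, which make its modes summable
  have hsum : ∀ q, q < 4 → ∀ i, ∑' n, ENNReal.ofReal (1 + ‖n‖) * modeL1 n (F q i) ≤ K * ENNReal.ofReal N := by
    intro q hq i
    have hGm : ∀ j, MemLp (weakDeriv (Pi.single j a) (Pi.single i q) f) 2 := fun j =>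
      hf.memLp_weakDeriv hp (ord' q hq i j)
    have hmode : ∀ j n, ∀ᵐ v, modeV n (weakDeriv (Pi.single j a) (Pi.single i q) f) v
        = (Complex.I * (n j : ℂ)) ^ a * modeV n (F q i) v := by
      intro j n
      have hl : ∀ {H : Torus d × Vel d → ℝ}, MemLp H 2 → LocallyIntegrable (modeV n H) := by
        intro H hH
        have h2 : MemLp (modeV n H) 2 := by
          refine ⟨aestronglyMeasurable_modeV hH n, (eLpNorm_lt_top_iff_lintegral_rpow_enorm_lt_top (by simp) (by simp)).mpr ?_⟩
          have h3 := lintegral_mul_enorm_sq_eq_tsum_modeV hH (w := fun _ => 1) measurable_const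
          simp only [one_mul] at h3
          have h4 : ∫⁻ z, ‖H z‖ₑ ^ 2 ≠ ⊤ := by
            have := (eLpNorm_lt_top_iff_lintegral_rpow_enorm_lt_top (by simp) (by simp)).mp hH.2
            simpa using this.ne
          rw [h3] at h4
          have h5 : ∑' n, ∫⁻ v, ‖modeV n H v‖ₑ ^ 2 ≠ ⊤ := by
            intro h6
            rw [h6, ENNReal.mul_top (ENNReal.ofReal_pos.mpr (by positivity)).ne'] at h4
            exact h4 rfl
          simpa using (ENNReal.ne_top_of_tsum_ne_top h5 n).lt_top
        exact h2.locallyIntegrable (by norm_num)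
      refine ae_eq_of_integral_contDiff_smul_eq (hl (hGm j)) (((hl (hFm q hq i)).smul ((Complex.I * (n j : ℂ)) ^ a)) :) fun g hg hgc => ?_
      have h1 := integral_modeV_mul_of_isWeakDeriv (hf.isWeakDeriv (ord' q hq i j)) (hf.isWeakDeriv (ord q hq i))
        (hGm j) (hFm q hq i) n (g := fun v => (g v : ℂ)) (Complex.ofRealCLM.contDiff.comp hg)
        (hgc.comp_left (g := Complex.ofReal) (by simp))
      simp only [Complex.real_smul]
      simp only [mul_comm (g _ : ℂ)]
      rw [h1, ← integral_const_mul]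
      simp only [mul_assoc]
      rfl
    have h1 := tsum_modeL1_le (2 * r) a (hFm q hq i) hGm hmode (N := ENNReal.ofReal N)
      (hf.lintegral_weakDeriv_le (ord q hq i)) (fun j => hf.lintegral_weakDeriv_le (ord' q hq i j))
    rw [← ennreal_sq_le_sq_iff]
    refine h1.trans_eq ?_
    rw [mul_pow, hKdef, ennreal_rpow_half_sq]
    ring
  have hfin : ∀ q, q < 4 → ∀ i n, modeL1 n (F q i) ≠ ⊤ := by
    intro q hq i n h
    have h1 := ne_top_of_le_ne_top (ENNReal.mul_ne_top hKtop ENNReal.ofReal_ne_top) (hsum q hq i)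
    have h2 := ENNReal.ne_top_of_tsum_ne_top h1 n
    rw [h, ENNReal.mul_top (ENNReal.ofReal_pos.mpr (by positivity)).ne'] at h2
    exact h2 rfl
  set M : ℕ → Fin d → (Fin d → ℤ) → ℝ := fun q i n => (modeL1 n (F q i)).toReal with hM
  have hM0 : ∀ q i n, 0 ≤ M q i n := fun q i n => ENNReal.toReal_nonneg
  have hMsum : ∀ q, q < 4 → ∀ i, Summable (fun n => (1 + ‖n‖) * M q i n) ∧
      ∑' n, (1 + ‖n‖) * M q i n ≤ K.toReal * N := by
    intro q hq i
    have h1 := ne_top_of_le_ne_top (ENNReal.mul_ne_top hKtop ENNReal.ofReal_ne_top) (hsum q hq i)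
    have h2 : ∀ n : Fin d → ℤ, (1 + ‖n‖) * M q i n = (ENNReal.ofReal (1 + ‖n‖) * modeL1 n (F q i)).toReal := by
      intro n
      rw [ENNReal.toReal_mul, ENNReal.toReal_ofReal (by positivity)]
    simp only [h2]
    refine ⟨ENNReal.summable_toReal h1, ?_⟩
    rw [← ENNReal.tsum_toReal_eq fun n => ENNReal.ne_top_of_tsum_ne_top h1 n]
    refine (ENNReal.toReal_mono (ENNReal.mul_ne_top hKtop ENNReal.ofReal_ne_top) (hsum q hq i)).trans_eq ?_
    rw [ENNReal.toReal_mul, ENNReal.toReal_ofReal hN0]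
  -- the potential `φ n` is the Fourier transform in `v` of the `n`-th mode of the profile itself
  set φ : (Fin d → ℤ) → Vel d → ℂ := fun n => velFourier (modeV n (weakDeriv 0 0 f)) with hφ
  set A : (Fin d → ℤ) → ℝ := fun n => (1 + (d : ℝ) ^ 2) * ∑ i, ∑ q ∈ Finset.range 4, M q i n with hA
  have hint := fun q hq i n => integrable_of_modeL1 (hFm q hq i) (hfin q hq i n)
  have hF0 : ∀ i, F 0 i = weakDeriv 0 0 f := fun i => by simp [hF]
  -- each velocity derivative multiplies the Fourier transform by `i ξ_i`
  have hfour : ∀ q, q < 4 → ∀ i n ξ, velFourier (modeV n (F q i)) ξ = (Complex.I * (ξ i : ℂ)) ^ q * φ n ξ := by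
    intro q
    induction q with
    | zero =>
      intro _ i n ξ
      rw [pow_zero, one_mul, hF0]
    | succ q ih =>
      intro hq i n ξ
      have hq' : q < 4 := by omega
      rw [velFourier_of_weak (hint q hq' i n).1 (hint (q + 1) hq i n).1 i (fun g hg hgc =>
        integral_modeV_succ (hf.isWeakDeriv (ord q hq' i)) (hf.isWeakDeriv (ord (q + 1) hq i))
          (hFm q hq' i) (hFm (q + 1) hq i) n hg hgc), ih hq', pow_succ]
      ring
  have hfle : ∀ q, q < 4 → ∀ i n ξ, |ξ i| ^ q * ‖φ n ξ‖ ≤ M q i n := by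
    intro q hq i n ξ
    have h1 := (norm_velFourier_le (modeV n (F q i)) ξ).trans (hint q hq i n).2.2.1
    rw [hfour q hq, norm_mul, norm_pow, norm_mul, Complex.norm_I, one_mul, Complex.norm_real, Real.norm_eq_abs] at h1
    exact h1
  have hMA : ∀ n, ∑ i, ∑ q ∈ Finset.range 4, M q i n ≤ A n := fun n => by
    have h0 : 0 ≤ ∑ i, ∑ q ∈ Finset.range 4, M q i n :=
      Finset.sum_nonneg fun i _ => Finset.sum_nonneg fun q _ => hM0 q i n
    exact le_mul_of_one_le_left h0 (by nlinarith)
  have hMq : ∀ q, q < 4 → ∀ n, ∑ i, M q i n ≤ ∑ i, ∑ q ∈ Finset.range 4, M q i n := fun q hq n =>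
    Finset.sum_le_sum fun i _ => Finset.single_le_sum (f := fun q => M q i n) (fun q _ => hM0 q i n)
      (Finset.mem_range.mpr hq)
  have hAs : ∀ n : Fin d → ℤ, (1 + ‖n‖) * A n
      = (1 + (d : ℝ) ^ 2) * ∑ i, ∑ q ∈ Finset.range 4, (1 + ‖n‖) * M q i n := by
    intro n
    simp only [hA, ← Finset.mul_sum]
    ring
  have hAsum : Summable fun n => ∑ i, ∑ q ∈ Finset.range 4, (1 + ‖n‖) * M q i n :=
    summable_sum fun i _ => summable_sum fun q hq => (hMsum q (Finset.mem_range.mp hq) i).1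
  refine ⟨φ, A, ⟨?_, ?_, ?_, ?_, ?_, ?_, ?_, ?_⟩, ?_⟩
  · exact fun j => hFm 1 (by norm_num) j
  · exact fun n => mul_nonneg (by positivity) (Finset.sum_nonneg fun i _ => Finset.sum_nonneg fun q _ => hM0 q i n)
  · simp only [hAs]
    exact hAsum.mul_left _
  · intro j n
    refine ENNReal.le_ofReal_iff_toReal_le (hfin 1 (by norm_num) j n) ?_ |>.mpr ?_
    · exact mul_nonneg (by positivity) (Finset.sum_nonneg fun i _ => Finset.sum_nonneg fun q _ => hM0 q i n)
    · exact (Finset.single_le_sum (f := fun i => M 1 i n) (fun i _ => hM0 1 i n) (Finset.mem_univ j)).trans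
        ((hMq 1 (by norm_num) n).trans (hMA n))
  · intro n
    have := (hint 0 (by norm_num) (Classical.arbitrary (Fin d)) n).1
    rw [hF0] at this
    exact continuous_velFourier this
  · intro j n ξ
    have := hfour 1 (by norm_num) j n ξ
    rwa [pow_one] at this
  · intro n ξ
    have h1 : ‖ξ‖ * ‖φ n ξ‖ ≤ ∑ i, ∑ q ∈ Finset.range 4, M q i n := by
      refine le_trans ?_ (hMq 1 (by norm_num) n)
      refine (mul_le_mul_of_nonneg_right (norm_le_sum_abs ξ) (norm_nonneg _)).trans ?_
      rw [Finset.sum_mul]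
      refine Finset.sum_le_sum fun i _ => ?_
      have := hfle 1 (by norm_num) i n ξ
      rwa [pow_one] at this
    have h2 : ‖ξ‖ ^ 3 * ‖φ n ξ‖ ≤ (d : ℝ) ^ 2 * ∑ i, ∑ q ∈ Finset.range 4, M q i n := by
      refine le_trans ?_ (mul_le_mul_of_nonneg_left (hMq 3 (by norm_num) n) (by positivity))
      refine (mul_le_mul_of_nonneg_right (norm_pow_three_le hd ξ) (norm_nonneg _)).trans ?_
      rw [mul_assoc, Finset.sum_mul]
      gcongr with i
      exact hfle 3 (by norm_num) i n ξ
    calc _ = ‖ξ‖ * ‖φ n ξ‖ + ‖ξ‖ ^ 3 * ‖φ n ξ‖ := by ring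
      _ ≤ _ := add_le_add h1 h2
      _ = _ := by simp only [hA]; ring
  · intro n ξ ξ'
    -- `
    -- ξ
    -- ² φ_n` is minus the transform of the Laplacian, Lipschitz because of the first moment in `v`
    have h1 : ∀ ξ : Vel d, ((‖ξ‖ ^ 2 : ℝ) : ℂ) * φ n ξ = -∑ i, velFourier (modeV n (F 2 i)) ξ := by
      intro ξ
      simp only [hfour 2 (by norm_num)]
      rw [EuclideanSpace.norm_sq_eq, ← Finset.sum_mul, ← neg_mul, ← Finset.sum_neg_distrib]
      push_cast
      congr 1
      refine Finset.sum_congr rfl fun i _ => ?_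
      rw [mul_pow, Complex.I_sq, Real.norm_eq_abs, ← Complex.ofReal_pow, sq_abs]
      push_cast
      ring
    rw [h1, h1, neg_sub_neg, ← Finset.sum_sub_distrib]
    refine (norm_sum_le _ _).trans ?_
    refine le_trans (b := ∑ i, ‖ξ - ξ'‖ * M 2 i n) (Finset.sum_le_sum fun i _ => ?_) ?_
    · rw [norm_sub_rev]
      refine (norm_velFourier_sub_le (hint 2 (by norm_num) i n).1 (hint 2 (by norm_num) i n).2.1 ξ ξ').trans ?_
      gcongr
      exact (hint 2 (by norm_num) i n).2.2.2
    · rw [← Finset.mul_sum, mul_comm]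
      gcongr
      exact (hMq 2 (by norm_num) n).trans (hMA n)
  · simp only [hAs]
    rw [tsum_mul_left, mul_assoc]
    gcongr
    rw [Summable.tsum_finsetSum fun i _ => summable_sum fun q hq => (hMsum q (Finset.mem_range.mp hq) i).1]
    calc _ ≤ ∑ i : Fin d, ∑ q ∈ Finset.range 4, K.toReal * N := by
          refine Finset.sum_le_sum fun i _ => ?_
          rw [Summable.tsum_finsetSum fun q hq => (hMsum q (Finset.mem_range.mp hq) i).1]
          exact Finset.sum_le_sum fun q hq => (hMsum q (Finset.mem_range.mp hq) i).2
      _ = _ := by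
        simp
        ring

/-! ### The Fourier series of a profile -/

/-- If the modes are summable in `L¹`, the function is the sum of its Fourier series in `x`, for
almost every `x` and then almost every `v`. -/
theorem ae_ae_eq_tsum_modeV {F : Torus d × Vel d → ℝ} (hF : MemLp F 2)
    (hs : ∑' n, ∫⁻ v, ‖modeV n F v‖ₑ ≠ ⊤) :
    ∀ᵐ y, ∀ᵐ v, (F (y, v) : ℂ) = ∑' n, tchar n y * modeV n F v := by
  have hm := fun n => aestronglyMeasurable_modeV hF n
  -- jointly measurable representatives, so that the quantifiers in `x` and `v` may be exchanged
  set g : (Fin d → ℤ) → Vel d → ℂ := fun n => (hm n).mk _ with hg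
  have hgm : ∀ n, Measurable (g n) := fun n => (hm n).stronglyMeasurable_mk.measurable
  have hgF : ∀ᵐ v, ∀ n, modeV n F v = g n v := ae_all_iff.mpr fun n => (hm n).ae_eq_mk
  have hF1 : AEStronglyMeasurable F ((volume : Measure (Torus d)).prod (volume : Measure (Vel d))) := hF.1
  set F' := hF1.mk F with hF'
  have hF'm : Measurable F' := hF1.stronglyMeasurable_mk.measurable
  have e1 : ∀ᵐ y, ∀ᵐ v, F (y, v) = F' (y, v) := Measure.ae_ae_of_ae_prod hF1.ae_eq_mk
  have e2 : ∀ᵐ v, ∀ᵐ y, F (y, v) = F' (y, v) := by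
    have : ∀ᵐ p ∂((volume : Measure (Vel d)).prod (volume : Measure (Torus d))), F p.swap = F' p.swap :=
      Measure.measurePreserving_swap.quasiMeasurePreserving.ae hF1.ae_eq_mk
    exact Measure.ae_ae_of_ae_prod this
  have hs' : ∀ᵐ v, ∑' n, ‖modeV n F v‖ₑ ≠ ⊤ := by
    rw [← lintegral_tsum fun n => (hm n).enorm] at hs
    filter_upwards [ae_lt_top' (AEMeasurable.tsum fun n => (hm n).enorm) hs] with v hv
    exact hv.ne
  have key : ∀ᵐ v, ∀ᵐ y, (F' (y, v) : ℂ) = ∑' n, tchar n y * g n v := by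
    filter_upwards [e2, hs', hgF, ae_memLp_slice hF] with v h1 h2 h3 h4
    have hsum : Summable fun n => ‖modeV n F v‖ := by simpa using ENNReal.summable_toReal h2
    have hb : ∀ y : Torus d, Summable fun n => tchar n y * modeV n F v := fun y => by
      refine Summable.of_norm ?_
      simpa using hsum
    have hcont : Continuous fun y : Torus d => ∑' n, tchar n y * modeV n F v := by
      refine continuous_tsum (fun n => (tchar n).continuous.mul continuous_const) hsum fun n y => ?_
      simp
    have hint : Integrable fun y : Torus d => ∑' n, tchar n y * modeV n F v :=
      hcont.integrable_of_hasCompactSupport (HasCompactSupport.of_compactSpace _)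
    have h5 := ae_eq_of_coef_eq (h4.integrable (by norm_num)) hint (fun k => by
      change modeV k F v = _
      have h6 : coef k (fun y : Torus d => ∑' n, tchar n y * modeV n F v)
          = ∑' n, coef k (fun y => modeV n F v * tchar n y) := by
        unfold coef
        rw [tsum_mul_left]
        congr 1
        rw [integral_tsum_of_summable_integral_norm]
        · refine integral_congr_ae (.of_forall fun y => ?_)
          dsimp only
          rw [← tsum_mul_left]
          refine tsum_congr fun n => ?_
          rw [mul_comm (tchar n y)]
        · exact fun n => integrable_tchar_mul ((torusSmooth_tchar n).integrable.const_mul _) _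
        · simp only [norm_mul, norm_tchar, one_mul, mul_one, integral_const, smul_eq_mul]
          exact hsum.mul_left _
      rw [h6]
      simp only [coef_const_mul, coef_tchar, mul_ite, mul_one, mul_zero, tsum_ite_eq])
    filter_upwards [h1, h5] with y h7 h8
    rw [← h7, h8]
    exact tsum_congr fun n => by rw [h3 n]
  have hmeas : MeasurableSet {p : Vel d × Torus d | (F' (p.2, p.1) : ℂ) = ∑' n, tchar n p.2 * g n p.1} := by
    refine measurableSet_eq_fun ?_ ?_
    · exact Complex.measurable_ofReal.comp (hF'm.comp measurable_swap)
    · exact Measurable.tsum fun n => ((tchar n).continuous.measurable.comp measurable_snd).mul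
        ((hgm n).comp measurable_fst)
  have key' := (Measure.ae_ae_comm (p := fun v y => (F' (y, v) : ℂ) = ∑' n, tchar n y * g n v) hmeas).mp key
  filter_upwards [key', e1] with y h1 h2
  filter_upwards [h1, h2, hgF] with v h3 h4 h5
  rw [h4, h3]
  exact tsum_congr fun n => by rw [h5 n]

theorem lintegral_modeV_le_modeL1 (n : Fin d → ℤ) (F : Torus d × Vel d → ℝ) :
    ∫⁻ v, ‖modeV n F v‖ₑ ≤ modeL1 n F := by
  refine lintegral_mono fun v => le_mul_of_one_le_left (by simp) ?_
  rw [ENNReal.one_le_ofReal]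
  linarith [norm_nonneg v]

namespace ProfileModes
variable {G : Torus d × Vel d → Fin d → ℝ} {φ : (Fin d → ℤ) → Vel d → ℂ} {A : (Fin d → ℤ) → ℝ}

theorem summable_A (hG : ProfileModes G φ A) : Summable A := by
  refine Summable.of_nonneg_of_le hG.nonneg (fun n => ?_) hG.summable
  have := mul_nonneg (norm_nonneg n) (hG.nonneg n)
  linarith

theorem modeL1_ne_top (hG : ProfileModes G φ A) (j : Fin d) (n : Fin d → ℤ) :
    modeL1 n (fun z => G z j) ≠ ⊤ := ne_top_of_le_ne_top ENNReal.ofReal_ne_top (hG.modeL1_le j n)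

theorem integrable_modeV (hG : ProfileModes G φ A) (j : Fin d) (n : Fin d → ℤ) :
    Integrable (modeV n fun z => G z j) := (integrable_of_modeL1 (hG.memLp j) (hG.modeL1_ne_top j n)).1

theorem integral_norm_modeV_le (hG : ProfileModes G φ A) (j : Fin d) (n : Fin d → ℤ) :
    ∫ v, ‖modeV n (fun z => G z j) v‖ ≤ A n :=
  (integrable_of_modeL1 (hG.memLp j) (hG.modeL1_ne_top j n)).2.2.1.trans
    (ENNReal.toReal_le_of_le_ofReal (hG.nonneg n) (hG.modeL1_le j n))

theorem tsum_lintegral_ne_top (hG : ProfileModes G φ A) (j : Fin d) :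
    ∑' n, ∫⁻ v, ‖modeV n (fun z => G z j) v‖ₑ ≠ ⊤ :=
  ne_top_of_le_ne_top hG.summable_A.tsum_ofReal_ne_top
    (ENNReal.tsum_le_tsum fun n => (lintegral_modeV_le_modeL1 n _).trans (hG.modeL1_le j n))

theorem norm_mul_norm_le (hG : ProfileModes G φ A) (n : Fin d → ℤ) (ξ : Vel d) : ‖ξ‖ * ‖φ n ξ‖ ≤ A n := by
  refine le_trans ?_ (hG.decay n ξ)
  exact le_mul_of_one_le_right (by positivity) (by nlinarith [sq_nonneg ‖ξ‖])

/-- The Fourier transform of almost every slice, as a Fourier series. -/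
theorem ae_fourierV_eq (hG : ProfileModes G φ A) :
    ∀ᵐ y, ∀ j ξ, fourierV (fun v => G (y, v) j) ξ = ∑' n, tchar n y * (Complex.I * (ξ j : ℂ) * φ n ξ) := by
  have := fun j => ae_ae_eq_tsum_modeV (hG.memLp j) (hG.tsum_lintegral_ne_top j)
  filter_upwards [ae_all_iff.mpr this] with y hy
  intro j ξ
  unfold fourierV
  have h1 : ∫ v : Vel d, Complex.exp (-Complex.I * ((inner ℝ ξ v : ℝ) : ℂ)) * (G (y, v) j : ℂ)
      = ∫ v : Vel d, ∑' n, Complex.exp (-Complex.I * ((inner ℝ ξ v : ℝ) : ℂ)) * (tchar n y * modeV n (fun z => G z j) v) := by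
    refine integral_congr_ae ?_
    filter_upwards [hy j] with v hv
    rw [hv, tsum_mul_left]
  rw [h1, ← integral_tsum_of_summable_integral_norm]
  · refine tsum_congr fun n => ?_
    rw [← hG.fourier j n ξ, velFourier, ← integral_const_mul]
    congr 1
    ext v
    ring
  · exact fun n => integrable_wave_mul ((hG.integrable_modeV j n).const_mul _) ξ
  · simp only [norm_mul, norm_cexp_neg_I_mul, norm_tchar, one_mul]
    exact Summable.of_nonneg_of_le (fun n => integral_nonneg fun v => norm_nonneg _)
      (hG.integral_norm_modeV_le j) hG.summable_A

end ProfileModes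

/-! ### The kernel in Fourier variables and the Penrose condition -/

/-- The kernel of the integral operator in Fourier variables: the mode `k` at time lag `s` is
mapped to the mode `k + n`. For `s > 0` it equals `(1 + ε²|k|²)⁻¹ i k · (i s k φ_n(s k))`, the first factor
`i k` being that of the gradient of the unknown. -/
def profileKernel (ε : ℝ) (φ : (Fin d → ℤ) → Vel d → ℂ) (n k : Fin d → ℤ) (s : ℝ) : ℂ :=
  (Ioi (0 : ℝ)).indicator (fun s => -((s * ‖intVec k‖ ^ 2 * (1 + ε ^ 2 * ‖intVec k‖ ^ 2)⁻¹ : ℝ) : ℂ) *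
    φ n (s • intVec k)) s

theorem abs_resolvent_sub_mul_le {ε x y l : ℝ} (hx : 0 ≤ x) (hy : 0 ≤ y) (hl : |x - y| ≤ l) :
    |(1 + ε ^ 2 * x ^ 2)⁻¹ - (1 + ε ^ 2 * y ^ 2)⁻¹| * y ≤ 2 * l := by
  have h1 : 0 < 1 + ε ^ 2 * x ^ 2 := by positivity
  have h2 : 0 < 1 + ε ^ 2 * y ^ 2 := by positivity
  have e : (1 + ε ^ 2 * x ^ 2)⁻¹ - (1 + ε ^ 2 * y ^ 2)⁻¹
      = -(x - y) * (ε ^ 2 * (x + y) / ((1 + ε ^ 2 * x ^ 2) * (1 + ε ^ 2 * y ^ 2))) := by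
    field_simp
    ring
  rw [e, abs_mul, abs_neg, abs_of_nonneg (by positivity : 0 ≤ ε ^ 2 * (x + y) / ((1 + ε ^ 2 * x ^ 2) * (1 + ε ^ 2 * y ^ 2))),
    mul_assoc, mul_comm (2 : ℝ)]
  refine mul_le_mul hl ?_ (by positivity) ((abs_nonneg _).trans hl)
  rw [div_mul_eq_mul_div, div_le_iff₀ (by positivity)]
  nlinarith [sq_nonneg (ε * x - ε * y), mul_nonneg (sq_nonneg (ε * x)) (sq_nonneg (ε * y)), sq_nonneg (ε * x), sq_nonneg (ε * y)]

theorem lintegral_mul_inv_one_add_sq_le {x : ℝ} (hx : 0 ≤ x) :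
    ∫⁻ s : ℝ, ENNReal.ofReal (x * (1 + (x * s) ^ 2)⁻¹) ≤ ENNReal.ofReal π := by
  rcases hx.eq_or_lt with rfl | hx
  · simp
  have h1 : Integrable fun s : ℝ => x * (1 + (x * s) ^ 2)⁻¹ :=
    (integrable_inv_one_add_sq.comp_mul_left' hx.ne').const_mul x
  rw [← ofReal_integral_eq_lintegral_ofReal h1 (.of_forall fun s => by positivity), integral_const_mul,
    Measure.integral_comp_mul_left (fun s : ℝ => (1 + s ^ 2)⁻¹), integral_univ_inv_one_add_sq]
  rw [abs_of_pos (inv_pos.mpr hx), smul_eq_mul, mul_inv_cancel_left₀ hx.ne']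

namespace ProfileModes
variable {G : Torus d × Vel d → Fin d → ℝ} {φ : (Fin d → ℤ) → Vel d → ℂ} {A : (Fin d → ℤ) → ℝ}

theorem measurable_profileKernel (hG : ProfileModes G φ A) (ε : ℝ) (n k : Fin d → ℤ) :
    Measurable (profileKernel ε φ n k) := by
  refine Measurable.indicator ?_ measurableSet_Ioi
  have h1 : Measurable fun s : ℝ => φ n (s • intVec k) :=
    ((hG.continuous n).comp (continuous_id.smul continuous_const)).measurable
  exact Measurable.mul (by fun_prop) h1

theorem norm_profileKernel_le (hG : ProfileModes G φ A) (ε : ℝ) (n k : Fin d → ℤ) (s : ℝ) :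
    ‖profileKernel ε φ n k s‖
      ≤ (1 + ε ^ 2 * ‖intVec k‖ ^ 2)⁻¹ * (A n * (‖intVec k‖ * (1 + (‖intVec k‖ * s) ^ 2)⁻¹)) := by
  have hA := hG.nonneg n
  unfold profileKernel
  rw [indicator_apply]
  split_ifs with hs
  · have hs0 : 0 < s := hs
    have h1 := hG.decay n (s • intVec k)
    rw [norm_smul, Real.norm_of_nonneg hs0.le, ← le_div_iff₀ (by positivity)] at h1
    rw [norm_mul, norm_neg, Complex.norm_real, Real.norm_of_nonneg (by positivity)]
    calc _ = (1 + ε ^ 2 * ‖intVec k‖ ^ 2)⁻¹ * (‖intVec k‖ * (s * ‖intVec k‖ * ‖φ n (s • intVec k)‖)) := by ring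
      _ ≤ (1 + ε ^ 2 * ‖intVec k‖ ^ 2)⁻¹ * (‖intVec k‖ * (A n / (1 + (s * ‖intVec k‖) ^ 2))) := by gcongr
      _ = _ := by rw [div_eq_mul_inv, mul_comm s]; ring
  · rw [norm_zero]
    positivity

theorem norm_profileKernel_le_const (hG : ProfileModes G φ A) {ε : ℝ} (hε : 0 < ε) (n k : Fin d → ℤ) (s : ℝ) :
    ‖profileKernel ε φ n k s‖ ≤ A n * ε⁻¹ := by
  have hA := hG.nonneg n
  refine (hG.norm_profileKernel_le ε n k s).trans ?_
  set x := ‖intVec k‖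
  have hx : 0 ≤ x := norm_nonneg _
  have h1 : (1 + ε ^ 2 * x ^ 2)⁻¹ * x ≤ ε⁻¹ := by
    rw [inv_mul_le_iff₀ (by positivity), ← div_eq_mul_inv, le_div_iff₀ hε]
    nlinarith [sq_nonneg (ε * x - 1)]
  have h2 : (1 + (x * s) ^ 2)⁻¹ ≤ 1 := inv_le_one_of_one_le₀ (by nlinarith [sq_nonneg (x * s)])
  calc _ = A n * (((1 + ε ^ 2 * x ^ 2)⁻¹ * x) * (1 + (x * s) ^ 2)⁻¹) := by ring
    _ ≤ A n * (ε⁻¹ * 1) := by gcongr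
    _ = _ := by ring

theorem lintegral_profileKernel_le (hG : ProfileModes G φ A) (ε : ℝ) (n k : Fin d → ℤ) :
    ∫⁻ s, ‖profileKernel ε φ n k s‖ₑ ≤ ENNReal.ofReal (A n * π) := by
  have hA := hG.nonneg n
  rw [ENNReal.ofReal_mul hA]
  refine le_trans (lintegral_mono (g := fun s => ENNReal.ofReal (A n) *
    ENNReal.ofReal (‖intVec k‖ * (1 + (‖intVec k‖ * s) ^ 2)⁻¹)) fun s => ?_) ?_
  · dsimp only
    rw [← ENNReal.ofReal_mul hA, ← ofReal_norm]
    refine ENNReal.ofReal_le_ofReal ((hG.norm_profileKernel_le ε n k s).trans ?_)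
    refine mul_le_of_le_one_left (by positivity) (inv_le_one_of_one_le₀ ?_)
    nlinarith [mul_nonneg (sq_nonneg ε) (sq_nonneg ‖intVec k‖)]
  · rw [lintegral_const_mul' _ _ ENNReal.ofReal_ne_top]
    gcongr
    exact lintegral_mul_inv_one_add_sq_le (norm_nonneg _)

theorem norm_profileKernel_sub_le (hG : ProfileModes G φ A) (ε : ℝ) (n k l : Fin d → ℤ) (s : ℝ) :
    ‖profileKernel ε φ n k s - profileKernel ε φ n (k - l) s‖ ≤ 3 * A n * ‖intVec l‖ := by
  have hA := hG.nonneg n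
  unfold profileKernel
  rw [indicator_apply, indicator_apply]
  split_ifs with hs
  swap
  · simp only [sub_zero, norm_zero]
    positivity
  have hs0 : 0 < s := hs
  set x := intVec k with hx
  set y := intVec (k - l) with hy
  have hxy : x - y = intVec l := by
    ext i
    simp [hx, hy, intVec]
  set q : ℝ := (1 + ε ^ 2 * ‖x‖ ^ 2)⁻¹ with hq
  set q' : ℝ := (1 + ε ^ 2 * ‖y‖ ^ 2)⁻¹ with hq'
  have hq1 : |q| ≤ 1 := by
    rw [abs_of_nonneg (by positivity)]
    exact inv_le_one_of_one_le₀ (by nlinarith [mul_nonneg (sq_nonneg ε) (sq_nonneg ‖x‖)])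
  -- the kernel is `-(1/s)` times a Lipschitz function of `s k`
  have e : ∀ (z : Vel d) (c : ℝ), -((s * ‖z‖ ^ 2 * c : ℝ) : ℂ) * φ n (s • z)
      = -((s⁻¹ * c : ℝ) : ℂ) * (((‖s • z‖ ^ 2 : ℝ) : ℂ) * φ n (s • z)) := by
    intro z c
    have e0 : s * ‖z‖ ^ 2 * c = s⁻¹ * c * ‖s • z‖ ^ 2 := by
      rw [norm_smul, Real.norm_of_nonneg hs0.le]
      field_simp
    rw [e0, Complex.ofReal_mul]
    ring
  rw [e, e]
  set X := ((‖s • x‖ ^ 2 : ℝ) : ℂ) * φ n (s • x)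
  set Y := ((‖s • y‖ ^ 2 : ℝ) : ℂ) * φ n (s • y) with hY
  have h1 : ‖X - Y‖ ≤ A n * (s * ‖intVec l‖) := by
    refine (hG.lip n _ _).trans_eq ?_
    rw [← smul_sub, norm_smul, Real.norm_of_nonneg hs0.le, hxy]
  have h2 : ‖Y‖ ≤ s * ‖y‖ * A n := by
    rw [hY, norm_mul, Complex.norm_real, Real.norm_of_nonneg (by positivity), pow_two, mul_assoc,
      norm_smul, Real.norm_of_nonneg hs0.le]
    have := hG.norm_mul_norm_le n (s • y)
    rw [norm_smul, Real.norm_of_nonneg hs0.le] at this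
    gcongr
  have h3 : |q - q'| * ‖y‖ ≤ 2 * ‖intVec l‖ := by
    refine abs_resolvent_sub_mul_le (norm_nonneg _) (norm_nonneg _) ?_
    rw [← hxy]
    exact abs_norm_sub_norm_le x y
  have e2 : -((s⁻¹ * q : ℝ) : ℂ) * X - -((s⁻¹ * q' : ℝ) : ℂ) * Y
      = -((s⁻¹ : ℝ) : ℂ) * ((q : ℂ) * (X - Y) + ((q - q' : ℝ) : ℂ) * Y) := by
    push_cast
    ring
  rw [e2, norm_mul, norm_neg, Complex.norm_real, Real.norm_of_nonneg (inv_pos.mpr hs0).le,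
    inv_mul_le_iff₀ hs0]
  refine (norm_add_le _ _).trans ?_
  rw [norm_mul, norm_mul, Complex.norm_real, Complex.norm_real, Real.norm_eq_abs, Real.norm_eq_abs]
  calc _ ≤ 1 * (A n * (s * ‖intVec l‖)) + |q - q'| * (s * ‖y‖ * A n) := by gcongr
    _ = A n * s * ‖intVec l‖ + s * A n * (|q - q'| * ‖y‖) := by ring
    _ ≤ A n * s * ‖intVec l‖ + s * A n * (2 * ‖intVec l‖) := by gcongr
    _ = _ := by ring

open FourierTransform in
/-- The Penrose function of a slice is the symbol of the integral operator with the coefficients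
frozen at `y`; the parameter `ε` is absorbed by scaling. The factor `2 π` comes from the normalization of
`𝓕`. -/
theorem penrose_eq (hG : ProfileModes G φ A) {ε : ℝ} (hε : 0 < ε) {y : Torus d}
    (hy : ∀ j ξ, fourierV (fun v => G (y, v) j) ξ = ∑' n, tchar n y * (Complex.I * (ξ j : ℂ) * φ n ξ))
    {γ : ℝ} (hγ : 0 < γ) (τ : ℝ) (k : Fin d → ℤ) :
    penrose (ε * γ) (ε * (2 * π * τ)) (ε • intVec k) (fun v => G (y, v))
      = 1 - ∑' n, tchar n y * 𝓕 (fun s => (Real.exp (-γ * s) : ℂ) * profileKernel ε φ n k s) τ := by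
  unfold penrose
  congr 1
  set f : ℝ → ℂ := fun s => Complex.exp (-(((ε * γ : ℝ) : ℂ) + Complex.I * ((ε * (2 * π * τ) : ℝ) : ℂ)) * (s : ℂ)) *
    (Complex.I / ((1 + ‖ε • intVec k‖ ^ 2 : ℝ) : ℂ) *
      ∑ j, (((ε • intVec k) j : ℝ) : ℂ) * fourierV (fun v => G (y, v) j) (s • ε • intVec k)) with hf
  -- the change of variables `s ↦ s / ε`
  have hsc := integral_comp_mul_left_Ioi f 0 (inv_pos.mpr hε)
  rw [inv_inv, mul_zero] at hsc
  have hsc' : ∫ s in Ioi (0 : ℝ), f s = ∫ s in Ioi (0 : ℝ), (ε⁻¹ : ℂ) * f (ε⁻¹ * s) := by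
    rw [integral_const_mul, hsc, Complex.real_smul]
    rw [inv_mul_cancel_left₀ (by exact_mod_cast hε.ne')]
  have hsA : ∀ ξ : Vel d, ∀ j, Summable fun n => tchar n y * (Complex.I * (ξ j : ℂ) * φ n ξ) := by
    intro ξ j
    refine Summable.of_norm_bounded hG.summable_A fun n => ?_
    rw [norm_mul, norm_tchar, one_mul, norm_mul, norm_mul, Complex.norm_I, one_mul, Complex.norm_real]
    refine le_trans ?_ (hG.norm_mul_norm_le n ξ)
    gcongr
    exact PiLp.norm_apply_le ξ j
  set u : (Fin d → ℤ) → ℝ → ℂ := fun n s =>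
    tchar n y * (Complex.exp (((-2 * π * s * τ : ℝ) : ℂ) * Complex.I) * ((Real.exp (-γ * s) : ℂ) * profileKernel ε φ n k s)) with hu
  have hfu : ∀ s ∈ Ioi (0 : ℝ), (ε⁻¹ : ℂ) * f (ε⁻¹ * s) = ∑' n, u n s := by
    intro s hs
    have hεs : (ε⁻¹ * s) • ε • intVec k = s • intVec k := by
      rw [smul_smul]
      congr 1
      field_simp
    have e1 : ∑ j, (((ε • intVec k) j : ℝ) : ℂ) * fourierV (fun v => G (y, v) j) (s • intVec k)
        = ∑' n, tchar n y * (Complex.I * ((ε * s * ‖intVec k‖ ^ 2 : ℝ) : ℂ) * φ n (s • intVec k)) := by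
      simp only [hy, ← tsum_mul_left]
      rw [← Summable.tsum_finsetSum fun j _ => (hsA _ j).mul_left _]
      refine tsum_congr fun n => ?_
      rw [EuclideanSpace.norm_sq_eq, Finset.mul_sum, Complex.ofReal_sum, Finset.mul_sum, Finset.sum_mul, Finset.mul_sum]
      refine Finset.sum_congr rfl fun j _ => ?_
      simp only [Real.norm_eq_abs, sq_abs, PiLp.smul_apply, smul_eq_mul]
      push_cast
      ring
    have e2 : Complex.exp (-(((ε * γ : ℝ) : ℂ) + Complex.I * ((ε * (2 * π * τ) : ℝ) : ℂ)) * ((ε⁻¹ * s : ℝ) : ℂ))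
        = Complex.exp (((-2 * π * s * τ : ℝ) : ℂ) * Complex.I) * (Real.exp (-γ * s) : ℂ) := by
      rw [Complex.ofReal_exp, ← Complex.exp_add]
      congr 1
      have : (ε : ℂ) ≠ 0 := by exact_mod_cast hε.ne'
      push_cast
      field_simp
      ring
    simp only [hf]
    rw [hεs, e1, e2, ← tsum_mul_left, ← tsum_mul_left, ← tsum_mul_left]
    refine tsum_congr fun n => ?_
    simp only [hu, profileKernel, indicator_of_mem hs]
    have h3 : ‖ε • intVec k‖ ^ 2 = ε ^ 2 * ‖intVec k‖ ^ 2 := by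
      rw [norm_smul, mul_pow, Real.norm_eq_abs, sq_abs]
    rw [h3]
    have h4 : (ε : ℂ) ≠ 0 := by exact_mod_cast hε.ne'
    have h5 : ((1 + ε ^ 2 * ‖intVec k‖ ^ 2 : ℝ) : ℂ) ≠ 0 := by
      have : (1 + ε ^ 2 * ‖intVec k‖ ^ 2 : ℝ) ≠ 0 := by positivity
      exact_mod_cast this
    rw [Complex.ofReal_mul (s * ‖intVec k‖ ^ 2), Complex.ofReal_inv]
    push_cast at h5 ⊢
    field_simp
    linear_combination (s * ‖intVec k‖ ^ 2 * tchar n y * φ n (s • intVec k) : ℂ) * Complex.I_sq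
  have hum : ∀ n, Measurable (u n) := fun n => by
    have := hG.measurable_profileKernel ε n k
    simp only [hu]
    fun_prop
  have hun : ∀ n s, ‖u n s‖ ≤ ‖profileKernel ε φ n k s‖ := by
    intro n s
    simp only [hu]
    rw [norm_mul, norm_tchar, one_mul, norm_mul, Complex.norm_exp_ofReal_mul_I, one_mul, norm_mul, Complex.norm_real,
      Real.norm_of_nonneg (Real.exp_pos _).le]
    rcases lt_or_ge s 0 with hs | hs
    · simp [profileKernel, hs.le]
    · refine mul_le_of_le_one_left (norm_nonneg _) (Real.exp_le_one_iff.mpr ?_)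
      nlinarith
  have huL : ∀ n, ∫⁻ s, ‖u n s‖ₑ ≤ ENNReal.ofReal (A n * π) := fun n =>
    (lintegral_mono fun s => enorm_le_iff_norm_le.mpr (hun n s)).trans (hG.lintegral_profileKernel_le ε n k)
  have hui : ∀ n, Integrable (u n) := fun n =>
    ⟨(hum n).aestronglyMeasurable, (huL n).trans_lt ENNReal.ofReal_lt_top⟩
  rw [hsc', setIntegral_congr_fun measurableSet_Ioi hfu, ← integral_tsum_of_summable_integral_norm]
  · refine tsum_congr fun n => ?_
    rw [Real.fourier_real_eq_integral_exp_smul, ← integral_const_mul]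
    refine setIntegral_eq_integral_of_forall_compl_eq_zero fun s hs => ?_
    simp [hu, profileKernel, indicator_of_notMem hs]
  · exact fun n => (hui n).integrableOn
  · refine Summable.of_nonneg_of_le (fun n => integral_nonneg fun s => norm_nonneg _) (fun n => ?_)
      (hG.summable_A.mul_right π)
    refine (setIntegral_le_integral (hui n).norm (.of_forall fun s => norm_nonneg _)).trans ?_
    rw [integral_norm_eq_lintegral_enorm (hum n).aestronglyMeasurable]
    exact ENNReal.toReal_le_of_le_ofReal (mul_nonneg (hG.nonneg n) Real.pi_pos.le) (huL n)

/-- Under the Penrose stability condition the kernel satisfies all the requirements of the coercivity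
estimate. Only the bound for the supremum depends on `ε`. For the frequency `0` the kernel vanishes and the
symbol is `1`, whence the minimum of `c₀` and `1`. -/
theorem penroseKernel (hG : ProfileModes G φ A) {c₀ : ℝ}
    (hst : ∀ᵐ x : Torus d, PenroseStable c₀ fun v => G (x, v)) {ε : ℝ} (hε : 0 < ε) :
    PenroseKernel (profileKernel ε φ) (fun n => A n * π) (fun n => 3 * A n) (fun n => A n * ε⁻¹) (min c₀ 1) where
  meas := hG.measurable_profileKernel ε
  supp n k s hs := by simp [profileKernel, hs.le]
  nonneg n := mul_nonneg (hG.nonneg n) Real.pi_pos.le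
  summable := by
    simp only [← mul_assoc]
    exact hG.summable.mul_right π
  lintegral_le := hG.lintegral_profileKernel_le ε
  lip_nonneg n := mul_nonneg (by norm_num) (hG.nonneg n)
  lip_summable := hG.summable_A.mul_left 3
  lip := hG.norm_profileKernel_sub_le ε
  sup_summable := hG.summable_A.mul_right _
  norm_le := hG.norm_profileKernel_le_const hε
  lower := by
    filter_upwards [hst, hG.ae_fourierV_eq] with y hy1 hy2
    intro γ hγ τ k
    by_cases hk : intVec k = 0
    · have : ∀ n s, profileKernel ε φ n k s = 0 := fun n s => by
        simp [profileKernel, hk, indicator_apply]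
      simp [this, Real.fourier_real_eq]
    · rw [← hG.penrose_eq hε hy2 hγ τ k]
      exact (min_le_left _ _).trans (hy1 _ _ _ (mul_pos hε hγ) (smul_ne_zero hε.ne' hk))

end ProfileModes

/-! ### Fourier coefficients of transported products -/

/-- The Fourier coefficients of a product. -/
theorem hasSum_coef_mul {f g : Torus d → ℂ} (hf : MemLp f 2) (hg : MemLp g 2) (k : Fin d → ℤ) :
    HasSum (fun n => coef (k - n) f * coef n g) (coef k fun x => f x * g x) := by
  have h1 : MemLp (fun x => tchar (-k) x * f x) 2 := by
    refine hf.of_le ((tchar (-k)).continuous.aestronglyMeasurable.mul hf.1) (.of_forall fun x => ?_)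
    rw [norm_mul, norm_tchar, one_mul]
  have h2 := (hasSum_coef_mul_coef h1 hg).mul_left (((2 * π : ℝ) : ℂ) ^ d)⁻¹
  have e1 : (((2 * π : ℝ) : ℂ) ^ d)⁻¹ * ∫ x, tchar (-k) x * f x * g x = coef k fun x => f x * g x := by
    simp only [coef, mul_assoc]
  have e2 : ∀ n, coef (-n) (fun x => tchar (-k) x * f x) = coef (k - n) f := by
    intro n
    unfold coef
    congr 1
    refine integral_congr_ae (.of_forall fun x => ?_)
    dsimp only
    rw [neg_neg, ← mul_assoc, ← tchar_add, show n + -k = -(k - n) by abel]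
  rw [e1] at h2
  simpa only [e2, inv_mul_cancel_left₀ two_pi_pow_ne_zero] using h2

theorem coef_comp_sub_right (k : Fin d → ℤ) (f : Torus d → ℂ) (c : Torus d) :
    coef k (fun x => f (x - c)) = tchar (-k) c * coef k f := by
  unfold coef
  rw [mul_left_comm]
  congr 1
  have h1 := integral_sub_right_eq_self (μ := (volume : Measure (Torus d)))
    (fun x => tchar (-k) c * (tchar (-k) x * f x)) c
  rw [← integral_const_mul, ← h1]
  refine integral_congr_ae (.of_forall fun x => ?_)
  dsimp only
  rw [tchar_sub_right, neg_neg]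
  have : tchar (-k) c * tchar k c = 1 := by
    rw [← tchar_add, neg_add_cancel, tchar_zero]
  linear_combination (-(tchar (-k) x * f (x - c))) * this

theorem coef_integral {α : Type*} [MeasurableSpace α] {P : Measure α} [SFinite P]
    {Ψ : α × Torus d → ℂ} (hΨ : Integrable Ψ (P.prod volume)) (k : Fin d → ℤ) :
    coef k (fun x => ∫ p, Ψ (p, x) ∂P) = ∫ p, coef k (fun x => Ψ (p, x)) ∂P := by
  unfold coef
  rw [integral_const_mul]
  congr 1
  have h1 : Integrable (fun z : α × Torus d => tchar (-k) z.2 * Ψ z) (P.prod volume) :=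
    hΨ.bdd_mul (c := 1) ((tchar (-k)).continuous.measurable.comp measurable_snd).aestronglyMeasurable
      (.of_forall fun z => (norm_tchar _ _).le)
  rw [integral_integral_swap h1]
  simp only [integral_const_mul]

theorem enorm_coef_le_sqrt_lintegral {f : Torus d → ℂ} (hf : MemLp f 2) (k : Fin d → ℤ) :
    ‖coef k f‖ₑ ≤ (∫⁻ x, ‖f x‖ₑ ^ 2) ^ (1 / 2 : ℝ) := by
  rw [← ennreal_sq_le_sq_iff, ennreal_rpow_half_sq]
  refine le_trans (le_mul_of_one_le_left (by simp) ?_) (enorm_coef_sq_le hf k)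
  rw [ENNReal.one_le_ofReal]
  exact one_le_pow₀ (by linarith [Real.pi_gt_three])

theorem ae_sqrt_lintegral_le_tsum_modeV {F : Torus d × Vel d → ℝ} (hF : MemLp F 2) :
    ∀ᵐ v, (∫⁻ x, ‖(F (x, v) : ℂ)‖ₑ ^ 2) ^ (1 / 2 : ℝ)
      ≤ ENNReal.ofReal ((2 * π) ^ d) ^ (1 / 2 : ℝ) * ∑' n, ‖modeV n F v‖ₑ := by
  filter_upwards [ae_memLp_slice hF] with v hv
  rw [← ennreal_sq_le_sq_iff, ennreal_rpow_half_sq, mul_pow, ennreal_rpow_half_sq,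
    lintegral_enorm_sq_eq_tsum_coef hv]
  gcongr
  change ∑' n, ‖modeV n F v‖ₑ ^ 2 ≤ _
  rw [pow_two, ← ENNReal.tsum_mul_right]
  refine ENNReal.tsum_le_tsum fun n => ?_
  rw [pow_two]
  gcongr
  exact ENNReal.le_tsum (f := fun n => ‖modeV n F v‖ₑ) n

theorem ae_memLp_transported {μ : Measure ℝ} {W : ℝ × Torus d → ℂ}
    {F : Torus d × Vel d → ℝ} (hW2 : ∀ᵐ s ∂μ, MemLp (fun x => W (s, x)) 2) (hF : MemLp F 2) :
    ∀ᵐ p ∂(μ.prod (volume : Measure (Vel d))), MemLp (fun x => W (p.1, x)) 2 ∧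
      MemLp (fun x => (F (x, p.2) : ℂ)) 2 :=
  (Measure.quasiMeasurePreserving_fst.ae hW2).and (Measure.quasiMeasurePreserving_snd.ae (ae_memLp_slice hF))

section transport
variable (μ : Measure ℝ) [SFinite μ] (t : ℝ)

/-- The integrand of the integral operator: `W(s, x - (t - s) v) F(x, v)` as a function of
`((s, v), x)`. -/
def transported (t : ℝ) (W : ℝ × Torus d → ℂ) (F : Torus d × Vel d → ℝ) :
    (ℝ × Vel d) × Torus d → ℂ :=
  fun z => W (z.1.1, z.2 - toTorus ((t - z.1.1) • z.1.2)) * (F (z.2, z.1.2) : ℂ)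

theorem quasiMeasurePreserving_transport :
    Measure.QuasiMeasurePreserving
      (fun z : (ℝ × Vel d) × Torus d => (z.1.1, z.2 - toTorus ((t - z.1.1) • z.1.2)))
      ((μ.prod volume).prod volume) (μ.prod volume) := by
  have h1 : MeasurePreserving (fun z : (ℝ × Vel d) × Torus d =>
      (z.1, z.2 - toTorus ((t - z.1.1) • z.1.2)))
      ((μ.prod volume).prod volume) ((μ.prod volume).prod volume) := by
    refine MeasurePreserving.skew_product (f := id) (MeasurePreserving.id _)
      (g := fun (p : ℝ × Vel d) (x : Torus d) => x - toTorus ((t - p.1) • p.2)) ?_ (.of_forall fun p => ?_)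
    · have : Continuous fun z : (ℝ × Vel d) × Torus d => z.2 - toTorus ((t - z.1.1) • z.1.2) := by
        fun_prop
      exact this.measurable
    · exact (measurePreserving_sub_right volume _).map_eq
  have h2 : Measure.QuasiMeasurePreserving (Prod.map Prod.fst id : (ℝ × Vel d) × Torus d → ℝ × Torus d)
      ((μ.prod volume).prod volume) (μ.prod volume) :=
    MeasureTheory.QuasiMeasurePreserving.prodMap Measure.quasiMeasurePreserving_fst (Measure.QuasiMeasurePreserving.id _)
  exact h2.comp h1.quasiMeasurePreserving

variable {μ} {W : ℝ × Torus d → ℂ} {F : Torus d × Vel d → ℝ}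

theorem aestronglyMeasurable_transported (hW : AEStronglyMeasurable W (μ.prod volume)) (hF : MemLp F 2) :
    AEStronglyMeasurable (transported t W F) ((μ.prod volume).prod volume) := by
  refine (hW.comp_quasiMeasurePreserving (quasiMeasurePreserving_transport μ t)).mul ?_
  have h1 : Measure.QuasiMeasurePreserving (fun z : (ℝ × Vel d) × Torus d => (z.1.2, z.2))
      ((μ.prod volume).prod volume) (volume.prod volume) :=
    MeasureTheory.QuasiMeasurePreserving.prodMap Measure.quasiMeasurePreserving_snd (Measure.QuasiMeasurePreserving.id _)
  exact (memLp_swap hF).1.comp_quasiMeasurePreserving h1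

theorem memLp_comp_sub_right {f : Torus d → ℂ} (hf : MemLp f 2) (c : Torus d) :
    MemLp (fun x => f (x - c)) 2 := hf.comp_measurePreserving (measurePreserving_sub_right volume c)

theorem integrable_transported (hW : AEStronglyMeasurable W (μ.prod volume))
    (hW2 : ∀ᵐ s ∂μ, MemLp (fun x => W (s, x)) 2) (hF : MemLp F 2)
    (hWfin : ∫⁻ s, (∫⁻ x, ‖W (s, x)‖ₑ ^ 2) ^ (1 / 2 : ℝ) ∂μ ≠ ⊤)
    (hFs : ∑' n, ∫⁻ v, ‖modeV n F v‖ₑ ≠ ⊤) :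
    Integrable (transported t W F) ((μ.prod volume).prod volume) := by
  have hm := aestronglyMeasurable_transported t hW hF
  refine ⟨hm, ?_⟩
  unfold HasFiniteIntegral
  rw [lintegral_prod _ hm.enorm]
  have mW : AEMeasurable (fun s => (∫⁻ x, ‖W (s, x)‖ₑ ^ 2) ^ (1 / 2 : ℝ)) μ :=
    ((hW.enorm.pow_const 2).lintegral_prod_right').pow_const _
  have mF : AEMeasurable (fun v => ∑' n, ‖modeV n F v‖ₑ) :=
    AEMeasurable.tsum fun n => (aestronglyMeasurable_modeV hF n).enorm
  have hb : ∫⁻ p : ℝ × Vel d, (∫⁻ x : Torus d, ‖transported t W F (p, x)‖ₑ) ∂(μ.prod volume)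
      ≤ ∫⁻ p : ℝ × Vel d, (∫⁻ x, ‖W (p.1, x)‖ₑ ^ 2) ^ (1 / 2 : ℝ) *
        (ENNReal.ofReal ((2 * π) ^ d) ^ (1 / 2 : ℝ) * ∑' n, ‖modeV n F p.2‖ₑ) ∂(μ.prod volume) := by
    refine lintegral_mono_ae ?_
    filter_upwards [ae_memLp_transported hW2 hF,
      Measure.quasiMeasurePreserving_snd.ae (ae_sqrt_lintegral_le_tsum_modeV hF)] with p h1 h2
    set c := toTorus ((t - p.1) • p.2)
    have h3 := memLp_comp_sub_right h1.1 c
    have h4 := lintegral_mul_le_sqrt volume h3.1.enorm h1.2.1.enorm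
    rw [lintegral_sub_right_eq_self (fun x => ‖W (p.1, x)‖ₑ ^ 2) c] at h4
    simp only [transported, enorm_mul]
    exact h4.trans (by gcongr)
  refine hb.trans_lt ?_
  rw [lintegral_prod_mul mW (mF.const_mul _), lintegral_const_mul'' _ mF,
    lintegral_tsum fun n => (aestronglyMeasurable_modeV hF n).enorm]
  refine ENNReal.mul_lt_top hWfin.lt_top (ENNReal.mul_lt_top ?_ hFs.lt_top)
  exact (ENNReal.rpow_ne_top_of_nonneg (by norm_num) ENNReal.ofReal_ne_top).lt_top

/-- The Fourier coefficients of the transported product: the phase `e^{-i (t - s) (k - n)·v}` turns the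
velocity average into a Fourier transform. -/
theorem integral_coef_transported (hW : AEStronglyMeasurable W (μ.prod volume))
    (hW2 : ∀ᵐ s ∂μ, MemLp (fun x => W (s, x)) 2) (hF : MemLp F 2)
    (hWfin : ∫⁻ s, (∫⁻ x, ‖W (s, x)‖ₑ ^ 2) ^ (1 / 2 : ℝ) ∂μ ≠ ⊤)
    (hFs : ∑' n, ∫⁻ v, ‖modeV n F v‖ₑ ≠ ⊤) (k : Fin d → ℤ) :
    HasSum (fun n => ∫ s, coef (k - n) (fun x => W (s, x)) *
        velFourier (modeV n F) ((t - s) • intVec (k - n)) ∂μ)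
      (∫ p, coef k (fun x => transported t W F (p, x)) ∂(μ.prod volume)) := by
  -- the terms of the product formula, by the mode `n` of `F`
  set u : (Fin d → ℤ) → ℝ × Vel d → ℂ := fun n p => coef (k - n) (fun x => W (p.1, x)) *
    (Complex.exp (-Complex.I * ((inner ℝ ((t - p.1) • intVec (k - n)) p.2 : ℝ) : ℂ)) * modeV n F p.2) with hu
  have hmc : ∀ l, AEStronglyMeasurable (fun s => coef l fun x => W (s, x)) μ := fun l => aestronglyMeasurable_coef hW l
  have hmF : ∀ n, AEStronglyMeasurable (modeV n F) := fun n => aestronglyMeasurable_modeV hF n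
  have hum : ∀ n, AEStronglyMeasurable (u n) (μ.prod volume) := by
    intro n
    refine (hmc (k - n)).comp_fst.mul (AEStronglyMeasurable.mul ?_ (hmF n).comp_snd)
    have h1 : Continuous fun p : ℝ × Vel d => (inner ℝ ((t - p.1) • intVec (k - n)) p.2 : ℝ) := by
      fun_prop
    exact (by fun_prop : Continuous fun p : ℝ × Vel d =>
      Complex.exp (-Complex.I * ((inner ℝ ((t - p.1) • intVec (k - n)) p.2 : ℝ) : ℂ))).aestronglyMeasurable
  set Wn := ∫⁻ s, (∫⁻ x, ‖W (s, x)‖ₑ ^ 2) ^ (1 / 2 : ℝ) ∂μ with hWn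
  have huL : ∀ n, ∫⁻ p, ‖u n p‖ₑ ∂(μ.prod volume) ≤ Wn * ∫⁻ v, ‖modeV n F v‖ₑ := by
    intro n
    have e : ∀ p, ‖u n p‖ₑ = ‖coef (k - n) (fun x => W (p.1, x))‖ₑ * ‖modeV n F p.2‖ₑ := by
      intro p
      simp only [hu]
      rw [enorm_mul, enorm_mul, ← ofReal_norm (Complex.exp _), norm_cexp_neg_I_mul, ENNReal.ofReal_one, one_mul]
    simp only [e]
    rw [lintegral_prod_mul (f := fun s => ‖coef (k - n) (fun x => W (s, x))‖ₑ) (g := fun v => ‖modeV n F v‖ₑ)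
      (hmc _).enorm (hmF n).enorm]
    gcongr
    refine lintegral_mono_ae ?_
    filter_upwards [hW2] with s hs
    exact enorm_coef_le_sqrt_lintegral hs _
  have hFn : ∀ n, ∫⁻ v, ‖modeV n F v‖ₑ ≠ ⊤ := fun n => ENNReal.ne_top_of_tsum_ne_top hFs n
  have hui : ∀ n, Integrable (u n) (μ.prod volume) := fun n =>
    ⟨hum n, (huL n).trans_lt (ENNReal.mul_lt_top hWfin.lt_top (hFn n).lt_top)⟩
  have hsum : Summable fun n => ∫ p, ‖u n p‖ ∂(μ.prod volume) := by
    refine Summable.of_nonneg_of_le (fun n => integral_nonneg fun p => norm_nonneg _) (fun n => ?_)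
      ((ENNReal.summable_toReal hFs).mul_left Wn.toReal)
    rw [integral_norm_eq_lintegral_enorm (hum n), ← ENNReal.toReal_mul]
    exact ENNReal.toReal_mono (ENNReal.mul_ne_top hWfin (hFn n)) (huL n)
  have h1 := hasSum_integral_of_summable_integral_norm hui hsum
  have e1 : ∫ p, ∑' n, u n p ∂(μ.prod volume) = ∫ p, coef k (fun x => transported t W F (p, x)) ∂(μ.prod volume) := by
    refine integral_congr_ae ?_
    filter_upwards [ae_memLp_transported hW2 hF] with p hp
    set c := toTorus ((t - p.1) • p.2) with hc
    have h2 := hasSum_coef_mul (memLp_comp_sub_right hp.1 c) hp.2 k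
    simp only [transported]
    rw [← h2.tsum_eq]
    refine tsum_congr fun n => ?_
    rw [coef_comp_sub_right (k - n) (fun x => W (p.1, x)) c, hc, tchar_toTorus]
    have e2 : (inner ℝ (intVec (-(k - n))) ((t - p.1) • p.2) : ℝ) = -(inner ℝ ((t - p.1) • intVec (k - n)) p.2 : ℝ) := by
      have : intVec (-(k - n)) = -intVec (k - n) := by
        ext i
        simp [intVec]
      rw [this, inner_neg_left, inner_smul_left, inner_smul_right]
      simp
    rw [e2]
    simp only [hu, modeV]
    push_cast
    ring_nf
  have e2 : ∀ n, ∫ p, u n p ∂(μ.prod volume) = ∫ s, coef (k - n) (fun x => W (s, x)) *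
      velFourier (modeV n F) ((t - s) • intVec (k - n)) ∂μ := by
    intro n
    rw [integral_prod _ (hui n)]
    refine integral_congr_ae (.of_forall fun s => ?_)
    simp only [hu]
    rw [integral_const_mul]
    rfl
  rw [e1] at h1
  simpa only [e2] using h1

end transport

/-! ### The integral operator in Fourier modes -/

/-- A bounded multiplier of the Fourier modes is bounded in `L²`. -/
theorem lintegral_sq_le_of_coef {f g : Torus d → ℂ} (hf : MemLp f 2) (hg : MemLp g 2) {C : ℝ} (hC : 0 ≤ C)
    (h : ∀ k, ‖coef k f‖ ≤ C * ‖coef k g‖) :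
    (∫⁻ x, ‖f x‖ₑ ^ 2) ^ (1 / 2 : ℝ) ≤ ENNReal.ofReal C * (∫⁻ x, ‖g x‖ₑ ^ 2) ^ (1 / 2 : ℝ) := by
  rw [← ennreal_sq_le_sq_iff, mul_pow, ennreal_rpow_half_sq, ennreal_rpow_half_sq,
    lintegral_enorm_sq_eq_tsum_coef hf, lintegral_enorm_sq_eq_tsum_coef hg, mul_left_comm]
  gcongr
  rw [← ENNReal.tsum_mul_left]
  refine ENNReal.tsum_le_tsum fun k => ?_
  rw [← mul_pow]
  gcongr
  rw [← ofReal_norm, ← ofReal_norm, ← ENNReal.ofReal_mul hC]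
  exact ENNReal.ofReal_le_ofReal (h k)

namespace ProfileModes
variable {G : Torus d × Vel d → Fin d → ℝ} {φ : (Fin d → ℤ) → Vel d → ℂ} {A : (Fin d → ℤ) → ℝ}

/-- The Fourier modes of the integral operator applied to the regularized unknown. -/
theorem coef_opK_eq (hG : ProfileModes G φ A) {ε : ℝ} (hε : 0 < ε) (γ : ℝ) {h : ℝ × Torus d → ℂ}
    (hm : AEStronglyMeasurable h) (h2 : ∀ᵐ t : ℝ, MemLp (fun x => h (t, x)) 2)
    {hh : (Fin d → ℤ) → ℝ → ℂ} (hhs : ∀ k s, s ≤ 0 → hh k s = 0)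
    (hhe : ∀ k, ∀ᵐ s, 0 < s → hh k s = coef k fun x => h (s, x)) {t : ℝ} (ht : 0 < t)
    (hfin : ∫⁻ s in Ioc 0 t, (∫⁻ x, ‖h (s, x)‖ₑ ^ 2) ^ (1 / 2 : ℝ) ≠ ⊤) (k : Fin d → ℤ) :
    coef k (fun x => opK G (fun y => (Real.exp (γ * y.1) : ℂ) * resolvent ε h y) (t, x))
      = (Real.exp (γ * t) : ℂ) * volterra γ (profileKernel ε φ) hh k t := by
  set μ : Measure ℝ := volume.restrict (Ioc 0 t) with hμ
  have hμac : μ ≪ volume := Measure.restrict_le_self.absolutelyContinuous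
  set W : Fin d → ℝ × Torus d → ℂ := fun j =>
    weakPdX j fun y => (Real.exp (γ * y.1) : ℂ) * resolvent ε h y with hW
  set Gj : Fin d → Torus d × Vel d → ℝ := fun j z => G z j with hGj
  have hWspec := fun j => weakPdX_resolvent hε γ hm h2 j
  have hWm : ∀ j, AEStronglyMeasurable (W j) (μ.prod (volume : Measure (Torus d))) := fun j => by
    refine (hWspec j).1.mono_ac ?_
    exact hμac.prod Measure.AbsolutelyContinuous.rfl
  have hW2 : ∀ j, ∀ᵐ s ∂μ, MemLp (fun x => W j (s, x)) 2 ∧ ∀ k, coef k (fun x => W j (s, x))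
      = (Real.exp (γ * s) : ℂ) * gradResolventSymbol ε j k * coef k (fun x => h (s, x)) := fun j =>
    hμac.ae_le (hWspec j).2
  have hWfin : ∀ j, ∫⁻ s, (∫⁻ x, ‖W j (s, x)‖ₑ ^ 2) ^ (1 / 2 : ℝ) ∂μ ≠ ⊤ := by
    intro j
    refine ne_top_of_le_ne_top (ENNReal.mul_ne_top
      (ENNReal.ofReal_ne_top (r := Real.exp (|γ| * t) * ε⁻¹)) hfin) ?_
    rw [← lintegral_const_mul' _ _ ENNReal.ofReal_ne_top]
    refine lintegral_mono_ae ?_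
    filter_upwards [hW2 j, hμac.ae_le h2, ae_restrict_mem measurableSet_Ioc] with s h3 h4 h5
    refine lintegral_sq_le_of_coef h3.1 h4 (by positivity) fun k => ?_
    rw [h3.2, norm_mul, norm_mul, Complex.norm_real, Real.norm_of_nonneg (Real.exp_pos _).le]
    gcongr
    · exact h5.1.le
    · exact le_abs_self γ
    · exact h5.2
    · exact norm_gradResolventSymbol_le hε j k
  -- absolute integrability, needed for the exchange of the integrals
  have hΨ := fun j => integrable_transported t (hWm j) ((hW2 j).mono fun s h => h.1) (hG.memLp j) (hWfin j)
    (hG.tsum_lintegral_ne_top j)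
  have hop : (fun x => opK G (fun y => (Real.exp (γ * y.1) : ℂ) * resolvent ε h y) (t, x))
      =ᵐ[volume] fun x => ∑ j, ∫ p, transported t (W j) (Gj j) (p, x) ∂(μ.prod volume) := by
    filter_upwards [ae_all_iff.mpr fun j => (hΨ j).prod_left_ae] with x hx
    unfold opK
    rw [intervalIntegral.integral_of_le ht.le, ← integral_finsetSum _ fun j _ => hx j,
      integral_prod _ (integrable_finsetSum _ fun j _ => hx j)]
    rfl
  rw [coef_congr_ae hop, coef_finset_sum _ fun j _ => (hΨ j).integral_prod_right]
  simp only [fun j => coef_integral (hΨ j) k]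
  have hs := hasSum_sum (s := Finset.univ) fun j _ => integral_coef_transported t (hWm j)
    ((hW2 j).mono fun s h => h.1) (hG.memLp j) (hWfin j) (hG.tsum_lintegral_ne_top j) k
  rw [← hs.tsum_eq]
  unfold volterra
  rw [← tsum_mul_left]
  refine tsum_congr fun n => ?_
  set l := k - n with hl
  set Y : ℝ → ℂ := fun s => (Real.exp (γ * s) : ℂ) * hh l s *
    (-(((t - s) * (1 + ε ^ 2 * ‖intVec l‖ ^ 2)⁻¹ : ℝ) : ℂ) * φ n ((t - s) • intVec l)) with hY
  -- the two gradients contribute `i l_j` each, and `Y` collects the common factors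
  have e1 : ∀ j, ∫ s, coef l (fun x => W j (s, x)) * velFourier (modeV n (Gj j)) ((t - s) • intVec l) ∂μ
      = ((l j : ℝ) : ℂ) ^ 2 * ∫ s, Y s ∂μ := by
    intro j
    rw [← integral_const_mul]
    refine integral_congr_ae ?_
    filter_upwards [hW2 j, hμac.ae_le (hhe l), ae_restrict_mem measurableSet_Ioc] with s h3 h4 h5
    rw [h3.2, hG.fourier j n, ← h4 h5.1, gradResolventSymbol]
    simp only [hY, PiLp.smul_apply, smul_eq_mul, intVec_apply]
    push_cast
    linear_combination (Complex.exp ((γ : ℂ) * (s : ℂ)) * (l j : ℂ) * (1 + (ε : ℂ) ^ 2 * (‖intVec l‖ : ℂ) ^ 2)⁻¹ * hh l s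
      * ((t - s) * (l j : ℂ)) * φ n ((t - s) • intVec l)) * Complex.I_sq
  change ∑ j, ∫ s, coef l (fun x => W j (s, x)) * velFourier (modeV n (Gj j)) ((t - s) • intVec l) ∂μ = _
  simp only [e1]
  set Z : ℝ → ℂ := fun s => (Real.exp (γ * s) : ℂ) * (profileKernel ε φ n l (t - s) * hh l s) with hZ
  have e2 : ∑ j, ((l j : ℝ) : ℂ) ^ 2 * ∫ s, Y s ∂μ = ∫ s, Z s := by
    rw [← Finset.sum_mul]
    have e3 : (∑ j, ((l j : ℝ) : ℂ) ^ 2) = ((‖intVec l‖ ^ 2 : ℝ) : ℂ) := by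
      rw [EuclideanSpace.norm_sq_eq]
      simp
    rw [e3, ← integral_const_mul]
    -- outside `(0, t]` either the unknown or the kernel vanishes
    have e4 : ∫ s, Z s = ∫ s, Z s ∂μ := by
      refine (setIntegral_eq_integral_of_forall_compl_eq_zero fun s hs => ?_).symm
      simp only [hZ]
      rcases le_or_gt s 0 with h0 | h0
      · rw [hhs l s h0, mul_zero, mul_zero]
      · have : t < s := by
          by_contra h6
          exact hs ⟨h0, not_lt.mp h6⟩
        simp [profileKernel, this.le]
    rw [e4]
    refine integral_congr_ae ?_
    -- the kernel is `0` for the time lag `0`, which is a null set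
    have hne : ∀ᵐ s ∂μ, s ≠ t := hμac.ae_le (Measure.ae_ne volume t)
    filter_upwards [ae_restrict_mem measurableSet_Ioc, hne] with s h5 h6
    have h7 : t - s ∈ Ioi (0 : ℝ) := by
      rw [mem_Ioi, sub_pos]
      exact lt_of_le_of_ne h5.2 h6
    simp only [hZ, hY, profileKernel, indicator_of_mem h7]
    push_cast
    ring
  rw [e2, ← integral_sub_left_eq_self Z volume t, ← integral_const_mul]
  congr 1
  ext s
  simp only [hZ, damped]
  have e5 : (Real.exp (γ * (t - s)) : ℂ) = (Real.exp (γ * t) : ℂ) * (Real.exp (-γ * s) : ℂ) := by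
    rw [← Complex.ofReal_mul, ← Real.exp_add]
    congr 2
    ring
  rw [e5, sub_sub_cancel]
  ring

end ProfileModes

/-! ### The equation in Fourier modes -/

/-- `u k t` are the Fourier coefficients in `x` of `U(t, ·)` for almost every `t > 0`, chosen
measurable in `t` and set to `0` for `t ≤ 0`. -/
structure TimeModes (U : ℝ × Torus d → ℂ) (u : (Fin d → ℤ) → ℝ → ℂ) : Prop where
  meas : ∀ k, Measurable (u k)
  supp : ∀ k t, t ≤ 0 → u k t = 0
  eq : ∀ᵐ t : ℝ, 0 < t → ∀ k, u k t = coef k fun x => U (t, x)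

theorem exists_timeModes {U : ℝ × Torus d → ℂ} (hU : AEStronglyMeasurable U) :
    ∃ u, TimeModes U u := by
  refine ⟨fun k => (Ioi 0).indicator fun t => coef k fun x => hU.mk U (t, x), ?_, ?_, ?_⟩
  · exact fun k => (measurable_coef hU.stronglyMeasurable_mk k).indicator measurableSet_Ioi
  · exact fun k t ht => indicator_of_notMem (notMem_Ioi.mpr ht) _
  · filter_upwards [Measure.ae_ae_of_ae_prod hU.ae_eq_mk] with t h1 h2 k
    rw [indicator_of_mem (mem_Ioi.mpr h2)]
    exact (coef_congr_ae h1).symm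

theorem eLpNorm_two_sq_prod {μ : Measure ℝ} [SFinite μ] {U : ℝ × Torus d → ℂ}
    (hU : AEStronglyMeasurable U (μ.prod volume)) :
    eLpNorm U 2 (μ.prod volume) ^ 2 = ∫⁻ t, (∫⁻ x, ‖U (t, x)‖ₑ ^ 2) ∂μ := by
  rw [eLpNorm_eq_lintegral_rpow_enorm_toReal (by simp) (by simp)]
  simp only [ENNReal.toReal_ofNat, ENNReal.rpow_ofNat]
  rw [ennreal_rpow_half_sq, lintegral_prod _ (hU.enorm.pow_const 2)]

theorem volume_restrict_prod_univ (S : Set ℝ) :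
    (volume : Measure (ℝ × Torus d)).restrict (S ×ˢ univ) = (volume.restrict S).prod volume := by
  rw [Measure.restrict_prod_eq_prod_univ]
  rfl

/-- Parseval's identity in `x`, integrated over times in `S`. -/
theorem TimeModes.seqNorm_sq {U : ℝ × Torus d → ℂ} {u : (Fin d → ℤ) → ℝ → ℂ} (hu : TimeModes U u)
    (hm : AEStronglyMeasurable U) (h2 : ∀ᵐ t : ℝ, MemLp (fun x => U (t, x)) 2)
    (h0 : ∀ᵐ z : ℝ × Torus d, z.1 < 0 → U z = 0) {S : Set ℝ} (hS : MeasurableSet S) :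
    ENNReal.ofReal ((2 * π) ^ d) *
        seqNorm (fun k t => S.indicator (fun _ => 1) t * ‖u k t‖ₑ) ^ 2
      = eLpNorm U 2 (volume.restrict (S ×ˢ univ)) ^ 2 := by
  have mi : Measurable (S.indicator fun _ => (1 : ℝ≥0∞)) := measurable_const.indicator hS
  have mu := hu.meas
  rw [volume_restrict_prod_univ, eLpNorm_two_sq_prod (by rw [← volume_restrict_prod_univ]; exact hm.restrict),
    VlasovPenrose.seqNorm_sq fun k => by fun_prop, ← lintegral_tsum fun k => by fun_prop,
    ← lintegral_const_mul' _ _ ENNReal.ofReal_ne_top, ← lintegral_indicator hS]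
  refine lintegral_congr_ae ?_
  filter_upwards [hu.eq, h2, Measure.ae_ae_of_ae_prod h0, Measure.ae_ne volume 0] with t h3 h4 h5 h6
  by_cases ht : t ∈ S
  · simp only [indicator_of_mem ht, one_mul]
    rcases lt_or_gt_of_ne h6 with h7 | h7
    · have : ∫⁻ x, ‖U (t, x)‖ₑ ^ 2 = 0 := by
        rw [lintegral_congr_ae (g := fun _ => 0), lintegral_zero]
        filter_upwards [h5] with x hx
        simp [hx h7]
      simp [this, hu.supp _ t h7.le]
    · rw [lintegral_enorm_sq_eq_tsum_coef h4]
      simp only [h3 h7]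
  · simp [ht]

section LocallySquareIntegrable
variable {h : ℝ × Torus d → ℂ}

theorem aestronglyMeasurable_of_forall_Iic
    (hT : ∀ T : ℝ, MemLp h 2 (volume.restrict (Iic T ×ˢ univ))) : AEStronglyMeasurable h := by
  have hU : (⋃ N : ℕ, Iic (N : ℝ) ×ˢ (univ : Set (Torus d))) = univ := by
    refine eq_univ_of_forall fun z => mem_iUnion.mpr ?_
    obtain ⟨N, hN⟩ := exists_nat_ge z.1
    exact ⟨N, hN, mem_univ _⟩
  rw [← Measure.restrict_univ (μ := (volume : Measure (ℝ × Torus d))), ← hU,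
    aestronglyMeasurable_iUnion_iff]
  exact fun N => (hT N).1

theorem ae_memLp_slice_of_forall_Iic
    (hT : ∀ T : ℝ, MemLp h 2 (volume.restrict (Iic T ×ˢ univ))) :
    ∀ᵐ t : ℝ, MemLp (fun x => h (t, x)) 2 := by
  have h1 : ∀ N : ℕ, ∀ᵐ t : ℝ, t ∈ Iic (N : ℝ) → MemLp (fun x => h (t, x)) 2 := fun N => by
    have h2 := hT N
    rw [volume_restrict_prod_univ] at h2
    exact (ae_restrict_iff' measurableSet_Iic).mp (ae_memLp_two_of_memLp_prod h2)
  filter_upwards [ae_all_iff.mpr h1] with t ht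
  obtain ⟨N, hN⟩ := exists_nat_ge t
  exact ht N hN

theorem lintegral_slice_norm_ne_top
    (hT : ∀ T : ℝ, MemLp h 2 (volume.restrict (Iic T ×ˢ univ))) (t : ℝ) :
    ∫⁻ s in Ioc 0 t, (∫⁻ x, ‖h (s, x)‖ₑ ^ 2) ^ (1 / 2 : ℝ) ≠ ⊤ := by
  have h1 := hT t
  rw [volume_restrict_prod_univ] at h1
  have h2 : ∫⁻ s in Ioc 0 t, ∫⁻ x, ‖h (s, x)‖ₑ ^ 2 ≠ ⊤ := by
    refine ne_top_of_le_ne_top ?_ (lintegral_mono_set (t := Iic t) fun s hs => hs.2)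
    rw [← eLpNorm_two_sq_prod h1.1]
    exact ENNReal.pow_ne_top h1.2.ne
  refine ne_top_of_le_ne_top (b := ∫⁻ s in Ioc 0 t, (1 + ∫⁻ x, ‖h (s, x)‖ₑ ^ 2)) ?_
    (lintegral_mono fun s => ?_)
  · rw [lintegral_add_left measurable_const]
    exact ENNReal.add_ne_top.mpr ⟨by simp, h2⟩
  · rcases le_total (∫⁻ x, ‖h (s, x)‖ₑ ^ 2) 1 with h3 | h3
    · exact (ENNReal.rpow_le_one h3 (by norm_num)).trans le_self_add
    · refine le_trans ?_ le_add_self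
      exact (ENNReal.rpow_le_rpow_of_exponent_le h3 (by norm_num)).trans_eq (ENNReal.rpow_one _)

end LocallySquareIntegrable

/-- The integral equation, written for the Fourier modes in `x`. For `t ≤ 0` both sides vanish: the kernel
lives on positive time lags and the modes on positive times. -/
theorem ProfileModes.modeEq {f₀ : Torus d × Vel d → ℝ} {φ : (Fin d → ℤ) → Vel d → ℂ}
    {A : (Fin d → ℤ) → ℝ} (hG : ProfileModes (gradV f₀) φ A) {ε : ℝ} (hε : 0 < ε) {γ : ℝ}
    {h R : ℝ × Torus d → ℂ} (hT : ∀ T : ℝ, MemLp h 2 (volume.restrict (Iic T ×ˢ univ)))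
    (hR : MemLp R 2) (heq : SolvesEq f₀ ε γ h R) {hh RR : (Fin d → ℤ) → ℝ → ℂ}
    (hhm : TimeModes h hh) (hRm : TimeModes R RR) : ModeEq γ (profileKernel ε φ) hh RR where
  meas := hhm.meas
  meas_source := hRm.meas
  supp k t ht := hhm.supp k t ht.le
  supp_source k t ht := hRm.supp k t ht.le
  eq k := by
    have h2 := ae_memLp_slice_of_forall_Iic hT
    filter_upwards [hhm.eq, hRm.eq, h2, ae_memLp_two_of_memLp_prod (μ := volume) hR,
      Measure.ae_ae_of_ae_prod heq] with t h3 h4 h5 h6 h7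
    rcases le_or_gt t 0 with ht | ht
    · have h8 : volterra γ (profileKernel ε φ) hh k t = 0 := by
        unfold volterra damped
        rw [← tsum_zero (β := Fin d → ℤ)]
        refine tsum_congr fun n => ?_
        rw [← integral_zero ℝ ℂ]
        congr 1
        ext s
        rcases le_or_gt s 0 with hs | hs
        · simp [profileKernel, hs]
        · simp [hhm.supp (k - n) (t - s) (by linarith)]
      rw [h8, hhm.supp k t ht, hRm.supp k t ht, add_zero]
    · rw [h3 ht, h4 ht]
      have h8 : (fun x => h (t, x)) =ᵐ[volume] fun x => (Real.exp (-γ * t) : ℂ) *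
          opK (gradV f₀) (fun y => (Real.exp (γ * y.1) : ℂ) * resolvent ε h y) (t, x) + R (t, x) := h7
      have hi := h5.integrable (by norm_num)
      have hRi := h6.integrable (by norm_num)
      have h9 : Integrable fun x => (Real.exp (-γ * t) : ℂ) *
          opK (gradV f₀) (fun y => (Real.exp (γ * y.1) : ℂ) * resolvent ε h y) (t, x) := by
        refine (hi.sub hRi).congr ?_
        filter_upwards [h8] with x hx
        simp [hx]
      rw [coef_congr_ae h8, coef_add h9 hRi, coef_const_mul,
        hG.coef_opK_eq hε γ (aestronglyMeasurable_of_forall_Iic hT) h2 hhm.supp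
          (fun k => hhm.eq.mono fun s h ht => h ht k) ht (lintegral_slice_norm_ne_top hT t) k,
        ← mul_assoc, ← Complex.ofReal_mul, ← Real.exp_add]
      simp

/-! ### The `L²` estimate -/

/-- A sequence of lower bounds is dominated by a continuous monotone positive function: the step function of
its partial sums, averaged over `[y, y + 1]`. -/
theorem exists_continuous_monotone_ge (l : ℕ → ℝ) (hl : ∀ N, 1 ≤ l N) :
    ∃ Λ : ℝ → ℝ, Continuous Λ ∧ Monotone Λ ∧ (∀ y, 0 < Λ y) ∧ ∀ y, l ⌈y⌉₊ ≤ Λ y := by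
  set g : ℝ → ℝ := fun y => ∑ i ∈ Finset.range (⌈y⌉₊ + 1), l i with hg
  have hmono : Monotone g := fun x y hxy =>
    Finset.sum_le_sum_of_subset_of_nonneg
      (Finset.range_mono (Nat.add_le_add_right (Nat.ceil_mono hxy) 1))
      fun i _ _ => zero_le_one.trans (hl i)
  have hle : ∀ y, l ⌈y⌉₊ ≤ g y := fun y =>
    Finset.single_le_sum (f := l) (fun i _ => zero_le_one.trans (hl i))
      (Finset.mem_range.mpr (Nat.lt_succ_self _))
  have hint : ∀ a b, IntervalIntegrable g volume a b := fun a b => hmono.intervalIntegrable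
  have hge : ∀ y, g y ≤ ∫ s in y..y + 1, g s := by
    intro y
    have := intervalIntegral.integral_mono_on (a := y) (b := y + 1) (f := fun _ => g y) (g := g)
      (by linarith) intervalIntegrable_const (hint _ _) fun s hs => hmono hs.1
    simpa using this
  refine ⟨fun y => ∫ s in y..y + 1, g s, ?_, ?_, ?_, fun y => (hle y).trans (hge y)⟩
  · have h1 := intervalIntegral.continuous_primitive hint 0
    have h2 : (fun y => ∫ s in y..y + 1, g s)
        = fun y => (∫ s in (0 : ℝ)..y + 1, g s) - ∫ s in (0 : ℝ)..y, g s := by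
      ext y
      rw [intervalIntegral.integral_interval_sub_left (hint _ _) (hint _ _)]
    rw [h2]
    exact (h1.comp (continuous_add_const 1)).sub h1
  · intro x y hxy
    have e : ∀ z : ℝ, ∫ s in z..z + 1, g s = ∫ s in (0 : ℝ)..1, g (s + z) := fun z => by
      rw [intervalIntegral.integral_comp_add_right (fun s => g s)]
      ring_nf
    dsimp only
    rw [e, e]
    refine intervalIntegral.integral_mono_on zero_le_one ?_ ?_ fun s _ => hmono (by linarith)
    · exact Monotone.intervalIntegrable fun a b hab => hmono (by linarith)
    · exact Monotone.intervalIntegrable fun a b hab => hmono (by linarith)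
  · exact fun y => zero_lt_one.trans_le ((hl _).trans ((hle y).trans (hge y)))

/-- The `L²` estimate, for a given bound `B` for the Fourier modes of the profile. -/
theorem exists_l2_bound (d : ℕ) {c₀ B : ℝ} (hc₀ : 0 < c₀) (hB : 0 ≤ B) :
    ∃ l : ℝ, 1 ≤ l ∧ ∀ (f₀ : Torus d × Vel d → ℝ) (φ : (Fin d → ℤ) → Vel d → ℂ)
      (A : (Fin d → ℤ) → ℝ), ProfileModes (gradV f₀) φ A → (∑' n, (1 + ‖n‖) * A n ≤ B) →
      (∀ᵐ x : Torus d, PenroseStable c₀ (fun v => gradV f₀ (x, v))) →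
      ∀ γ ε : ℝ, l ≤ γ → 0 < ε → ∀ h R : ℝ × Torus d → ℂ,
      (∀ T : ℝ, MemLp h 2 (volume.restrict (Iic T ×ˢ univ))) → MemLp R 2 →
      (∀ᵐ z : ℝ × Torus d, z.1 < 0 → h z = 0) → (∀ᵐ z : ℝ × Torus d, z.1 < 0 → R z = 0) →
      SolvesEq f₀ ε γ h R →
      MemLp h 2 ∧ eLpNorm h 2 ≤ ENNReal.ofReal l * eLpNorm R 2 := by
  set c := min c₀ 1 with hc
  have hc0 : 0 < c := lt_min hc₀ one_pos
  obtain ⟨Γ, hΓ, H⟩ := seqNorm_le_of_modeEq d hc0 (B := B * π) (by positivity)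
  -- `1` and `3 B Γ / c` are the thresholds for `γ`, `4 / c` is the constant of the estimate
  refine ⟨max 1 (max (4 / c) (3 * B * Γ / c)), le_max_left _ _, ?_⟩
  intro f₀ φ A hG hA hst γ ε hγ hε h R hT hR h0 R0 heq
  have hγ1 : 1 ≤ γ := (le_max_left _ _).trans hγ
  have hγ2 : 3 * B * Γ / c ≤ γ := ((le_max_right _ _).trans (le_max_right _ _)).trans hγ
  have hm := aestronglyMeasurable_of_forall_Iic hT
  have h2 := ae_memLp_slice_of_forall_Iic hT
  have R2 := ae_memLp_two_of_memLp_prod (μ := volume) hR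
  obtain ⟨hh, hhm⟩ := exists_timeModes hm
  obtain ⟨RR, hRm⟩ := exists_timeModes hR.1
  have hK : ENNReal.ofReal ((2 * π) ^ d) ≠ 0 := (ENNReal.ofReal_pos.mpr (by positivity)).ne'
  have fin : ∀ {U : ℝ × Torus d → ℂ} {S : Set ℝ} {X : ℝ≥0∞},
      ENNReal.ofReal ((2 * π) ^ d) * X ^ 2 = eLpNorm U 2 (volume.restrict (S ×ˢ univ)) ^ 2 →
      MemLp U 2 (volume.restrict (S ×ˢ univ)) → X ≠ ⊤ := by
    rintro U S X hX hU rfl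
    rw [ENNReal.top_pow (by norm_num), ENNReal.mul_top hK] at hX
    exact ENNReal.pow_ne_top hU.2.ne hX.symm
  have eh := hhm.seqNorm_sq hm h2 h0 MeasurableSet.univ
  have eR := hRm.seqNorm_sq hR.1 R2 R0 MeasurableSet.univ
  have hRfin := fin eR (hR.restrict _)
  simp only [univ_prod_univ, Measure.restrict_univ, indicator_univ, one_mul] at eh eR hRfin
  have hsum : ∑' n, A n ≤ B := le_trans
    (hG.summable_A.tsum_le_tsum (fun n => le_mul_of_one_le_left (hG.nonneg n) (by simp)) hG.summable) hA
  have key := H (profileKernel ε φ) _ _ _ (hG.penroseKernel hst hε)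
    (by simp only [← mul_assoc, tsum_mul_right]; gcongr) γ hγ1
    (by
      rw [tsum_mul_left]
      rw [div_le_iff₀ hc0] at hγ2
      calc 3 * (∑' n, A n) * Γ ≤ 3 * B * Γ := by gcongr
        _ ≤ c * γ := by linarith) hh RR (hG.modeEq hε hT hR heq hhm hRm) hRfin
    fun T => fin (hhm.seqNorm_sq hm h2 h0 measurableSet_Iic) (hT T)
  have key2 : ENNReal.ofReal (c / 4) * eLpNorm h 2 ≤ eLpNorm R 2 := by
    rw [← ennreal_sq_le_sq_iff, mul_pow, ← eh, ← eR, mul_left_comm, ← mul_pow]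
    gcongr
  have key3 : eLpNorm h 2 ≤ ENNReal.ofReal (4 / c) * eLpNorm R 2 := by
    refine le_trans (le_of_eq ?_) (mul_le_mul_right key2 (ENNReal.ofReal (4 / c)))
    rw [← mul_assoc, ← ENNReal.ofReal_mul (by positivity)]
    field_simp
    simp
  refine ⟨⟨hm, key3.trans_lt (ENNReal.mul_lt_top ENNReal.ofReal_lt_top hR.2)⟩, key3.trans ?_⟩
  gcongr
  exact (le_max_left _ _).trans (le_max_right _ _)

end VlasovPenrose
end

theorem mainTheorem6 (d m : ℕ) (r c₀ : ℝ) (hd : 1 ≤ d) (hm : 4 + (d : ℝ) / 2 < 2 * (m : ℝ))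
    (hr : 2 + (d : ℝ) / 2 < 2 * r) (hc₀ : 0 < c₀) :
    ∃ Λ : ℝ → ℝ, Continuous Λ ∧ Monotone Λ ∧ (∀ y, 0 < Λ y) ∧
      ∀ f₀ : Torus d × Vel d → ℝ, MemH (2 * m) (2 * r) f₀ →
        (∀ᵐ x : Torus d, PenroseStable c₀ (fun v => gradV f₀ (x, v))) →
        ∀ γ : ℝ, Λ (normH (2 * m) (2 * r) f₀) ≤ γ →
        ∀ ε : ℝ, 0 < ε → ε ≤ 1 →
        ∀ h R : ℝ × Torus d → ℂ,
          (∀ T : ℝ, MemLp h 2 (volume.restrict (Set.Iic T ×ˢ Set.univ))) →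
          MemLp R 2 volume →
          (∀ᵐ z : ℝ × Torus d, z.1 < 0 → h z = 0) →
          (∀ᵐ z : ℝ × Torus d, z.1 < 0 → R z = 0) →
          SolvesEq f₀ ε γ h R →
          MemLp h 2 volume ∧
            eLpNorm h 2 volume ≤
              ENNReal.ofReal (Λ (normH (2 * m) (2 * r) f₀)) * eLpNorm R 2 volume := by
  obtain ⟨C, hC, hmodes⟩ := exists_profileModes m r hd hm hr
  -- the bounds depend only on the least integer above the norm of the profile
  choose l hl1 hl using fun N : ℕ => exists_l2_bound d hc₀ (B := C * N) (by positivity)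
  obtain ⟨Λ, hΛc, hΛm, hΛp, hΛ⟩ := exists_continuous_monotone_ge l hl1
  refine ⟨Λ, hΛc, hΛm, hΛp, fun f₀ hf hst γ hγ ε hε _ h R hT hR h0 R0 heq => ?_⟩
  obtain ⟨φ, A, hG, hA⟩ := hmodes f₀ hf
  have hΛ0 := hΛ (normH (2 * m) (2 * r) f₀)
  have hA' : ∑' n, (1 + ‖n‖) * A n ≤ C * ⌈normH (2 * m) (2 * r) f₀⌉₊ :=
    hA.trans (mul_le_mul_of_nonneg_left (Nat.le_ceil _) hC)
  obtain ⟨h1, h2⟩ := hl _ f₀ φ A hG hA' hst γ ε (hΛ0.trans hγ) hε h R hT hR h0 R0 heq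
  refine ⟨h1, h2.trans ?_⟩
  gcongr
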